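/- A hypergraph $G=(V,E)$ has $n=|V|$ nodes and a set $E$ of nonempty hyperedges. A $k$-way partitioning assigns each node to one of the parts $P_1,\dots,P_k$ (parts may be empty). With $\lambda_e$ the number of parts that $e\in E$ intersects, its cost is either $|\{e\in E:\lambda_e>1\}|$ (cut-net) or $\sum_{e\in E}(\lambda_e-1)$ (connectivity); the claims hold for each of the two metrics. In the $c$-constraint $\epsilon$-balanced partitioning problem the input also contains disjoint sets $V_1,\dots,V_c\subseteq V$, and a partitioning is feasible if $|P_i\cap V_j|\le(1+\epsilon)\frac{|V_j|}{k}$ for all $i\in[k]$, $j\in[c]$. For $\epsilon=0$ this is $c$-constraint $k$-section; standard $k$-section has the single constraint $|P_i|\le\frac nk$ for all $i\in [k]$. The goal is a feasible partitioning of minimum cost. Polynomial time means polynomial in $n+|E|$. A polynomial-time $\alpha$-approximation algorithm halts in polynomial time on every admitted instance, and whenever a feasible partitioning exists, it outputs one of cost at most $\alpha(n)$ times the minimum. Let $k\ge2$ and $c\ge0$ be constants. 1. There is a polynomial-time reduction from $c$-constraint $k$-section to standard $k$-section: a polynomial-time transformation of each $c$-constraint instance $I$ on $n$ nodes into a hypergraph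 $f(I)$ on $O(n^{c+1})$ nodes such that every feasible partitioning of $I$ gives rise to a $k$-section of $f(I)$ of the same cost, and a polynomial-time transformation of each $k$-section of $f(I)$ into a feasible partitioning of $I$ of no larger cost. 2. Let $\alpha:\mathbb N\to[1,\infty)$ be nondecreasing. If standard $k$-section has a polynomial-time $\alpha(n)$-approximation algorithm, then $c$-constraint $k$-section has a polynomial-time approximation algorithm of factor $O(\alpha(n^{c+1}))$. Moreover, for every $h$ there is an $h'$, independent of $\alpha$, such that the same holds if the given algorithm is only required to work for hypergraphs with $|E|\le n^{h'}$ and the resulting one only for hypergraphs with $|E|\le n^{h}$. The constants in $O(\cdot)$ do not depend on $\alpha$ or $h$. 3. Let $\epsilon\ge0$ be a constant that is rational or, more generally, a real number for which $\lfloor(1+\epsilon)\frac mk\rfloor$ can be computed from $m$ in time polynomial in $m$. Then the decision version of $c$-constraint $\epsilon$-balanced $k$-way partitioning (given an instance and $L\in\mathbb N$, is there a feasible partitioning of cost at most $L$?) is in XP with respect to $L$: there are a single algorithm and a computable function $\varphi$ such that the algorithm decides it in time at most $(n+|E|+2)^{\varphi(L)}$. -/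

import Mathlib

/-! ### Machine model

The language WHILE over binary trees (Jones, *Computability and Complexity from a Programming
Perspective*): finitely many variables holding trees, constant-time `cons`, `hd`, `tl` and
`nil`-test, `while` loops, one time unit per operation. Its running times and those of Turing
machines agree up to polynomials. -/

/-- Data values: binary trees with unlabelled leaves. -/
inductive Tr : Type
  | nil : Tr
  | cons : Tr → Tr → Tr

namespace Tr

/-- First component (`nil` at `nil`). -/
def hd : Tr → Tr
  | nil => nil
  | cons a _ => a

/-- Second component (`nil` at `nil`). -/
def tl : Tr → Tr
  | nil => nil
  | cons _ b => b

end Tr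

/-- A store assigns a value to each variable; variables are numbered. -/
abbrev Store : Type := ℕ → Tr

/-- Expressions. -/
inductive Expr : Type
  | var : ℕ → Expr
  | nil : Expr
  | cons : Expr → Expr → Expr
  | hd : Expr → Expr
  | tl : Expr → Expr

namespace Expr

/-- Value of an expression. -/
def eval (s : Store) : Expr → Tr
  | var x => s x
  | nil => Tr.nil
  | cons a b => Tr.cons (a.eval s) (b.eval s)
  | hd a => (a.eval s).hd
  | tl a => (a.eval s).tl

/-- Number of operations performed to evaluate an expression. -/
def cost : Expr → ℕ
  | var _ => 1
  | nil => 1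
  | cons a b => a.cost + b.cost + 1
  | hd a => a.cost + 1
  | tl a => a.cost + 1

end Expr

/-- Programs. The tests of `ite` and `loop` ask whether the value differs from `nil`. -/
inductive Cmd : Type
  | assign : ℕ → Expr → Cmd
  | seq : Cmd → Cmd → Cmd
  | ite : Expr → Cmd → Cmd → Cmd
  | loop : Expr → Cmd → Cmd

/-- `Exec p s s' t`: started in the store `s`, the program `p` halts in the store `s'` after
exactly `t` time units. -/
inductive Exec : Cmd → Store → Store → ℕ → Prop
  | assign (x : ℕ) (e : Expr) (s : Store) :
      Exec (Cmd.assign x e) s (Function.update s x (e.eval s)) (e.cost + 1)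
  | seq {p q : Cmd} {s s' s'' : Store} {t t' : ℕ} :
      Exec p s s' t → Exec q s' s'' t' → Exec (Cmd.seq p q) s s'' (t + t')
  | iteTrue {e : Expr} {p q : Cmd} {s s' : Store} {t : ℕ} :
      e.eval s ≠ Tr.nil → Exec p s s' t → Exec (Cmd.ite e p q) s s' (e.cost + 1 + t)
  | iteFalse {e : Expr} {p q : Cmd} {s s' : Store} {t : ℕ} :
      e.eval s = Tr.nil → Exec q s s' t → Exec (Cmd.ite e p q) s s' (e.cost + 1 + t)
  | loopDone {e : Expr} {p : Cmd} {s : Store} :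
      e.eval s = Tr.nil → Exec (Cmd.loop e p) s s (e.cost + 1)
  | loopStep {e : Expr} {p : Cmd} {s s' s'' : Store} {t t' : ℕ} :
      e.eval s ≠ Tr.nil → Exec p s s' t → Exec (Cmd.loop e p) s' s'' t' →
      Exec (Cmd.loop e p) s s'' (e.cost + 1 + t + t')

/-- On input `a` (in variable `0`, all other variables being `nil`) the program `p` halts within
`T` time units with output `b` (in variable `0`). -/
def RunsIn (p : Cmd) (a b : Tr) (T : ℕ) : Prop :=
  ∃ (s : Store) (t : ℕ),
    Exec p (Function.update (fun _ => Tr.nil) 0 a) s t ∧ t ≤ T ∧ s 0 = b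

/-- `f` is computable, with respect to the given encodings, in time polynomial in `size`. -/
def PolyTime {A B : Type*} (encA : A → Tr) (encB : B → Tr) (size : A → ℕ) (f : A → B) : Prop :=
  ∃ (p : Cmd) (C d : ℕ), ∀ a, RunsIn p (encA a) (encB (f a)) (C * (size a + 1) ^ d)

/-! ### Encodings -/

/-- A list of trees as one tree. -/
def encList : List Tr → Tr
  | [] => Tr.nil
  | a :: l => Tr.cons a (encList l)

/-- Natural numbers in unary. -/
def encNat (m : ℕ) : Tr := encList (List.replicate m Tr.nil)

/-- Truth values: `nil` is false. -/
def encBool (b : Bool) : Tr := if b then Tr.cons Tr.nil Tr.nil else Tr.nil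

/-- A set of nodes, as its characteristic vector. -/
def encSet {n : ℕ} (e : Finset (Fin n)) : Tr :=
  encList (List.ofFn fun v => encBool (decide (v ∈ e)))

/-- A `k`-way partitioning, as the list of the part numbers of the nodes. -/
def encPart {n k : ℕ} (P : Fin n → Fin k) : Tr :=
  encList (List.ofFn fun v => encNat (P v))

/-! ### Hypergraphs and partitionings -/

/-- A hypergraph on the nodes `0, …, n - 1`, presented by listing its set of (nonempty)
hyperedges without repetition, in any order. -/
structure HGraph : Type where
  n : ℕ
  edges : List (Finset (Fin n))
  nodup : edges.Nodup
  nonempty : ∀ e ∈ edges, e.Nonempty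

/-- Input size, up to polynomials: number of nodes plus number of hyperedges. -/
def HGraph.size (H : HGraph) : ℕ := H.n + H.edges.length

/-- The number of nodes followed by the incidence matrix. -/
def HGraph.enc (H : HGraph) : Tr :=
  Tr.cons (encNat H.n) (encList (H.edges.map encSet))

/-- An instance with `c` balance constraints: a hypergraph with disjoint node sets
`V 0, …, V (c - 1)`. -/
structure MultiInst (c : ℕ) extends HGraph where
  V : Fin c → Finset (Fin n)
  disj : ∀ i j, i ≠ j → Disjoint (V i) (V j)

/-- The hypergraph followed by the characteristic vectors of the constraint sets. -/
def MultiInst.enc {c : ℕ} (I : MultiInst c) : Tr :=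
  Tr.cons I.toHGraph.enc (encList (List.ofFn fun j => encSet (I.V j)))

/-- The two cost metrics. -/
inductive Metric : Type
  | cutNet
  | connectivity

/-- Number of parts that the hyperedge `e` intersects. -/
def lam {n k : ℕ} (P : Fin n → Fin k) (e : Finset (Fin n)) : ℕ := (e.image P).card

/-- Cost of a partitioning `P` (node `v` lies in part `P v`): the number of cut hyperedges, or the
sum of `lam P e - 1` over all hyperedges (which are nonempty, so `1 ≤ lam P e`). -/
def HGraph.cost (H : HGraph) {k : ℕ} (P : Fin H.n → Fin k) : Metric → ℕ
  | Metric.cutNet => (H.edges.filter fun e => decide (1 < lam P e)).length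
  | Metric.connectivity => (H.edges.map fun e => lam P e - 1).sum

/-- The `ε`-balance constraint on the node set `S`:
`|Pᵢ ∩ S| ≤ (1 + ε) |S| / k` for every part `Pᵢ`. -/
def BalancedOn {n k : ℕ} (ε : ℝ) (S : Finset (Fin n)) (P : Fin n → Fin k) : Prop :=
  ∀ i : Fin k, ((S.filter fun v => P v = i).card : ℝ) ≤ (1 + ε) * ((S.card : ℝ) / (k : ℝ))

/-- `P` is a `k`-section of the hypergraph: it is `0`-balanced. -/
def HGraph.IsSection (H : HGraph) {k : ℕ} (P : Fin H.n → Fin k) : Prop :=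
  BalancedOn 0 Finset.univ P

/-- `P` satisfies the `ε`-balance constraint on each of the sets `V j`. -/
def MultiInst.Feasible {c : ℕ} (I : MultiInst c) (ε : ℝ) {k : ℕ} (P : Fin I.n → Fin k) : Prop :=
  ∀ j, BalancedOn ε (I.V j) P

/-! ### Algorithmic statements -/

/-- On the hypergraphs in the class `S`, `k`-section has a polynomial-time approximation algorithm
of factor `α n`: it always halts in polynomial time, and if some `k`-section exists, then it
outputs one whose cost is at most `α n` times the cost of any other. -/
def SectionApprox (k : ℕ) (μ : Metric) (S : HGraph → Prop) (α : ℕ → ℝ) : Prop :=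
  ∃ (p : Cmd) (C d : ℕ), ∀ H : HGraph, S H →
    ∃ out : Tr, RunsIn p H.enc out (C * (H.size + 1) ^ d) ∧
      ((∃ Q : Fin H.n → Fin k, H.IsSection Q) →
        ∃ P : Fin H.n → Fin k, out = encPart P ∧ H.IsSection P ∧
          ∀ Q : Fin H.n → Fin k, H.IsSection Q →
            (H.cost P μ : ℝ) ≤ α H.n * (H.cost Q μ : ℝ))

/-- The same for `k`-section with `c` balance constraints, on the instances whose hypergraph lies
in the class `S`. -/
def MultiSectionApprox (k c : ℕ) (μ : Metric) (S : HGraph → Prop) (α : ℕ → ℝ) : Prop :=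
  ∃ (p : Cmd) (C d : ℕ), ∀ I : MultiInst c, S I.toHGraph →
    ∃ out : Tr, RunsIn p I.enc out (C * (I.size + 1) ^ d) ∧
      ((∃ Q : Fin I.n → Fin k, I.Feasible 0 Q) →
        ∃ P : Fin I.n → Fin k, out = encPart P ∧ I.Feasible 0 P ∧
          ∀ Q : Fin I.n → Fin k, I.Feasible 0 Q →
            (I.cost P μ : ℝ) ≤ α I.n * (I.cost Q μ : ℝ))

/-- A polynomial-time reduction from `c`-constraint `k`-section to `k`-section: `f` transforms
instances, `g` transforms partitionings back, costs are preserved, and the number of nodes grows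
to at most `K * n ^ (c + 1)`. -/
def MultiSectionReduces (k c : ℕ) (μ : Metric) : Prop :=
  ∃ (f : MultiInst c → HGraph)
    (g : (I : MultiInst c) → (Fin (f I).n → Fin k) → (Fin I.n → Fin k)) (K : ℕ),
    PolyTime MultiInst.enc HGraph.enc (fun I => I.size) f ∧
    PolyTime (A := (I : MultiInst c) × (Fin (f I).n → Fin k))
      (B := (I : MultiInst c) × (Fin I.n → Fin k))
      (fun x => Tr.cons x.1.enc (encPart x.2)) (fun y => encPart y.2)
      (fun x => x.1.size) (fun x => ⟨x.1, g x.1 x.2⟩) ∧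
    ∀ I : MultiInst c,
      (f I).n ≤ K * I.n ^ (c + 1) ∧
      (∀ P : Fin I.n → Fin k, I.Feasible 0 P →
        ∃ P' : Fin (f I).n → Fin k, (f I).IsSection P' ∧ (f I).cost P' μ = I.cost P μ) ∧
      (∀ P' : Fin (f I).n → Fin k, (f I).IsSection P' →
        I.Feasible 0 (g I P') ∧ I.cost (g I P') μ ≤ (f I).cost P' μ)

/-- The balance thresholds `⌊(1 + ε) m / k⌋` are computable from `m` in time polynomial in `m`. -/
def ThresholdPolyTime (k : ℕ) (ε : ℝ) : Prop :=
  PolyTime encNat encNat (fun m => m) fun m : ℕ => ⌊(1 + ε) * ((m : ℝ) / (k : ℝ))⌋₊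

/-- The decision version of `ε`-balanced `k`-way partitioning with `c` balance constraints (given
an instance and `L`, is there a feasible partitioning of cost at most `L`?) is in XP with respect
to `L`: one algorithm decides it within `N ^ φ L` steps, for a computable `φ`, where `N` is the
number of nodes and hyperedges (plus `2`, so that the base is never degenerate). -/
def MultiPartitionInXP (k c : ℕ) (ε : ℝ) (μ : Metric) : Prop :=
  ∃ (p : Cmd) (φ : ℕ → ℕ), Computable φ ∧ ∀ (I : MultiInst c) (L : ℕ),
    ∃ b : Bool,
      RunsIn p (Tr.cons I.enc (encNat L)) (encBool b) ((I.size + 2) ^ φ L) ∧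
      (b = true ↔ ∃ P : Fin I.n → Fin k, I.Feasible ε P ∧ I.cost P μ ≤ L)

/-!
All three parts are proved for explicit WHILE programs. These are not written down: `PolyFun f` says
that some program computes `f` in polynomial time and leaves no garbage in its variables, which makes
the class closed under composition, pairing and, with a polynomial bound on the intermediate results,
folding over a list (`PolyFun.foldl`). From these closure properties every algorithm below, stated as
a function on lists and natural numbers, is seen to run in polynomial time.

**Reduction.** A node of `V j` is replaced by a block of `(a n) ^ (j + 1)` nodes, an unconstrained
node by a single one, every hyperedge by the union of the blocks of its nodes, and isolated nodes are
added so that unconstrained nodes can be balanced. If all blocks are monochromatic, then a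
`k`-section balances the block sizes, and since these belong to different powers of `a n`, the most
significant of which cannot be compensated by the others, it balances every `V j`
(`balanced_of_radix`). The blocks are held together by hyperedges inside them; as hyperedges must not
be repeated, these hyperedges contain the first node and one other node of a block, and encode a
hyperedge of the instance and a number less than `R` in the rest of the block. Splitting a block
cuts at least `R |E| / 4` of them (`MultiInst.card_le_cost_of_split`). The backward transformation
reads off the parts of the first nodes of the blocks; if the result is not feasible, then some block
has been split, so that the cyclic partitioning, whose cost is at most `(k - 1) |E|`, is cheap enough
(`MultiInst.pullback_spec`). An infeasible instance gets a number of nodes that is not divisible by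
`k`, so that there is no `k`-section at all.

**Approximation.** A nondecreasing `α` need not satisfy `α (K m) = O(α m)`, so the constructed
hypergraph must have at most `n ^ (c + 1)` nodes, without a constant factor. This is achieved with
`a = 1` and `R = 1`, and costs only a factor of `4 (k - 1)`.

**Fixed cost.** A partitioning of cost at most `L` cuts at most `L` hyperedges. The algorithm guesses
which ones, and for each of them a set of parts containing those it intersects; there are at most
`(1 + q |E|) ^ L` guesses for a constant `q` (`length_foldl_guessStep`). The other hyperedges glue the
nodes into monochromatic components, each with a set of admitted parts, and a dynamic program over the
components computes all possible tables of the numbers of nodes of `V j` in part `i`.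
-/

/-! ### Programs that leave no garbage -/

/-- The initial store on input `a`. -/
def inputStore (a : Tr) : Store := Function.update (fun _ => Tr.nil) 0 a

/-- The store whose variable `0` holds `c` and whose variable `i + 1` holds `s i`. -/
def Store.push (c : Tr) (s : Store) : Store
  | 0 => c
  | i + 1 => s i

/-- The expression with every variable index increased by one. -/
def Expr.shift : Expr → Expr
  | var x => var (x + 1)
  | nil => nil
  | cons a b => cons a.shift b.shift
  | hd a => hd a.shift
  | tl a => tl a.shift

/-- The program with every variable index increased by one, so that variable `0` is untouched. -/
def Cmd.shift : Cmd → Cmd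
  | assign x e => assign (x + 1) e.shift
  | seq p q => seq p.shift q.shift
  | ite e p q => ite e.shift p.shift q.shift
  | loop e p => loop e.shift p.shift

theorem Expr.eval_shift (c : Tr) (s : Store) (e : Expr) :
    e.shift.eval (Store.push c s) = e.eval s := by
  induction e <;> simp_all [Expr.shift, Expr.eval, Store.push]

theorem Expr.cost_shift (e : Expr) : e.shift.cost = e.cost := by
  induction e <;> simp_all [Expr.shift, Expr.cost]

theorem Store.push_update (c : Tr) (s : Store) (x : ℕ) (v : Tr) :
    Store.push c (Function.update s x v) = Function.update (Store.push c s) (x + 1) v := by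
  funext i
  cases i with
  | zero => simp [Store.push]
  | succ i => simp [Store.push, Function.update_apply]

theorem Exec.shift {p : Cmd} {s s' : Store} {t : ℕ} (c : Tr) (h : Exec p s s' t) :
    Exec p.shift (Store.push c s) (Store.push c s') t := by
  induction h with
  | assign x e s =>
    rw [Store.push_update, ← Expr.eval_shift c s e, ← Expr.cost_shift e]
    exact Exec.assign _ _ _
  | seq _ _ h1 h2 => exact Exec.seq h1 h2
  | @iteTrue e _ _ s _ _ he _ h1 =>
    rw [← Expr.cost_shift e]
    exact Exec.iteTrue (by rwa [Expr.eval_shift]) h1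
  | @iteFalse e _ _ s _ _ he _ h1 =>
    rw [← Expr.cost_shift e]
    exact Exec.iteFalse (by rwa [Expr.eval_shift]) h1
  | @loopDone e _ s he =>
    rw [← Expr.cost_shift e]
    exact Exec.loopDone (by rwa [Expr.eval_shift])
  | @loopStep e _ s _ _ _ _ he _ _ h1 h2 =>
    rw [← Expr.cost_shift e]
    exact Exec.loopStep (by rwa [Expr.eval_shift]) h1 h2

/-- A run of `p` from the input `a` that takes time `t` and ends with `b` in variable `0` and
every other variable restored to `nil`. Leaving no garbage behind is what lets programs be
composed. -/
def Runs (p : Cmd) (a b : Tr) (t : ℕ) : Prop := Exec p (inputStore a) (inputStore b) t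

theorem Runs.runsIn {p : Cmd} {a b : Tr} {t T : ℕ} (h : Runs p a b t) (hT : t ≤ T) :
    RunsIn p a b T := ⟨_, t, h, hT, by simp [inputStore]⟩

theorem Runs.expr (e : Expr) (a : Tr) :
    Runs (Cmd.assign 0 e) a (e.eval (inputStore a)) (e.cost + 1) := by
  have := Exec.assign 0 e (inputStore a)
  unfold Runs
  convert this using 1
  simp [inputStore]

theorem Runs.seq {p q : Cmd} {a b c : Tr} {t t' : ℕ} (h : Runs p a b t) (h' : Runs q b c t') :
    Runs (Cmd.seq p q) a c (t + t') := Exec.seq h h'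

/-- Exchanges the values of the variables `0` and `1`, using the variable `2`. -/
def Cmd.swap : Cmd :=
  .seq (.assign 2 (.var 0)) <| .seq (.assign 0 (.var 1)) <| .seq (.assign 1 (.var 2)) <|
  .assign 2 .nil

theorem Exec.swap (a b : Tr) :
    Exec Cmd.swap (Store.push a (inputStore b)) (Store.push b (inputStore a)) 8 := by
  have h := Exec.seq (Exec.assign 2 (.var 0) (Store.push a (inputStore b))) <|
    Exec.seq (Exec.assign 0 (.var 1) _) <| Exec.seq (Exec.assign 1 (.var 2) _) <|
    Exec.assign 2 .nil _
  unfold Cmd.swap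
  convert h using 1
  · funext i
    rcases i with _ | _ | _ | i <;> simp [inputStore, Store.push, Expr.eval]
  · rfl

/-- Runs `p` and `q` on the same input and pairs the outputs. -/
def Cmd.pair (p q : Cmd) : Cmd :=
  .seq (.assign 1 (.var 0)) <| .seq p.shift <| .seq Cmd.swap <| .seq q.shift <|
  .seq (.assign 0 (.cons (.var 0) (.var 1))) (.assign 1 .nil)

theorem Runs.pair {p q : Cmd} {a b c : Tr} {t t' : ℕ} (h : Runs p a b t) (h' : Runs q a c t') :
    Runs (p.pair q) a (Tr.cons b c) (t + t' + 16) := by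
  have h₁ : Exec (.assign 1 (.var 0)) (inputStore a) (Store.push a (inputStore a)) 2 := by
    convert Exec.assign 1 (.var 0) (inputStore a) using 1
    · funext i
      rcases i with _ | _ | i <;> simp [inputStore, Store.push, Expr.eval]
    · rfl
  have h₂ : Exec (.seq (.assign 0 (.cons (.var 0) (.var 1))) (.assign 1 .nil))
      (Store.push b (inputStore c)) (inputStore (Tr.cons b c)) 6 := by
    convert Exec.seq (Exec.assign 0 (.cons (.var 0) (.var 1)) (Store.push b (inputStore c)))
      (Exec.assign 1 .nil _) using 1
    · funext i
      rcases i with _ | _ | i <;> simp [inputStore, Store.push, Expr.eval]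
    · rfl
  have key := Exec.seq h₁ <| Exec.seq (h.shift a) <| Exec.seq (Exec.swap a b) <|
    Exec.seq (h'.shift b) h₂
  unfold Runs Cmd.pair
  convert key using 1
  ring

theorem Runs.iteTrue {e : Expr} {p q : Cmd} {a b : Tr} {t : ℕ}
    (he : e.eval (inputStore a) ≠ Tr.nil) (h : Runs p a b t) :
    Runs (Cmd.ite e p q) a b (e.cost + 1 + t) := Exec.iteTrue he h

theorem Runs.iteFalse {e : Expr} {p q : Cmd} {a b : Tr} {t : ℕ}
    (he : e.eval (inputStore a) = Tr.nil) (h : Runs q a b t) :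
    Runs (Cmd.ite e p q) a b (e.cost + 1 + t) := Exec.iteFalse he h

/-- An expression with a given closed value. -/
def Expr.quote : Tr → Expr
  | Tr.nil => Expr.nil
  | Tr.cons a b => Expr.cons (quote a) (quote b)

theorem Expr.eval_quote (s : Store) (a : Tr) : (Expr.quote a).eval s = a := by
  induction a <;> simp_all [Expr.quote, Expr.eval]

/-! ### Clearing the working variables -/

/-- Every variable that `p` assigns to is less than `p.bound`. -/
def Cmd.bound : Cmd → ℕ
  | assign x _ => x + 1
  | seq p q => max p.bound q.bound
  | ite _ p q => max p.bound q.bound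
  | loop _ p => p.bound

theorem Exec.eq_of_bound_le {p : Cmd} {s s' : Store} {t : ℕ} (h : Exec p s s' t) {x : ℕ}
    (hx : p.bound ≤ x) : s' x = s x := by
  induction h with
  | assign y e s =>
    simp only [Cmd.bound] at hx
    rw [Function.update_of_ne (by omega)]
  | seq _ _ h1 h2 =>
    simp only [Cmd.bound, max_le_iff] at hx
    rw [h2 hx.2, h1 hx.1]
  | iteTrue _ _ h1 => exact h1 (by simp only [Cmd.bound, max_le_iff] at hx; exact hx.1)
  | iteFalse _ _ h1 => exact h1 (by simp only [Cmd.bound, max_le_iff] at hx; exact hx.2)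
  | loopDone => rfl
  | loopStep _ _ _ h1 h2 => rw [h2 hx, h1 hx]

/-- Sets the variables `1, …, m` to `nil`. -/
def Cmd.clear : ℕ → Cmd
  | 0 => .assign 0 (.var 0)
  | m + 1 => .seq (.assign (m + 1) .nil) (Cmd.clear m)

theorem Exec.clear (m : ℕ) (s : Store) :
    Exec (Cmd.clear m) s (fun x => if 1 ≤ x ∧ x ≤ m then Tr.nil else s x) (2 * m + 2) := by
  induction m generalizing s with
  | zero =>
    have h : (fun x => if 1 ≤ x ∧ x ≤ 0 then Tr.nil else s x) =
        Function.update s 0 ((Expr.var 0).eval s) := by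
      funext x
      have : ¬ (1 ≤ x ∧ x ≤ 0) := by omega
      rcases x with _ | x <;> simp [Expr.eval]
    rw [h]
    exact Exec.assign _ _ _
  | succ m ih =>
    have h := Exec.seq (Exec.assign (m + 1) .nil s) (ih (Function.update s (m + 1) Tr.nil))
    unfold Cmd.clear
    convert h using 1
    · funext x
      rcases eq_or_ne x (m + 1) with rfl | hx
      · simp
      · rw [Function.update_of_ne hx]
        have : (1 ≤ x ∧ x ≤ m + 1) ↔ (1 ≤ x ∧ x ≤ m) := by omega
        simp [this]
    · simp [Expr.cost]; ring

/-- Every program can be followed by a constant-time clean-up, hence be used as a subroutine. -/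
theorem RunsIn.clean (p : Cmd) : ∃ (q : Cmd) (K : ℕ), ∀ a b T, RunsIn p a b T →
    ∃ t ≤ T + K, Runs q a b t := by
  refine ⟨.seq p (Cmd.clear p.bound), 2 * p.bound + 2, ?_⟩
  rintro a b T ⟨s, t, h, ht, rfl⟩
  refine ⟨t + (2 * p.bound + 2), by omega, ?_⟩
  have e : (fun x => if 1 ≤ x ∧ x ≤ p.bound then Tr.nil else s x) = inputStore (s 0) := by
    funext x
    rcases x with _ | x
    · simp [inputStore]
    · by_cases hx : x + 1 ≤ p.bound
      · simp [inputStore, hx]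
      · have := h.eq_of_bound_le (x := x + 1) (by omega)
        simp [inputStore, hx, this]
  have h2 := Exec.seq h (Exec.clear p.bound s)
  rw [e] at h2
  exact h2

/-! ### Data and polynomial-time functions -/

/-- Types of data that programs work on: `code` is the tree representing a value, and `wt` is the
measure in which running times are expressed. For ordinary data `wt` is comparable to the length of
the data; for a type of inputs it may be any quantity that is to serve as input size. -/
class TEnc (A : Type) where
  code : A → Tr
  wt : A → ℕ

open TEnc

/-- `f` is bounded by a polynomial in the weight of its argument. -/
@[fun_prop]
def PolyBdd {A : Type} [TEnc A] (f : A → ℕ) : Prop :=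
  ∃ C d : ℕ, ∀ a, f a ≤ C * (wt a + 1) ^ d

/-- `f` is computed by a program whose running time and output weight are polynomial in the weight
of the argument. The output weight has to be bounded separately since `wt` need not be related to the
size of the representation. -/
@[fun_prop]
def PolyFun {A B : Type} [TEnc A] [TEnc B] (f : A → B) : Prop :=
  (∃ (p : Cmd) (T : A → ℕ), PolyBdd T ∧ ∀ a, ∃ t ≤ T a, Runs p (code a) (code (f a)) t) ∧
    PolyBdd fun a => wt (f a)

instance : TEnc Unit := ⟨fun _ => Tr.nil, fun _ => 0⟩
instance : TEnc Bool := ⟨encBool, fun _ => 0⟩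
instance : TEnc ℕ := ⟨encNat, fun m => m⟩

section

variable {A B C Γ S : Type} [TEnc A] [TEnc B] [TEnc C] [TEnc Γ] [TEnc S]

instance : TEnc (A × B) := ⟨fun x => Tr.cons (code x.1) (code x.2), fun x => wt x.1 + wt x.2⟩
instance : TEnc (List A) :=
  ⟨fun l => encList (l.map code), fun l => (l.map fun a => wt a + 1).sum⟩

theorem wt_prod (x : A × B) : wt x = wt x.1 + wt x.2 := rfl

theorem wt_nil : wt ([] : List A) = 0 := rfl

theorem wt_cons (a : A) (l : List A) : wt (a :: l) = wt a + 1 + wt l := by simp [wt]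

theorem wt_append (l l' : List A) : wt (l ++ l') = wt l + wt l' := by
  induction l <;> simp_all [wt_nil, wt_cons]; omega

theorem length_le_wt (l : List A) : l.length ≤ wt l := by
  induction l <;> simp_all [wt_nil, wt_cons]; omega

theorem wt_le_of_mem {a : A} {l : List A} (h : a ∈ l) : wt a + 1 ≤ wt l := by
  induction l <;> simp_all [wt_cons]; grind

theorem wt_list_le {l : List A} {M : ℕ} (h : ∀ a ∈ l, wt a ≤ M) : wt l ≤ l.length * (M + 1) := by
  induction l with
  | nil => simp [wt_nil]
  | cons a l ih =>
    simp only [List.mem_cons, forall_eq_or_imp] at h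
    rw [wt_cons, List.length_cons]
    have := ih h.2
    nlinarith [h.1]

theorem wt_sublist {l l' : List A} (h : l.Sublist l') : wt l ≤ wt l' := by
  induction h <;> simp_all [wt_cons]; omega

theorem wt_reverse (l : List A) : wt l.reverse = wt l := by
  induction l <;> simp_all [wt_cons, wt_append, wt_nil]; omega

/-! ### Polynomial bounds -/

theorem PolyBdd.mono {f g : A → ℕ} (hg : PolyBdd g) (h : ∀ a, f a ≤ g a) : PolyBdd f := by
  obtain ⟨c, d, hg⟩ := hg
  exact ⟨c, d, fun a => (h a).trans (hg a)⟩

@[fun_prop]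
theorem PolyBdd.const (n : ℕ) : PolyBdd fun _ : A => n := ⟨n, 0, fun a => by simp⟩

@[fun_prop]
theorem PolyBdd.wt_id : PolyBdd fun a : A => wt a := ⟨1, 1, fun a => by simp⟩

@[fun_prop]
theorem PolyBdd.add {f g : A → ℕ} (hf : PolyBdd f) (hg : PolyBdd g) :
    PolyBdd fun a => f a + g a := by
  obtain ⟨c, d, hf⟩ := hf
  obtain ⟨c', d', hg⟩ := hg
  refine ⟨c + c', d + d', fun a => ?_⟩
  have h1 : (wt a + 1) ^ d ≤ (wt a + 1) ^ (d + d') := Nat.pow_le_pow_right (by omega) (by omega)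
  have h2 : (wt a + 1) ^ d' ≤ (wt a + 1) ^ (d + d') := Nat.pow_le_pow_right (by omega) (by omega)
  calc f a + g a ≤ c * (wt a + 1) ^ d + c' * (wt a + 1) ^ d' := add_le_add (hf a) (hg a)
    _ ≤ c * (wt a + 1) ^ (d + d') + c' * (wt a + 1) ^ (d + d') := by gcongr
    _ = _ := by ring

@[fun_prop]
theorem PolyBdd.mul {f g : A → ℕ} (hf : PolyBdd f) (hg : PolyBdd g) :
    PolyBdd fun a => f a * g a := by
  obtain ⟨c, d, hf⟩ := hf
  obtain ⟨c', d', hg⟩ := hg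
  refine ⟨c * c', d + d', fun a => ?_⟩
  calc f a * g a ≤ (c * (wt a + 1) ^ d) * (c' * (wt a + 1) ^ d') := Nat.mul_le_mul (hf a) (hg a)
    _ = _ := by ring

theorem PolyBdd.comp_bdd {g : B → ℕ} {f : A → B} (hg : PolyBdd g)
    (hf : PolyBdd fun a => wt (f a)) : PolyBdd fun a => g (f a) := by
  obtain ⟨c, d, hg⟩ := hg
  obtain ⟨c', d', hf⟩ := hf
  refine ⟨c * (c' + 1) ^ d, d' * d, fun a => ?_⟩
  calc g (f a) ≤ c * (wt (f a) + 1) ^ d := hg _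
    _ ≤ c * (c' * (wt a + 1) ^ d' + 1 * (wt a + 1) ^ d') ^ d := by
        gcongr
        · exact hf a
        · rw [one_mul]; exact Nat.one_le_pow _ _ (by omega)
    _ = _ := by rw [← add_mul, mul_pow, ← pow_mul, mul_assoc]

theorem PolyFun.bdd {f : A → B} (hf : PolyFun f) : PolyBdd fun a => wt (f a) := hf.2

/-! ### Closure properties of polynomial-time functions -/

theorem PolyFun.of_runs {f : A → B} (p : Cmd) (t : ℕ) (hw : PolyBdd fun a => wt (f a))
    (h : ∀ a, ∃ t' ≤ t, Runs p (code a) (code (f a)) t') : PolyFun f :=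
  ⟨⟨p, fun _ => t, .const t, h⟩, hw⟩

/-- Functions given by an expression. -/
theorem PolyFun.of_expr {f : A → B} (e : Expr) (hw : PolyBdd fun a => wt (f a))
    (h : ∀ a, e.eval (inputStore (code a)) = code (f a)) : PolyFun f :=
  .of_runs _ (e.cost + 1) hw fun a => ⟨_, le_rfl, h a ▸ Runs.expr e (code a)⟩

/-- Functions that do not change the representation. -/
theorem PolyFun.of_code_eq {f : A → B} (hw : PolyBdd fun a => wt (f a))
    (h : ∀ a, code a = code (f a)) : PolyFun f :=
  .of_expr (.var 0) hw fun a => by simp [Expr.eval, inputStore, h]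

@[fun_prop]
theorem PolyFun.id : PolyFun fun a : A => a := .of_code_eq .wt_id fun _ => rfl

@[fun_prop]
theorem PolyFun.const (b : B) : PolyFun fun _ : A => b :=
  .of_expr (.quote (code b)) (.const _) fun _ => Expr.eval_quote _ _

@[fun_prop]
theorem PolyFun.comp {g : B → C} {f : A → B} (hg : PolyFun g) (hf : PolyFun f) :
    PolyFun fun a => g (f a) := by
  obtain ⟨⟨q, T', hT', hq⟩, hgw⟩ := hg
  obtain ⟨⟨p, T, hT, hp⟩, hfw⟩ := hf
  refine ⟨⟨.seq p q, fun a => T a + T' (f a), hT.add (hT'.comp_bdd hfw), fun a => ?_⟩,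
    hgw.comp_bdd hfw⟩
  obtain ⟨t, ht, h⟩ := hp a
  obtain ⟨t', ht', h'⟩ := hq (f a)
  exact ⟨_, add_le_add ht ht', h.seq h'⟩

@[fun_prop]
theorem PolyFun.pair {f : Γ → A} {g : Γ → B} (hf : PolyFun f) (hg : PolyFun g) :
    PolyFun fun γ => (f γ, g γ) := by
  obtain ⟨⟨p, T, hT, hp⟩, hfw⟩ := hf
  obtain ⟨⟨q, T', hT', hq⟩, hgw⟩ := hg
  refine ⟨⟨p.pair q, fun γ => T γ + T' γ + 16, (hT.add hT').add (.const _), fun γ => ?_⟩,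
    hfw.add hgw⟩
  obtain ⟨t, ht, h⟩ := hp γ
  obtain ⟨t', ht', h'⟩ := hq γ
  exact ⟨_, by dsimp only; omega, h.pair h'⟩

theorem PolyFun.fst' : PolyFun fun x : A × B => x.1 :=
  .of_expr (.hd (.var 0)) (PolyBdd.wt_id.mono fun a => by simp [wt_prod])
    fun a => by simp [Expr.eval, inputStore, code, Tr.hd]

theorem PolyFun.snd' : PolyFun fun x : A × B => x.2 :=
  .of_expr (.tl (.var 0)) (PolyBdd.wt_id.mono fun a => by simp [wt_prod])
    fun a => by simp [Expr.eval, inputStore, code, Tr.tl]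

@[fun_prop]
theorem PolyFun.fst {f : Γ → A × B} (hf : PolyFun f) : PolyFun fun γ => (f γ).1 := fst'.comp hf

@[fun_prop]
theorem PolyFun.snd {f : Γ → A × B} (hf : PolyFun f) : PolyFun fun γ => (f γ).2 := snd'.comp hf

@[fun_prop]
theorem PolyFun.cond {c : Γ → Bool} {f g : Γ → A} (hc : PolyFun c) (hf : PolyFun f)
    (hg : PolyFun g) : PolyFun fun γ => bif c γ then f γ else g γ := by
  obtain ⟨⟨q, T, hT, hq⟩, hcw⟩ := hc
  obtain ⟨⟨p₁, T₁, hT₁, hp₁⟩, hfw⟩ := hf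
  obtain ⟨⟨p₂, T₂, hT₂, hp₂⟩, hgw⟩ := hg
  refine ⟨⟨.seq (q.pair (.assign 0 (.var 0))) (.ite (.hd (.var 0))
    (.seq (.assign 0 (.tl (.var 0))) p₁) (.seq (.assign 0 (.tl (.var 0))) p₂)),
    fun γ => T γ + T₁ γ + T₂ γ + 24, by fun_prop, fun γ => ?_⟩,
    (hfw.add hgw).mono fun γ => by cases h : c γ <;> simp [h]⟩
  obtain ⟨t, ht, h⟩ := hq γ
  obtain ⟨t₁, ht₁, h₁⟩ := hp₁ γ
  obtain ⟨t₂, ht₂, h₂⟩ := hp₂ γ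
  have h0 := h.pair (Runs.expr (.var 0) (code γ))
  have ht := Runs.expr (.tl (.var 0)) (Tr.cons (code (c γ)) (code γ))
  have e : (Expr.tl (.var 0)).eval (inputStore (Tr.cons (code (c γ)) (code γ))) = code γ := by
    simp [Expr.eval, inputStore, Tr.tl]
  rw [e] at ht
  have e' : (Expr.var 0).eval (inputStore (code γ)) = code γ := by simp [Expr.eval, inputStore]
  rw [e'] at h0
  cases hc : c γ
  · refine ⟨_, ?_, h0.seq (.iteFalse ?_ (ht.seq (by simpa only [hc, cond_false] using h₂)))⟩
    · simp only [Expr.cost]; omega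
    · simp [Expr.eval, inputStore, hc, code, Tr.hd, encBool]
  · refine ⟨_, ?_, h0.seq (.iteTrue ?_ (ht.seq (by simpa only [hc, cond_true] using h₁)))⟩
    · simp only [Expr.cost]; omega
    · simp [Expr.eval, inputStore, hc, code, Tr.hd, encBool]

/-- Folding over a list, provided that the intermediate values stay small: without the bound `M`,
they might double in every step. -/
theorem PolyFun.foldl {l : Γ → List A} {i : Γ → S} {f : Γ → S → A → S} {M : Γ → ℕ}
    (hl : PolyFun l) (hi : PolyFun i) (hf : PolyFun fun x : (Γ × S) × A => f x.1.1 x.1.2 x.2)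
    (hM : PolyBdd M) (h : ∀ γ l', l' <+: l γ → wt (l'.foldl (f γ) (i γ)) ≤ M γ) :
    PolyFun fun γ => (l γ).foldl (f γ) (i γ) := by
  obtain ⟨⟨q, T, ⟨c, d, hT⟩, hq⟩, hfw⟩ := hf
  have hid : PolyFun fun γ : Γ => γ := .id
  obtain ⟨⟨r, R, hR, hr⟩, hrw⟩ := hl.pair (hid.pair hi)
  -- the loop works on the triple of the rest of the list, the parameter, and the current value
  let body : Cmd := (Cmd.assign 0 (.tl (.hd (.var 0)))).pair <|
    (Cmd.assign 0 (.hd (.tl (.var 0)))).pair <|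
    .seq (.assign 0 (.cons (.tl (.var 0)) (.hd (.hd (.var 0))))) q
  let N : Γ → ℕ := fun γ => c * (wt γ + M γ + wt (l γ) + 1) ^ d
  have hN : PolyBdd N := by
    have h1 : PolyBdd fun x : ℕ => c * (x + 1) ^ d := ⟨c, d, fun x => le_rfl⟩
    exact h1.comp_bdd (f := fun γ => wt γ + M γ + wt (l γ))
      ((PolyBdd.wt_id.add hM).add hl.2)
  refine ⟨⟨.seq r (.seq (.loop (.hd (.var 0)) body) (.assign 0 (.tl (.tl (.var 0))))),
    fun γ => R γ + ((wt (l γ)) * ((N γ + 50) + 3) + 3 + 4), ?_, fun γ => ?_⟩, ?_⟩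
  · exact hR.add (((hl.2.mul ((hN.add (.const _)).add (.const _))).add (.const _)).add (.const _))
  · obtain ⟨t, ht, h1⟩ := hr γ
    -- the loop invariant: what is kept besides the rest of the list
    let F : List A → Tr := fun l' => Tr.cons (code γ) (code (l'.foldl (f γ) (i γ)))
    have key : ∀ l₁ a l₂, l γ = l₁ ++ a :: l₂ → ∃ t ≤ N γ + 50,
        Runs body (Tr.cons (encList ((a :: l₂).map code)) (F l₁))
          (Tr.cons (encList (l₂.map code)) (F (l₁ ++ [a]))) t := by
      intro l₁ a l₂ hl'
      obtain ⟨t, ht, h2⟩ := hq ((γ, l₁.foldl (f γ) (i γ)), a)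
      have hw : T ((γ, l₁.foldl (f γ) (i γ)), a) ≤ N γ := by
        refine (hT _).trans ?_
        simp only [N, wt_prod]
        gcongr
        · exact h γ l₁ ⟨_, hl'.symm⟩
        · have : wt a + 1 ≤ wt (l γ) := wt_le_of_mem (by simp [hl'])
          omega
      have e1 := Runs.expr (.tl (.hd (.var 0)))
        (Tr.cons (encList ((a :: l₂).map code)) (F l₁))
      have e2 := Runs.expr (.hd (.tl (.var 0)))
        (Tr.cons (encList ((a :: l₂).map code)) (F l₁))
      have e3 := Runs.expr (.cons (.tl (.var 0)) (.hd (.hd (.var 0))))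
        (Tr.cons (encList ((a :: l₂).map code)) (F l₁))
      simp only [Expr.eval, inputStore, Tr.hd, Tr.tl, Function.update_self, List.map_cons,
        encList, F] at e1 e2 e3
      have := e1.pair (e2.pair (e3.seq h2))
      refine ⟨_, ?_, by
        simpa only [body, F, List.foldl_append, List.foldl_cons, List.foldl_nil, List.map_cons,
          encList] using this⟩
      simp only [Expr.cost]
      omega
    have loop : ∀ l₂ l₁, l γ = l₁ ++ l₂ → ∃ t ≤ l₂.length * ((N γ + 50) + 3) + 3,
        Runs (.loop (.hd (.var 0)) body) (Tr.cons (encList (l₂.map code)) (F l₁))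
          (Tr.cons Tr.nil (F (l γ))) t := by
      intro l₂
      induction l₂ with
      | nil =>
        intro l₁ hl'
        refine ⟨3, by simp, ?_⟩
        rw [hl', List.append_nil]
        exact Exec.loopDone (by simp [Expr.eval, inputStore, Tr.hd, encList])
      | cons a l₂ ih =>
        intro l₁ hl'
        obtain ⟨t1, ht1, r1⟩ := key l₁ a l₂ hl'
        obtain ⟨t2, ht2, r2⟩ := ih (l₁ ++ [a]) (by simp [hl'])
        refine ⟨_, ?_, Exec.loopStep (by simp [Expr.eval, inputStore, Tr.hd, encList]) r1 r2⟩
        simp only [Expr.cost, List.length_cons]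
        nlinarith
    obtain ⟨t', ht', h2⟩ := loop (l γ) [] rfl
    have h3 := Runs.expr (.tl (.tl (.var 0))) (Tr.cons Tr.nil (F (l γ)))
    simp only [Expr.eval, inputStore, Tr.tl, Function.update_self, F] at h3
    refine ⟨_, ?_, h1.seq (h2.seq h3)⟩
    have := length_le_wt (l γ)
    simp only [Expr.cost]
    have h5 : (l γ).length * ((N γ + 50) + 3) ≤ wt (l γ) * ((N γ + 50) + 3) := by gcongr
    omega
  · exact hM.mono fun γ => h γ _ (List.prefix_refl _)

/-! ### Lists -/

@[fun_prop]
theorem PolyFun.list_cons {f : Γ → A} {g : Γ → List A} (hf : PolyFun f) (hg : PolyFun g) :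
    PolyFun fun γ => f γ :: g γ := by
  have h : PolyFun fun x : A × List A => x.1 :: x.2 := .of_code_eq
    ((PolyBdd.wt_id.add (.const 1)).mono fun a => by simp only [wt_cons, wt_prod]; omega)
    fun a => rfl
  exact h.comp (hf.pair hg)

@[fun_prop]
theorem PolyFun.list_tail {f : Γ → List A} (hf : PolyFun f) : PolyFun fun γ => (f γ).tail := by
  have h : PolyFun fun l : List A => l.tail := .of_expr (.tl (.var 0))
    (PolyBdd.wt_id.mono fun l => wt_sublist (List.tail_sublist l)) fun l => by
      cases l <;> simp [Expr.eval, inputStore, code, Tr.tl, encList]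
  exact h.comp hf

@[fun_prop]
theorem PolyFun.list_isEmpty {f : Γ → List A} (hf : PolyFun f) :
    PolyFun fun γ => (f γ).isEmpty := by
  have h : PolyFun fun l : List A => l.isEmpty := .of_runs
    (.ite (.var 0) (.assign 0 .nil) (.assign 0 (.cons .nil .nil))) 6 (.const 0) fun l => by
      cases l with
      | nil => exact ⟨_, by simp [Expr.cost], .iteFalse (by simp [Expr.eval, inputStore, code, encList])
          (Runs.expr _ _)⟩
      | cons a l => exact ⟨_, by simp [Expr.cost], .iteTrue (by simp [Expr.eval, inputStore, code, encList])
          (Runs.expr _ _)⟩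
  exact h.comp hf

@[fun_prop]
theorem PolyFun.list_headD {f : Γ → List A} {g : Γ → A} (hf : PolyFun f) (hg : PolyFun g) :
    PolyFun fun γ => (f γ).headD (g γ) := by
  have h : PolyFun fun x : List A × A => x.1.headD x.2 := .of_runs
    (.ite (.hd (.var 0)) (.assign 0 (.hd (.hd (.var 0)))) (.assign 0 (.tl (.var 0)))) 7
    (PolyBdd.wt_id.mono fun l => by
      rcases l with ⟨_ | ⟨a, l⟩, x⟩ <;> simp [wt_prod, wt_cons]; omega) fun l => by
      rcases l with ⟨_ | ⟨a, l⟩, x⟩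
      · have := Runs.expr (.tl (.var 0)) (code (([] : List A), x))
        exact ⟨_, by simp [Expr.cost], .iteFalse (by
          simp [Expr.eval, inputStore, code, encList, Tr.hd]) this⟩
      · have := Runs.expr (.hd (.hd (.var 0))) (code (a :: l, x))
        exact ⟨_, by simp [Expr.cost], .iteTrue (by
          simp [Expr.eval, inputStore, code, encList, Tr.hd]) this⟩
  exact h.comp (hf.pair hg)

@[fun_prop]
theorem PolyFun.list_reverse {l : Γ → List A} (hl : PolyFun l) :
    PolyFun fun γ => (l γ).reverse := by
  have e : ∀ l i : List A, l.foldl (fun s a => a :: s) i = l.reverse ++ i := fun l => by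
    induction l <;> simp_all
  have h : PolyFun fun γ => (l γ).foldl (fun s a => a :: s) [] :=
    hl.foldl (.const []) (by fun_prop) hl.bdd fun γ l' hl' => by
      rw [e, List.append_nil, wt_reverse]
      exact wt_sublist hl'.sublist
  simpa [e] using h

theorem PolyFun.foldr {l : Γ → List A} {i : Γ → S} {f : Γ → A → S → S} {M : Γ → ℕ}
    (hl : PolyFun l) (hi : PolyFun i) (hf : PolyFun fun x : (Γ × S) × A => f x.1.1 x.2 x.1.2)
    (hM : PolyBdd M) (h : ∀ γ l', l' <:+ l γ → TEnc.wt (l'.foldr (f γ) (i γ)) ≤ M γ) :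
    PolyFun fun γ => (l γ).foldr (f γ) (i γ) := by
  have := hl.list_reverse.foldl (f := fun γ s a => f γ a s) hi hf hM fun γ l' hl' => by
    have := h γ l'.reverse (by simpa using List.reverse_suffix.2 hl')
    simpa using this
  simpa using this

@[fun_prop]
theorem PolyFun.list_map {l : Γ → List A} {f : Γ → A → B} (hl : PolyFun l)
    (hf : PolyFun fun x : Γ × A => f x.1 x.2) : PolyFun fun γ => (l γ).map (f γ) := by
  have e : ∀ γ (l : List A), l.foldr (fun a s => f γ a :: s) [] = l.map (f γ) := fun γ l => by
    induction l <;> simp_all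
  obtain ⟨c, d, hw⟩ := hf.bdd
  have h : PolyFun fun γ => (l γ).foldr (fun a s => f γ a :: s) [] :=
    hl.foldr (.const []) (.list_cons (hf.comp (f := fun x : (Γ × List B) × A => (x.1.1, x.2))
      (by fun_prop)) (by fun_prop))
      (M := fun γ => wt (l γ) * (c * ((wt γ + wt (l γ)) + 1) ^ d + 1))
      (hl.bdd.mul (PolyBdd.add (PolyBdd.comp_bdd (g := fun x : ℕ => c * (x + 1) ^ d)
        ⟨c, d, fun x => le_rfl⟩ (f := fun γ => wt γ + wt (l γ)) (PolyBdd.wt_id.add hl.bdd)) (.const 1)))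
      fun γ l' hl' => by
        rw [e]
        refine (wt_list_le (M := c * ((wt γ + wt (l γ)) + 1) ^ d) fun b hb => ?_).trans ?_
        · obtain ⟨a, ha, rfl⟩ := List.mem_map.1 hb
          refine (hw (γ, a)).trans ?_
          have := wt_le_of_mem (hl'.subset ha)
          simp only [wt_prod]
          gcongr; omega
        · gcongr
          rw [List.length_map]
          exact hl'.length_le.trans (length_le_wt _)
  simpa [e] using h

@[fun_prop]
theorem PolyFun.list_append {f g : Γ → List A} (hf : PolyFun f) (hg : PolyFun g) :
    PolyFun fun γ => f γ ++ g γ := by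
  have e : ∀ l l' : List A, l.foldr (fun a s => a :: s) l' = l ++ l' := fun l l' => by
    induction l <;> simp_all
  have h : PolyFun fun γ => (f γ).foldr (fun a s => a :: s) (g γ) :=
    hf.foldr hg (by fun_prop) (hf.bdd.add hg.bdd) fun γ l' hl' => by
      rw [e, wt_append]
      gcongr
      exact wt_sublist hl'.sublist
  simpa [e] using h

@[fun_prop]
theorem PolyFun.list_flatten {l : Γ → List (List A)} (hl : PolyFun l) :
    PolyFun fun γ => (l γ).flatten := by
  have e : ∀ l : List (List A), l.foldr (fun a s => a ++ s) [] = l.flatten := fun l => by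
    induction l <;> simp_all
  have e' : ∀ l : List (List A), wt l.flatten ≤ wt l := fun l => by
    induction l <;> simp_all [wt_cons, wt_append, wt_nil]; omega
  have h : PolyFun fun γ => (l γ).foldr (fun a s => a ++ s) [] :=
    hl.foldr (.const []) (by fun_prop) hl.bdd fun γ l' hl' => by
      rw [e]
      exact (e' _).trans (wt_sublist hl'.sublist)
  simpa [e] using h

@[fun_prop]
theorem PolyFun.list_flatMap {l : Γ → List A} {f : Γ → A → List B} (hl : PolyFun l)
    (hf : PolyFun fun x : Γ × A => f x.1 x.2) : PolyFun fun γ => (l γ).flatMap (f γ) := by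
  simp only [List.flatMap]
  fun_prop

@[fun_prop]
theorem PolyFun.list_filter {l : Γ → List A} {f : Γ → A → Bool} (hl : PolyFun l)
    (hf : PolyFun fun x : Γ × A => f x.1 x.2) : PolyFun fun γ => (l γ).filter (f γ) := by
  have e : ∀ γ (l : List A), l.filter (f γ) = l.flatMap fun a => bif f γ a then [a] else [] :=
    fun γ l => by
      induction l with
      | nil => rfl
      | cons a l ih => cases h : f γ a <;> simp [h, ih]
  simp only [e]
  fun_prop

/-! ### Natural numbers and truth values -/

theorem wt_replicate_unit (n : ℕ) : wt (List.replicate n ()) = n := by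
  induction n with
  | zero => rfl
  | succ n ih => rw [List.replicate_succ, wt_cons, ih]; simp [wt]; omega

theorem code_replicate_unit (n : ℕ) : code (List.replicate n ()) = code n := by
  simp [code, encNat]

@[fun_prop]
theorem PolyFun.replicate_unit {f : Γ → ℕ} (hf : PolyFun f) :
    PolyFun fun γ => List.replicate (f γ) () := by
  have h : PolyFun fun n : ℕ => List.replicate n () := .of_code_eq
    (PolyBdd.wt_id.mono fun n => (wt_replicate_unit n).le) fun n => (code_replicate_unit n).symm
  exact h.comp hf

theorem PolyFun.list_length_unit {f : Γ → List Unit} (hf : PolyFun f) :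
    PolyFun fun γ => (f γ).length := by
  have h : PolyFun fun l : List Unit => l.length := .of_code_eq
    (PolyBdd.wt_id.mono fun n => length_le_wt n) fun l => by
      rw [← code_replicate_unit]
      congr 1
      exact (List.eq_replicate_iff.2 ⟨rfl, by simp⟩)
  exact h.comp hf

@[fun_prop]
theorem PolyFun.list_length {f : Γ → List A} (hf : PolyFun f) :
    PolyFun fun γ => (f γ).length := by
  have h : PolyFun fun γ => ((f γ).map fun _ => ()).length := list_length_unit (by fun_prop)
  simpa using h

@[fun_prop]
theorem PolyFun.nat_add {f g : Γ → ℕ} (hf : PolyFun f) (hg : PolyFun g) :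
    PolyFun fun γ => f γ + g γ := by
  have h : PolyFun fun γ => (List.replicate (f γ) () ++ List.replicate (g γ) ()).length := by
    fun_prop
  simpa using h

theorem PolyFun.iterate {n : Γ → ℕ} {i : Γ → S} {f : Γ → S → S} {M : Γ → ℕ}
    (hn : PolyFun n) (hi : PolyFun i) (hf : PolyFun fun x : Γ × S => f x.1 x.2)
    (hM : PolyBdd M) (h : ∀ γ m, m ≤ n γ → wt ((f γ)^[m] (i γ)) ≤ M γ) :
    PolyFun fun γ => (f γ)^[n γ] (i γ) := by
  have e : ∀ γ m s, (List.replicate m ()).foldl (fun s _ => f γ s) s = (f γ)^[m] s := by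
    intro γ m
    induction m with
    | zero => intro s; rfl
    | succ m ih => intro s; simp [List.replicate_succ, ih]
  have h' : PolyFun fun γ => (List.replicate (n γ) ()).foldl (fun s _ => f γ s) (i γ) :=
    PolyFun.foldl (by fun_prop) hi
      (hf.comp (f := fun x : (Γ × S) × Unit => (x.1.1, x.1.2)) (by fun_prop)) hM
      fun γ l' hl' => by
        have : l' = List.replicate l'.length () := List.eq_replicate_iff.2 ⟨rfl, by simp⟩
        rw [this, e]
        exact h γ _ (by simpa using hl'.length_le)
  simpa [e] using h'

@[fun_prop]
theorem PolyFun.list_drop {n : Γ → ℕ} {l : Γ → List A} (hn : PolyFun n) (hl : PolyFun l) :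
    PolyFun fun γ => (l γ).drop (n γ) := by
  have e : ∀ n (l : List A), List.tail^[n] l = l.drop n := fun n => by
    induction n with
    | zero => intro l; rfl
    | succ n ih => intro l; rw [Function.iterate_succ_apply, ih, List.drop_tail]
  have h : PolyFun fun γ => List.tail^[n γ] (l γ) :=
    PolyFun.iterate hn hl (by fun_prop) hl.bdd fun γ m _ => by
      rw [e]; exact wt_sublist (List.drop_sublist _ _)
  simpa [e] using h

@[fun_prop]
theorem PolyFun.list_getD {n : Γ → ℕ} {l : Γ → List A} {d : Γ → A} (hn : PolyFun n)
    (hl : PolyFun l) (hd : PolyFun d) : PolyFun fun γ => (l γ).getD (n γ) (d γ) := by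
  have h : PolyFun fun γ => ((l γ).drop (n γ)).headD (d γ) := by fun_prop
  have e : ∀ (l : List A) n d, (l.drop n).headD d = l.getD n d := fun l n d => by
    simp [List.headD_eq_head?_getD]
  simpa only [e] using h

@[fun_prop]
theorem PolyFun.nat_sub {f g : Γ → ℕ} (hf : PolyFun f) (hg : PolyFun g) :
    PolyFun fun γ => f γ - g γ := by
  have h : PolyFun fun γ => ((List.replicate (f γ) ()).drop (g γ)).length := by fun_prop
  simpa using h

@[fun_prop]
theorem PolyFun.nat_mul {f g : Γ → ℕ} (hf : PolyFun f) (hg : PolyFun g) :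
    PolyFun fun γ => f γ * g γ := by
  have h : PolyFun fun γ => ((List.replicate (f γ) ()).flatMap
      fun _ => List.replicate (g γ) ()).length := by fun_prop
  simpa using h

@[fun_prop]
theorem PolyFun.nat_pow {f : Γ → ℕ} (hf : PolyFun f) (j : ℕ) : PolyFun fun γ => f γ ^ j := by
  induction j with
  | zero => simp only [pow_zero]; fun_prop
  | succ j ih => simp only [pow_succ]; fun_prop

@[fun_prop]
theorem PolyFun.nat_ble {f g : Γ → ℕ} (hf : PolyFun f) (hg : PolyFun g) :
    PolyFun fun γ => Nat.ble (f γ) (g γ) := by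
  have h : PolyFun fun γ => (List.replicate (f γ - g γ) ()).isEmpty := by fun_prop
  convert h using 2 with γ
  rw [Bool.eq_iff_iff]
  simp [Nat.sub_eq_zero_iff_le]

@[fun_prop]
theorem PolyFun.not {f : Γ → Bool} (hf : PolyFun f) : PolyFun fun γ => !(f γ) := by
  have h : PolyFun fun γ => bif f γ then false else true := by fun_prop
  convert h using 2 with γ
  cases f γ <;> rfl

@[fun_prop]
theorem PolyFun.and {f g : Γ → Bool} (hf : PolyFun f) (hg : PolyFun g) :
    PolyFun fun γ => f γ && g γ := by
  have h : PolyFun fun γ => bif f γ then g γ else false := by fun_prop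
  convert h using 2 with γ
  cases f γ <;> rfl

@[fun_prop]
theorem PolyFun.or {f g : Γ → Bool} (hf : PolyFun f) (hg : PolyFun g) :
    PolyFun fun γ => f γ || g γ := by
  have h : PolyFun fun γ => bif f γ then true else g γ := by fun_prop
  convert h using 2 with γ
  cases f γ <;> rfl

@[fun_prop]
theorem PolyFun.list_any {l : Γ → List A} {f : Γ → A → Bool} (hl : PolyFun l)
    (hf : PolyFun fun x : Γ × A => f x.1 x.2) : PolyFun fun γ => (l γ).any (f γ) := by
  have h : PolyFun fun γ => !((l γ).filter (f γ)).isEmpty := by fun_prop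
  convert h using 2 with γ
  rw [Bool.eq_iff_iff]
  simp

@[fun_prop]
theorem PolyFun.list_all {l : Γ → List A} {f : Γ → A → Bool} (hl : PolyFun l)
    (hf : PolyFun fun x : Γ × A => f x.1 x.2) : PolyFun fun γ => (l γ).all (f γ) := by
  have h : PolyFun fun γ => !((l γ).any fun a => !(f γ a)) := by fun_prop
  convert h using 2 with γ
  rw [Bool.eq_iff_iff]
  simp

@[fun_prop]
theorem PolyFun.list_countP {l : Γ → List A} {f : Γ → A → Bool} (hl : PolyFun l)
    (hf : PolyFun fun x : Γ × A => f x.1 x.2) : PolyFun fun γ => (l γ).countP (f γ) := by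
  simp only [List.countP_eq_length_filter]
  fun_prop

@[fun_prop]
theorem PolyFun.list_sum {l : Γ → List ℕ} (hl : PolyFun l) : PolyFun fun γ => (l γ).sum := by
  have h : PolyFun fun γ => ((l γ).flatMap fun m => List.replicate m ()).length := by fun_prop
  convert h using 2 with γ
  simp [List.length_flatMap]

@[fun_prop]
theorem PolyFun.list_range {n : Γ → ℕ} (hn : PolyFun n) : PolyFun fun γ => List.range (n γ) := by
  have e : ∀ n, (fun l : List ℕ => l ++ [l.length])^[n] [] = List.range n := fun n => by
    induction n with
    | zero => rfl
    | succ n ih => rw [Function.iterate_succ_apply', ih, List.range_succ, List.length_range]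
  have h : PolyFun fun γ => (fun l : List ℕ => l ++ [l.length])^[n γ] [] :=
    PolyFun.iterate hn (.const _) (by fun_prop) (M := fun γ => wt (n γ) * (wt (n γ) + 1))
      (hn.bdd.mul (hn.bdd.add (.const 1))) fun γ m hm => by
        rw [e]
        refine (wt_list_le (M := m) fun a ha => (List.mem_range.1 ha).le).trans ?_
        rw [List.length_range]
        exact Nat.mul_le_mul hm (Nat.succ_le_succ hm)
  simpa [e] using h

@[fun_prop]
theorem PolyFun.list_zip [Inhabited A] [Inhabited B] {l : Γ → List A} {l' : Γ → List B}
    (hl : PolyFun l) (hl' : PolyFun l') : PolyFun fun γ => (l γ).zip (l' γ) := by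
  have h : PolyFun fun γ => ((List.range (l γ).length).filter fun i => Nat.ble (i + 1) (l' γ).length).map
      fun i => ((l γ).getD i default, (l' γ).getD i default) := by fun_prop
  convert h using 2 with γ
  have e : ((List.range (l γ).length).filter fun i => Nat.ble (i + 1) (l' γ).length) =
      List.range (min (l γ).length (l' γ).length) := by
    generalize (l γ).length = a
    induction a with
    | zero => simp
    | succ a ih =>
      rw [List.range_succ, List.filter_append, ih]
      by_cases h : a + 1 ≤ (l' γ).length
      · rw [min_eq_left h, min_eq_left (by omega), List.range_succ]
        simp [h]
      · rw [min_eq_right (by omega), min_eq_right (by omega)]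
        simp [h]
  rw [e]
  refine List.ext_getElem (by simp) fun i h1 h2 => ?_
  simp only [List.length_zip] at h1
  simp [List.getElem?_eq_getElem (show i < (l γ).length by omega),
    List.getElem?_eq_getElem (show i < (l' γ).length by omega)]

/-! ### Decidable equality -/

/-- Equality of elements of `A` can be tested in polynomial time. -/
class PolyEq (A : Type) [TEnc A] [DecidableEq A] : Prop where
  poly : PolyFun fun x : A × A => decide (x.1 = x.2)

@[fun_prop]
theorem PolyFun.decide_eq [DecidableEq A] [PolyEq A] {f g : Γ → A} (hf : PolyFun f)
    (hg : PolyFun g) : PolyFun fun γ => decide (f γ = g γ) := PolyEq.poly.comp (hf.pair hg)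

instance : PolyEq ℕ where
  poly := by
    have h : PolyFun fun x : ℕ × ℕ => Nat.ble x.1 x.2 && Nat.ble x.2 x.1 := by fun_prop
    convert h using 2 with x
    rw [Bool.eq_iff_iff]
    simp [Nat.le_antisymm_iff]

instance : PolyEq Bool where
  poly := by
    have h : PolyFun fun x : Bool × Bool => bif x.1 then x.2 else !x.2 := by fun_prop
    convert h using 2 with x
    rcases x with ⟨_ | _, _ | _⟩ <;> rfl

instance [DecidableEq A] [PolyEq A] [Inhabited A] : PolyEq (List A) where
  poly := by
    have h : PolyFun fun x : List A × List A => decide (x.1.length = x.2.length) &&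
      (x.1.zip x.2).all fun y => decide (y.1 = y.2) := by fun_prop
    convert h using 2 with x
    rcases x with ⟨l, l'⟩
    rw [Bool.eq_iff_iff]
    induction l generalizing l' with
    | nil => cases l' <;> simp
    | cons a l ih =>
      cases l' with
      | nil => simp
      | cons b l' =>
        have := ih l'
        simp only [Bool.and_eq_true, decide_eq_true_eq] at this
        simp [this]
        grind

@[fun_prop]
theorem PolyFun.list_dedup [DecidableEq A] [PolyEq A] {l : Γ → List A} (hl : PolyFun l) :
    PolyFun fun γ => (l γ).dedup := by
  have e : ∀ l : List A, l.foldr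
      (fun a s => bif s.any fun b => decide (b = a) then s else a :: s) [] = l.dedup := fun l => by
    induction l with
    | nil => rfl
    | cons a l ih =>
      rw [List.foldr_cons, ih]
      by_cases h : a ∈ l
      · have h' : (l.dedup.any fun b => decide (b = a)) = true := by simpa using h
        rw [List.dedup_cons_of_mem h, h', cond_true]
      · have h' : (l.dedup.any fun b => decide (b = a)) = false := by
          simp only [List.any_eq_false, List.mem_dedup, decide_eq_true_eq]
          grind
        rw [List.dedup_cons_of_notMem h, h', cond_false]
  have h : PolyFun fun γ => (l γ).foldr
      (fun a s => bif s.any fun b => decide (b = a) then s else a :: s) [] :=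
    hl.foldr (.const []) (by fun_prop) hl.bdd fun γ l' hl' => by
      rw [e]
      exact wt_sublist ((List.dedup_sublist l').trans hl'.sublist)
  simpa [e] using h

@[fun_prop]
theorem PolyFun.nat_div {f : Γ → ℕ} (hf : PolyFun f) (k : ℕ) (hk : 0 < k := by assumption) :
    PolyFun fun γ => f γ / k := by
  have h : PolyFun fun γ => (List.range (f γ)).countP fun i => Nat.ble (k * (i + 1)) (f γ) := by
    fun_prop
  have e : ∀ m q, m / k ≤ q → (List.range q).countP (fun i => Nat.ble (k * (i + 1)) m) = m / k := by
    intro m q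
    induction q with
    | zero => intro h; rw [Nat.le_zero.1 h]; rfl
    | succ q ih =>
      intro h
      rw [List.range_succ, List.countP_append]
      have e : k * (q + 1) ≤ m ↔ q + 1 ≤ m / k := by rw [Nat.le_div_iff_mul_le hk, mul_comm]
      rcases h.lt_or_eq with h | h
      · rw [ih (by omega)]
        simp [e]; omega
      · rw [List.countP_eq_length.2]
        · simp [e, h]
        · intro i hi
          have := List.mem_range.1 hi
          rw [Nat.ble_eq, mul_comm, ← Nat.le_div_iff_mul_le hk]; omega
  simpa [e _ _ (Nat.div_le_self _ _)] using h

theorem PolyFun.nat_mod {f : Γ → ℕ} (hf : PolyFun f) (k : ℕ) (hk : 0 < k) :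
    PolyFun fun γ => f γ % k := by
  have h' := hf.nat_div k hk
  have h : PolyFun fun γ => f γ - k * (f γ / k) := by fun_prop
  convert h using 2 with γ
  exact Nat.mod_eq_sub_mul_div

end

/-! ### The reduction on lists -/

/-- The level of each node: `j + 1` on `V j`, and `0` on the unconstrained nodes. -/
def levels (c n : ℕ) (Vs : List (List Bool)) : List ℕ :=
  (List.range n).map fun v =>
    ((List.range c).map fun j => bif (Vs.getD j []).getD v false then j + 1 else 0).sum

/-- Whether the partitioning `p` splits every positive level evenly into `k` parts. -/
def evenOn (k c n : ℕ) (lv p : List ℕ) : Bool :=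
  (List.range c).all fun j => (List.range k).all fun i =>
    Nat.ble (k * (List.range n).countP fun v =>
        decide (lv.getD v 0 = j + 1) && decide (p.getD v 0 = i))
      ((List.range n).countP fun v => decide (lv.getD v 0 = j + 1))

/-- The partitioning that deals out the nodes of each positive level cyclically and puts all
unconstrained nodes into part `0`. -/
def cyclic (k n : ℕ) (lv : List ℕ) : List ℕ :=
  (List.range n).map fun v => bif decide (lv.getD v 0 = 0) then 0 else
    ((List.range v).countP fun x => decide (lv.getD x 0 = lv.getD v 0)) % k

/-- The sizes of the blocks that replace the nodes: `(a n) ^ ℓ` at level `ℓ`. -/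
def blockSizes (c a n : ℕ) (lv : List ℕ) : List ℕ :=
  (List.range n).map fun v => ((List.range (c + 1)).map fun j => (a * n) ^ j).getD (lv.getD v 0) 1

/-- The number of isolated nodes added at the end. If the instance has no feasible partitioning,
then this makes the total number of nodes congruent to `1` modulo `k`. -/
def padding (k c n : ℕ) (lv bs : List ℕ) : ℕ :=
  bif evenOn k c n lv (cyclic k n lv) then
    (k - 1) * (List.range n).countP fun v => decide (lv.getD v 0 = 0)
  else (k - 1) * bs.sum + 1

/-- The nodes `(v, t)` of the constructed hypergraph: for `v < n` they form the block of `v`, and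
for `v = n` they are the padding. -/
def blockNodes (n : ℕ) (bs : List ℕ) (pad : ℕ) : List (ℕ × ℕ) :=
  (List.range (n + 1)).flatMap fun v =>
    (List.range ((bs ++ [pad]).getD v 0)).map fun t => (v, t)

/-- The hyperedge `e`, with every node replaced by its block. -/
def blowUp (e : List Bool) (N : List (ℕ × ℕ)) : List Bool := N.map fun x => e.getD x.1 false

/-- A hyperedge inside the block of `v` that contains `(v, 0)` and `(v, t)`; besides, the hyperedge
`e` and the number `r` are encoded in it. -/
def tie (n : ℕ) (N : List (ℕ × ℕ)) (v t : ℕ) (e : List Bool) (r : ℕ) : List Bool :=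
  N.map fun x => decide (x.1 = v) && (decide (x.2 = 0) || decide (x.2 = t) ||
    e.getD x.2 false || (Nat.ble n x.2 && Nat.ble (x.2 + 1) (n + r)))

/-- All hyperedges of the constructed hypergraph. -/
def blockEdges (R n : ℕ) (es : List (List Bool)) (lv bs : List ℕ) (N : List (ℕ × ℕ)) :
    List (List Bool) :=
  ((es.map fun e => blowUp e N) ++ (List.range n).flatMap fun v =>
    bif decide (lv.getD v 0 = 0) then [] else (List.range (bs.getD v 0)).flatMap fun t =>
      es.flatMap fun e => (List.range R).map fun r => tie n N v t e r).dedup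

/-- The part of the first node of each block. -/
def representatives (n : ℕ) (N : List (ℕ × ℕ)) (p : List ℕ) : List ℕ :=
  ((N.zip p).filter fun y => decide (y.1.2 = 0) && Nat.ble (y.1.1 + 1) n).map fun y => y.2

section

variable {Γ : Type} [TEnc Γ]

@[fun_prop]
theorem PolyFun.levels {c : ℕ} {n : Γ → ℕ} {Vs : Γ → List (List Bool)} (hn : PolyFun n)
    (hV : PolyFun Vs) : PolyFun fun γ => levels c (n γ) (Vs γ) := by
  unfold _root_.levels
  fun_prop

@[fun_prop]
theorem PolyFun.evenOn {k c : ℕ} {n : Γ → ℕ} {lv p : Γ → List ℕ} (hn : PolyFun n)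
    (hl : PolyFun lv) (hp : PolyFun p) : PolyFun fun γ => evenOn k c (n γ) (lv γ) (p γ) := by
  unfold _root_.evenOn
  fun_prop

theorem PolyFun.cyclic {k : ℕ} (hk : 0 < k) {n : Γ → ℕ} {lv : Γ → List ℕ} (hn : PolyFun n)
    (hl : PolyFun lv) : PolyFun fun γ => cyclic k (n γ) (lv γ) := by
  unfold _root_.cyclic
  have h : PolyFun fun x : Γ × ℕ =>
      ((List.range x.2).countP fun y => decide ((lv x.1).getD y 0 = (lv x.1).getD x.2 0)) % k :=
    .nat_mod (by fun_prop) k hk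
  fun_prop

@[fun_prop]
theorem PolyFun.blockSizes {c a : ℕ} {n : Γ → ℕ} {lv : Γ → List ℕ} (hn : PolyFun n)
    (hl : PolyFun lv) : PolyFun fun γ => blockSizes c a (n γ) (lv γ) := by
  unfold _root_.blockSizes
  have h : ∀ m, PolyFun fun γ => (List.range m).map fun j => (a * n γ) ^ j := fun m => by
    induction m with
    | zero => simp only [List.range_zero, List.map_nil]; fun_prop
    | succ m ih => simp only [List.range_succ, List.map_append, List.map_cons, List.map_nil]; fun_prop
  have h' : ∀ P : Γ → List ℕ, PolyFun P →
      PolyFun fun γ => (List.range (n γ)).map fun v => (P γ).getD ((lv γ).getD v 0) 1 :=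
    fun P hP => by fun_prop
  exact h' _ (h (c + 1))

theorem PolyFun.padding {k c : ℕ} (hk : 0 < k) {n : Γ → ℕ} {lv bs : Γ → List ℕ} (hn : PolyFun n)
    (hl : PolyFun lv) (hb : PolyFun bs) : PolyFun fun γ => padding k c (n γ) (lv γ) (bs γ) := by
  unfold _root_.padding
  have := PolyFun.cyclic hk hn hl
  fun_prop

@[fun_prop]
theorem PolyFun.blockNodes {n pad : Γ → ℕ} {bs : Γ → List ℕ} (hn : PolyFun n)
    (hb : PolyFun bs) (hp : PolyFun pad) :
    PolyFun fun γ => blockNodes (n γ) (bs γ) (pad γ) := by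
  unfold _root_.blockNodes
  fun_prop

@[fun_prop]
theorem PolyFun.blockEdges {R : ℕ} {n : Γ → ℕ} {es : Γ → List (List Bool)} {lv bs : Γ → List ℕ}
    {N : Γ → List (ℕ × ℕ)} (hn : PolyFun n) (he : PolyFun es) (hl : PolyFun lv) (hb : PolyFun bs)
    (hN : PolyFun N) : PolyFun fun γ => blockEdges R (n γ) (es γ) (lv γ) (bs γ) (N γ) := by
  unfold _root_.blockEdges blowUp tie
  fun_prop

@[fun_prop]
theorem PolyFun.representatives {n : Γ → ℕ} {N : Γ → List (ℕ × ℕ)} {p : Γ → List ℕ}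
    (hn : PolyFun n) (hN : PolyFun N) (hp : PolyFun p) :
    PolyFun fun γ => representatives (n γ) (N γ) (p γ) := by
  unfold _root_.representatives
  fun_prop

end

/-! ### Encodings as lists -/

/-- The characteristic vector of a set of nodes. -/
def bits {n : ℕ} (e : Finset (Fin n)) : List Bool := List.ofFn fun v => decide (v ∈ e)

/-- The list of the part numbers of the nodes. -/
def partList {n k : ℕ} (P : Fin n → Fin k) : List ℕ := List.ofFn fun v => (P v : ℕ)

/-- The partitioning with a given list of part numbers, reduced modulo `k`. -/
def toPart (n : ℕ) {k : ℕ} (hk : 0 < k) (l : List ℕ) : Fin n → Fin k :=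
  fun v => ⟨l.getD v 0 % k, Nat.mod_lt _ hk⟩

theorem code_bits {n : ℕ} (e : Finset (Fin n)) : code (bits e) = encSet e := by
  simp [code, bits, encSet, Function.comp_def]

theorem code_partList {n k : ℕ} (P : Fin n → Fin k) : code (partList P) = encPart P := by
  simp [code, partList, encPart, Function.comp_def]

theorem length_bits {n : ℕ} (e : Finset (Fin n)) : (bits e).length = n := by simp [bits]

theorem length_partList {n k : ℕ} (P : Fin n → Fin k) : (partList P).length = n := by
  simp [partList]

theorem bits_getD {n : ℕ} (e : Finset (Fin n)) (v : Fin n) :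
    (bits e).getD v false = decide (v ∈ e) := by
  simp [bits]

theorem bits_getD_of_le {n : ℕ} (e : Finset (Fin n)) {v : ℕ} (h : n ≤ v) :
    (bits e).getD v false = false := by
  simp [bits, h]

theorem partList_getD {n k : ℕ} (P : Fin n → Fin k) (v : Fin n) (d : ℕ) :
    (partList P).getD v d = P v := by
  simp [partList]

theorem partList_toPart {n k : ℕ} (hk : 0 < k) {l : List ℕ} (hl : l.length = n)
    (h : ∀ x ∈ l, x < k) : partList (toPart n hk l) = l := by
  subst hl
  refine List.ext_getElem (by simp [partList]) fun i h1 h2 => ?_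
  simp [partList, toPart, Nat.mod_eq_of_lt (h _ (List.getElem_mem h2))]

theorem wt_bits {n : ℕ} (e : Finset (Fin n)) : wt (bits e) ≤ n := by
  refine (wt_list_le (M := 0) fun b _ => le_rfl).trans ?_
  simp [length_bits]

theorem wt_partList {n k : ℕ} (P : Fin n → Fin k) : wt (partList P) ≤ n * (k + 1) := by
  refine (wt_list_le (M := k) fun b hb => ?_).trans ?_
  · obtain ⟨v, rfl⟩ := (List.mem_ofFn' _ _).1 hb
    exact (P v).2.le
  · simp [length_partList]

/-- A hypergraph as its number of nodes and the list of the characteristic vectors of its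
hyperedges. -/
def HGraph.lists (H : HGraph) : ℕ × List (List Bool) := (H.n, H.edges.map bits)

/-- The characteristic vectors of the constraint sets. -/
def MultiInst.sets {c : ℕ} (I : MultiInst c) : List (List Bool) := List.ofFn fun j => bits (I.V j)

theorem HGraph.code_lists (H : HGraph) : code H.lists = H.enc := by
  simp only [HGraph.lists, HGraph.enc, code, List.map_map]
  congr 2
  exact List.map_congr_left fun e _ => code_bits e

instance (c : ℕ) : TEnc (MultiInst c) := ⟨MultiInst.enc, fun I => I.size⟩

theorem MultiInst.code_lists {c : ℕ} (I : MultiInst c) :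
    code (I.toHGraph.lists, I.sets) = I.enc := by
  have h := I.toHGraph.code_lists
  have h' : code I.sets = encList (List.ofFn fun j => encSet (I.V j)) := by
    have : code I.sets = encList (I.sets.map code) := rfl
    rw [this, MultiInst.sets, List.map_ofFn]
    congr 2
    funext j
    exact code_bits _
  unfold MultiInst.enc
  rw [← h, ← h']
  rfl

theorem HGraph.wt_lists (H : HGraph) : wt H.lists ≤ H.n + H.edges.length * (H.n + 1) := by
  rw [HGraph.lists, wt_prod]
  gcongr
  · rfl
  · refine (wt_list_le (M := H.n) fun b hb => ?_).trans (by simp)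
    obtain ⟨e, _, rfl⟩ := List.mem_map.1 hb
    exact wt_bits e

theorem MultiInst.wt_sets {c : ℕ} (I : MultiInst c) : wt I.sets ≤ c * (I.n + 1) := by
  refine (wt_list_le (M := I.n) fun b hb => ?_).trans (by simp [MultiInst.sets])
  obtain ⟨j, rfl⟩ := (List.mem_ofFn' _ _).1 hb
  exact wt_bits _

theorem MultiInst.wt_lists {c : ℕ} (I : MultiInst c) :
    wt (I.toHGraph.lists, I.sets) ≤ (I.size + c) * (I.size + 2) := by
  have h1 := I.toHGraph.wt_lists
  have h2 := I.wt_sets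
  have : I.size = I.n + I.edges.length := rfl
  rw [wt_prod]
  dsimp only
  rw [this]
  nlinarith

@[fun_prop]
theorem PolyFun.multiInst_lists {c : ℕ} :
    PolyFun fun I : MultiInst c => (I.toHGraph.lists, I.sets) := by
  refine .of_code_eq (PolyBdd.mono (g := fun I => (wt I + c) * (wt I + 2)) (by fun_prop)
    fun I => I.wt_lists) fun I => I.code_lists.symm

@[fun_prop]
theorem PolyFun.multiInst_n {c : ℕ} : PolyFun fun I : MultiInst c => I.n :=
  multiInst_lists.fst.fst

@[fun_prop]
theorem PolyFun.multiInst_edges {c : ℕ} : PolyFun fun I : MultiInst c => I.edges.map bits :=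
  multiInst_lists.fst.snd

@[fun_prop]
theorem PolyFun.multiInst_sets {c : ℕ} : PolyFun fun I : MultiInst c => I.sets :=
  multiInst_lists.snd

theorem PolyFun.runsIn {A B : Type} [TEnc A] [TEnc B] {f : A → B} (hf : PolyFun f) :
    ∃ (p : Cmd) (C d : ℕ), ∀ a, RunsIn p (code a) (code (f a)) (C * (wt a + 1) ^ d) := by
  obtain ⟨⟨p, T, ⟨C, d, hT⟩, hp⟩, _⟩ := hf
  refine ⟨p, C, d, fun a => ?_⟩
  obtain ⟨t, ht, h⟩ := hp a
  exact h.runsIn (ht.trans (hT a))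

/-- The set of nodes with a given characteristic vector. -/
def toSet (n : ℕ) (b : List Bool) : Finset (Fin n) := {v | b.getD v false = true}

theorem bits_toSet {n : ℕ} {b : List Bool} (h : b.length = n) : bits (toSet n b) = b := by
  subst h
  exact List.ext_getElem (by simp [bits]) fun i h1 h2 => by simp [bits, toSet]

/-- The hypergraph with the hyperedges given by the characteristic vectors in the list `L`. -/
abbrev HGraph.ofLists (n : ℕ) (L : List (List Bool)) : HGraph where
  n := n
  edges := ((L.map (toSet n)).filter fun e => decide e.Nonempty).dedup
  nodup := List.nodup_dedup _
  nonempty e he := by simpa using (List.mem_filter.1 (List.mem_dedup.1 he)).2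

theorem HGraph.edges_ofLists {n : ℕ} {L : List (List Bool)} (h : L.Nodup)
    (hl : ∀ b ∈ L, b.length = n) (ht : ∀ b ∈ L, true ∈ b) :
    (HGraph.ofLists n L).edges = L.map (toSet n) := by
  have h1 : ((L.map (toSet n)).filter fun e => decide e.Nonempty) = L.map (toSet n) := by
    rw [List.filter_eq_self]
    intro e he
    obtain ⟨b, hb, rfl⟩ := List.mem_map.1 he
    obtain ⟨i, hi, hb'⟩ := List.getElem_of_mem (ht b hb)
    have hn := hl b hb
    subst hn
    simp only [decide_eq_true_eq]
    exact ⟨⟨i, hi⟩, by simp [toSet, hb']⟩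
  have h2 : (L.map (toSet n)).Nodup := by
    refine List.Nodup.map_on (fun b hb b' hb' e => ?_) h
    rw [← bits_toSet (hl b hb), e, bits_toSet (hl b' hb')]
  unfold HGraph.ofLists
  simp only [h1]
  exact List.dedup_eq_self.2 h2

theorem HGraph.lists_ofLists {n : ℕ} {L : List (List Bool)} (h : L.Nodup)
    (hl : ∀ b ∈ L, b.length = n) (ht : ∀ b ∈ L, true ∈ b) :
    (HGraph.ofLists n L).lists = (n, L) := by
  have e : (L.map (toSet n)).map bits = L := by
    rw [List.map_map]
    conv_rhs => rw [← List.map_id L]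
    exact List.map_congr_left fun b hb => bits_toSet (hl b hb)
  exact Prod.ext rfl ((congrArg (List.map bits) (HGraph.edges_ofLists h hl ht)).trans e)

theorem countP_range (n : ℕ) (p : ℕ → Bool) :
    (List.range n).countP p = (Finset.univ.filter fun v : Fin n => p v = true).card := by
  rw [← List.map_coe_finRange_eq_range, List.countP_map, List.countP_eq_length_filter,
    Fin.univ_def, Finset.card_def, Finset.filter_val, Multiset.filter_coe, Multiset.coe_card]
  congr 1
  exact List.filter_congr fun v _ => by simp

/-! ### Levels and balance -/

theorem balancedOn_zero_iff {n k : ℕ} (hk : 0 < k) (X : Finset (Fin n)) (P : Fin n → Fin k) :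
    BalancedOn 0 X P ↔ ∀ i, k * (X.filter fun v => P v = i).card ≤ X.card := by
  refine forall_congr' fun i => ?_
  have : (0 : ℝ) < k := by exact_mod_cast hk
  rw [add_zero, one_mul, le_div_iff₀ this, mul_comm]
  exact_mod_cast Iff.rfl

namespace MultiInst

variable {c : ℕ} (I : MultiInst c)

/-- The level of a node: `j + 1` on `V j`, and `0` on the unconstrained nodes. -/
def level (v : Fin I.n) : ℕ := (levels c I.n I.sets).getD v 0

theorem level_eq (v : Fin I.n) : I.level v = ∑ j : Fin c, if v ∈ I.V j then (j : ℕ) + 1 else 0 := by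
  have h : ∀ j : Fin c, (bif (I.sets.getD j []).getD v false then (j : ℕ) + 1 else 0) =
      if v ∈ I.V j then (j : ℕ) + 1 else 0 := fun j => by
    have : I.sets.getD j [] = bits (I.V j) := by simp [sets]
    rw [this, bits_getD]
    by_cases h : v ∈ I.V j <;> simp [h]
  unfold level levels
  rw [List.getD_eq_getElem _ _ (by simp), List.getElem_map, List.getElem_range,
    ← List.map_coe_finRange_eq_range, List.map_map, ← List.sum_ofFn, List.ofFn_eq_map]
  congr 1
  exact List.map_congr_left fun j _ => h j

theorem level_of_mem {v : Fin I.n} {j : Fin c} (h : v ∈ I.V j) : I.level v = j + 1 := by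
  rw [level_eq, Finset.sum_eq_single j, if_pos h]
  · intro j' _ hj
    exact if_neg fun h' => Finset.disjoint_left.1 (I.disj _ _ hj) h' h
  · simp

theorem level_eq_zero_of_forall {v : Fin I.n} (h : ∀ j, v ∉ I.V j) : I.level v = 0 := by
  simp [level_eq, h]

theorem level_eq_iff {v : Fin I.n} {j : Fin c} : I.level v = j + 1 ↔ v ∈ I.V j := by
  refine ⟨fun h => ?_, I.level_of_mem⟩
  by_cases h' : ∃ j, v ∈ I.V j
  · obtain ⟨j', hj⟩ := h'
    rw [I.level_of_mem hj] at h
    have : j' = j := by ext; omega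
    exact this ▸ hj
  · push Not at h'
    rw [I.level_eq_zero_of_forall h'] at h
    omega

theorem level_le (v : Fin I.n) : I.level v ≤ c := by
  by_cases h' : ∃ j, v ∈ I.V j
  · obtain ⟨j, hj⟩ := h'
    rw [I.level_of_mem hj]
    omega
  · push Not at h'
    rw [I.level_eq_zero_of_forall h']
    omega

/-- The number of nodes of a level. -/
def levelCard (l : ℕ) : ℕ := (Finset.univ.filter fun v => I.level v = l).card

/-- The number of nodes of a level in a part. -/
def partCard {k : ℕ} (P : Fin I.n → Fin k) (l : ℕ) (i : Fin k) : ℕ :=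
  (Finset.univ.filter fun v => I.level v = l ∧ P v = i).card

theorem sum_partCard {k : ℕ} (P : Fin I.n → Fin k) (l : ℕ) :
    ∑ i, I.partCard P l i = I.levelCard l := by
  unfold partCard levelCard
  rw [Finset.card_eq_sum_card_fiberwise (f := P) (t := Finset.univ) (by simp)]
  simp [Finset.filter_filter]

theorem feasible_zero_iff {k : ℕ} (hk : 0 < k) (P : Fin I.n → Fin k) :
    I.Feasible 0 P ↔ ∀ j < c, ∀ i, k * I.partCard P (j + 1) i ≤ I.levelCard (j + 1) := by
  have h : ∀ j : Fin c, (Finset.univ.filter fun v => I.level v = j + 1) = I.V j := fun j => by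
    ext v; simp [level_eq_iff]
  constructor
  · intro hP j hj i
    have := (balancedOn_zero_iff hk _ _).1 (hP ⟨j, hj⟩) i
    rw [← h, Finset.filter_filter] at this
    exact this
  · intro hP j
    rw [balancedOn_zero_iff hk, ← h]
    intro i
    rw [Finset.filter_filter]
    exact hP j j.2 i

theorem evenOn_iff {k : ℕ} (hk : 0 < k) (P : Fin I.n → Fin k) :
    evenOn k c I.n (levels c I.n I.sets) (partList P) = true ↔ I.Feasible 0 P := by
  rw [feasible_zero_iff _ hk]
  simp only [evenOn, List.all_eq_true, List.mem_range, Nat.ble_eq, countP_range, Bool.and_eq_true,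
    decide_eq_true_eq]
  refine forall₂_congr fun j hj => ?_
  constructor
  · intro h i
    convert h i i.2 using 2
    · unfold partCard
      congr 1
      ext v
      simp only [Finset.mem_filter, Finset.mem_univ, true_and, partList_getD, Fin.ext_iff]
      rfl
    · rfl
  · intro h i hi
    convert h ⟨i, hi⟩ using 2
    · unfold partCard
      congr 1
      ext v
      simp only [Finset.mem_filter, Finset.mem_univ, true_and, partList_getD, Fin.ext_iff]
      rfl
    · rfl

theorem Feasible.dvd {I : MultiInst c} {k : ℕ} (hk : 0 < k) {P : Fin I.n → Fin k}
    (h : I.Feasible 0 P) {j : ℕ} (hj : j < c) :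
    ∀ i, k * I.partCard P (j + 1) i = I.levelCard (j + 1) := by
  have h1 := (I.feasible_zero_iff hk P).1 h j hj
  have h2 : ∑ i, k * I.partCard P (j + 1) i = ∑ _i : Fin k, I.levelCard (j + 1) := by
    rw [← Finset.mul_sum, sum_partCard]
    simp
  intro i
  exact (Finset.sum_eq_sum_iff_of_le fun i _ => h1 i).1 h2 i (Finset.mem_univ i)

/-- The partitioning that deals out the nodes of each positive level cyclically. -/
def cyclicPart {k : ℕ} (hk : 0 < k) : Fin I.n → Fin k :=
  toPart I.n hk (cyclic k I.n (levels c I.n I.sets))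

theorem partList_cyclicPart {k : ℕ} (hk : 0 < k) :
    partList (I.cyclicPart hk) = cyclic k I.n (levels c I.n I.sets) := by
  refine partList_toPart hk (by simp [cyclic]) fun x hx => ?_
  obtain ⟨v, _, rfl⟩ := List.mem_map.1 hx
  rw [Bool.cond_decide]
  split_ifs
  · exact hk
  · exact Nat.mod_lt _ hk

/-- Counting the elements of a set of natural numbers whose rank lies in a residue class. -/
theorem _root_.countP_rank_mod (p : ℕ → Bool) (k i n : ℕ) :
    (List.range n).countP (fun v => p v && decide ((List.range v).countP p % k = i)) =
      (List.range ((List.range n).countP p)).countP fun r => decide (r % k = i) := by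
  induction n with
  | zero => rfl
  | succ n ih =>
    rw [List.range_succ, List.countP_append, ih, List.countP_append]
    cases h : p n
    · simp [h]
    · simp [h, List.range_succ]

theorem feasible_cyclicPart {k : ℕ} (hk : 0 < k) (h : ∀ j < c, k ∣ I.levelCard (j + 1)) :
    I.Feasible 0 (I.cyclicPart hk) := by
  rw [← evenOn_iff _ hk, partList_cyclicPart]
  simp only [evenOn, List.all_eq_true, List.mem_range, Nat.ble_eq]
  intro j hj i hi
  set lv := levels c I.n I.sets
  have e : (List.range I.n).countP (fun v => decide (lv.getD v 0 = j + 1)) =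
      I.levelCard (j + 1) := by
    rw [countP_range]; simp only [decide_eq_true_eq]; rfl
  have e2 : (List.range I.n).countP (fun v => decide (lv.getD v 0 = j + 1) &&
        decide ((cyclic k I.n lv).getD v 0 = i)) =
      (List.range I.n).countP (fun v => decide (lv.getD v 0 = j + 1) &&
        decide ((List.range v).countP (fun v => decide (lv.getD v 0 = j + 1)) % k = i)) := by
    refine List.countP_congr fun v hv => ?_
    have hv := List.mem_range.1 hv
    simp only [Bool.and_eq_true, decide_eq_true_eq]
    refine and_congr_right fun hl => ?_
    unfold cyclic
    rw [List.getD_eq_getElem _ _ (by simpa using hv), List.getElem_map, List.getElem_range, hl]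
    simp
  rw [e2, countP_rank_mod, e]
  obtain ⟨q, hq⟩ := h j hj
  have h1 := Nat.count_modEq_card (I.levelCard (j + 1)) hk i
  unfold Nat.count at h1
  simp only [Nat.ModEq, Nat.mod_eq_of_lt hi] at h1
  rw [h1, hq]
  simp [hk]

end MultiInst

/-! ### Costs as sums -/

/-- The contribution of a hyperedge that intersects `l` parts to the cost. -/
def Metric.price : Metric → ℕ → ℕ
  | cutNet, l => if 1 < l then 1 else 0
  | connectivity, l => l - 1

theorem Metric.price_mono (μ : Metric) {l l' : ℕ} (h : l ≤ l') : μ.price l ≤ μ.price l' := by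
  cases μ <;> simp only [price]
  · split_ifs <;> omega
  · omega

theorem Metric.price_eq_zero (μ : Metric) {l : ℕ} (h : l ≤ 1) : μ.price l = 0 := by
  cases μ <;> simp only [price]
  · rw [if_neg (by omega)]
  · omega

theorem Metric.one_le_price (μ : Metric) {l : ℕ} (h : 2 ≤ l) : 1 ≤ μ.price l := by
  cases μ <;> simp only [price]
  · rw [if_pos (by omega)]
  · omega

theorem Metric.price_le (μ : Metric) (l : ℕ) : μ.price l ≤ l - 1 := by
  cases μ <;> simp only [price]
  · split_ifs <;> omega
  · omega

theorem HGraph.cost_eq_list (H : HGraph) {k : ℕ} (P : Fin H.n → Fin k) (μ : Metric) :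
    H.cost P μ = (H.edges.map fun e => μ.price (lam P e)).sum := by
  cases μ
  · unfold HGraph.cost Metric.price
    generalize H.edges = l
    induction l with
    | nil => rfl
    | cons e l ih =>
      by_cases h : 1 < lam P e
      · simp [h, ← ih]; omega
      · simp [h, ← ih]
  · rfl

theorem HGraph.cost_eq_sum (H : HGraph) {k : ℕ} (P : Fin H.n → Fin k) (μ : Metric) :
    H.cost P μ = ∑ e ∈ H.edges.toFinset, μ.price (lam P e) := by
  rw [cost_eq_list, List.sum_toFinset _ H.nodup]

theorem HGraph.cost_le (H : HGraph) {k : ℕ} (P : Fin H.n → Fin k) (μ : Metric) :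
    H.cost P μ ≤ (k - 1) * H.edges.length := by
  rw [cost_eq_list]
  refine (List.sum_le_card_nsmul _ (k - 1) fun x hx => ?_).trans (by simp [mul_comm])
  obtain ⟨e, _, rfl⟩ := List.mem_map.1 hx
  refine (μ.price_le _).trans (Nat.sub_le_sub_right ?_ 1)
  exact (Finset.card_le_univ _).trans (by simp)

theorem lam_le_one_iff {n k : ℕ} (P : Fin n → Fin k) (e : Finset (Fin n)) :
    lam P e ≤ 1 ↔ ∀ v ∈ e, ∀ w ∈ e, P v = P w := by
  simp [lam, Finset.card_le_one]

/-! ### Mixed radix representations -/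

/-- If the counts of each level sum up to `tot`, and their radix `u` combinations are at most
the average up to an error that concerns level `0` only, then each positive level is balanced: if the
top level were not, then divisibility would make its excess at least `1`, that is `u ^ (c + 1)` in the
combination, which the lower levels cannot make up for; and an exactly balanced level cancels. -/
theorem balanced_of_radix {k : ℕ} (u : ℕ) (cnt : ℕ → Fin k → ℕ) (tot : ℕ → ℕ)
    (htot : ∀ l, ∑ i, cnt l i = tot l) (c : ℕ) (hdvd : ∀ j < c, k ∣ tot (j + 1))
    (hu : ∑ l ∈ Finset.range (c + 1), tot l ≤ u)
    (h : ∀ i, k * ∑ l ∈ Finset.range (c + 1), u ^ l * cnt l i ≤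
      ∑ l ∈ Finset.range (c + 1), u ^ l * tot l + (k - 1) * tot 0) :
    ∀ j < c, ∀ i, k * cnt (j + 1) i ≤ tot (j + 1) := by
  induction c with
  | zero => simp
  | succ c ih =>
    have top : ∀ i, k * cnt (c + 1) i ≤ tot (c + 1) := by
      intro i
      by_contra! hlt
      have hi := h i
      have hk : 0 < k := Nat.pos_of_ne_zero fun h0 => by simp [h0] at hlt
      obtain ⟨q, hq⟩ := hdvd c (by omega)
      have h1 : q + 1 ≤ cnt (c + 1) i := by
        rw [hq] at hlt; exact Nat.lt_of_mul_lt_mul_left hlt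
      have hpos : 1 ≤ tot (c + 1) := by
        have := Finset.single_le_sum (f := cnt (c + 1)) (fun _ _ => Nat.zero_le _) (Finset.mem_univ i)
        rw [htot] at this; omega
      rw [Finset.sum_range_succ, Finset.sum_range_succ _ (c + 1)] at hi
      rw [Finset.sum_range_succ] at hu
      have hu1 : 1 ≤ u := by omega
      have h2 : ∑ l ∈ Finset.range (c + 1), u ^ l * tot l ≤
          u ^ c * ∑ l ∈ Finset.range (c + 1), tot l := by
        rw [Finset.mul_sum]
        refine Finset.sum_le_sum fun l hl => Nat.mul_le_mul_right _ (Nat.pow_le_pow_right hu1 ?_)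
        have := Finset.mem_range.1 hl; omega
      have h3 : tot 0 ≤ u ^ c * ∑ l ∈ Finset.range (c + 1), tot l := by
        have h4 := Finset.single_le_sum (f := tot) (s := Finset.range (c + 1))
          (fun _ _ => Nat.zero_le _) (Finset.mem_range.2 (Nat.succ_pos c))
        have h5 : 1 ≤ u ^ c := Nat.one_le_pow _ _ hu1
        nlinarith
      have h4 : u ^ c * ∑ l ∈ Finset.range (c + 1), tot l < u ^ c * u :=
        Nat.mul_lt_mul_of_pos_left (by omega) (Nat.pow_pos hu1)
      set Z := u ^ c * ∑ l ∈ Finset.range (c + 1), tot l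
      have h6 : u ^ (c + 1) * (k * (q + 1)) ≤ k * (u ^ (c + 1) * cnt (c + 1) i) := by
        calc _ = k * (u ^ (c + 1) * (q + 1)) := by ring
          _ ≤ _ := by gcongr
      have h7 : k * u ^ (c + 1) ≤ Z + (k - 1) * tot 0 := by
        have h8 : 0 ≤ k * ∑ l ∈ Finset.range (c + 1), u ^ l * cnt l i := Nat.zero_le _
        rw [mul_add] at hi
        rw [hq] at hi
        nlinarith
      obtain ⟨k', rfl⟩ := Nat.exists_eq_succ_of_ne_zero hk.ne'
      simp only [Nat.succ_eq_add_one, Nat.add_sub_cancel] at h7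
      have h8 : k' * tot 0 ≤ k' * Z := Nat.mul_le_mul_left _ h3
      have h9 : (k' + 1) * Z < (k' + 1) * u ^ (c + 1) :=
        Nat.mul_lt_mul_of_pos_left (by rw [pow_succ]; exact h4) (by omega)
      have h10 : (k' + 1) * Z = k' * Z + Z := by ring
      omega
    have eq : ∀ i, k * cnt (c + 1) i = tot (c + 1) := fun i => by
      have h2 : ∑ i, k * cnt (c + 1) i = ∑ _i : Fin k, tot (c + 1) := by
        rw [← Finset.mul_sum, htot]; simp
      exact (Finset.sum_eq_sum_iff_of_le fun i _ => top i).1 h2 i (Finset.mem_univ i)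
    intro j hj i
    rcases Nat.lt_succ_iff_lt_or_eq.1 hj with hj | rfl
    · refine ih (fun j hj => hdvd j (by omega)) ?_ (fun i => ?_) j hj i
      · rw [Finset.sum_range_succ] at hu; omega
      · have := h i
        rw [Finset.sum_range_succ, Finset.sum_range_succ _ (c + 1), ← eq i] at this
        have e : k * (u ^ (c + 1) * cnt (c + 1) i) = u ^ (c + 1) * (k * cnt (c + 1) i) := by ring
        rw [mul_add, e] at this
        omega
    · exact top i

/-- Functions with prescribed numbers of preimages exist. -/
theorem exists_coloring {k : ℕ} (hk : 0 < k) (y : Fin k → ℕ) :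
    ∃ q : ℕ → Fin k, ∀ i, (List.range (∑ i, y i)).countP (fun t => decide (q t = i)) = y i := by
  refine ⟨fun t => if h : t < ∑ i, y i then (finSigmaFinEquiv.symm ⟨t, h⟩).1 else ⟨0, hk⟩,
    fun i => ?_⟩
  rw [countP_range]
  simp only [decide_eq_true_eq, Fin.is_lt, dif_pos, Fin.eta]
  rw [← Finset.card_map finSigmaFinEquiv.symm.toEmbedding]
  have : (Finset.univ.filter fun v => (finSigmaFinEquiv.symm v).1 = i).map
      finSigmaFinEquiv.symm.toEmbedding =
      (Finset.univ : Finset (Fin (y i))).map (Function.Embedding.sigmaMk (β := fun i => Fin (y i)) i) := by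
    ext ⟨j, t⟩
    simp only [Finset.mem_filter, Finset.mem_univ, true_and, Finset.mem_map,
      Function.Embedding.sigmaMk_apply, Equiv.coe_toEmbedding]
    constructor
    · rintro ⟨a, rfl, h⟩
      rw [h]
      exact ⟨t, rfl⟩
    · rintro ⟨t', h⟩
      refine ⟨finSigmaFinEquiv ⟨j, t⟩, ?_, by simp⟩
      rw [Equiv.symm_apply_apply]
      exact (congrArg Sigma.fst h).symm
  rw [this, Finset.card_map, Finset.card_univ, Fintype.card_fin]

/-! ### Sets of nodes cut out of a list by a predicate -/

section

variable {A B : Type}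

theorem exists_factor [Nonempty B] {N : List A} (h : N.Nodup) (P : Fin N.length → B) :
    ∃ φ : A → B, ∀ j : Fin N.length, P j = φ N[j] := by
  have hinj : Function.Injective fun j : Fin N.length => N[j] := fun i j hij =>
    (List.nodup_iff_injective_get.1 h) hij
  refine ⟨Function.extend (fun j : Fin N.length => N[j]) P fun _ => Classical.arbitrary B,
    fun j => (hinj.extend_apply P _ j).symm⟩

theorem card_filter_getElem (N : List A) (p : A → Bool) :
    (Finset.univ.filter fun j : Fin N.length => p N[j] = true).card = N.countP p := by
  conv_rhs => rw [← List.map_getElem_finRange N]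
  rw [List.countP_map, List.countP_eq_length_filter,
    Fin.univ_def, Finset.card_def, Finset.filter_val, Multiset.filter_coe, Multiset.coe_card]
  congr 1
  exact List.filter_congr fun v _ => by simp

theorem mem_toSet_map (N : List A) (p : A → Bool) (j : Fin N.length) :
    j ∈ toSet N.length (N.map p) ↔ p N[j] = true := by
  simp [toSet]

theorem mem_image_toSet_map {k : ℕ} (N : List A) (p : A → Bool) (P : Fin N.length → Fin k)
    {φ : A → Fin k} (hφ : ∀ j : Fin N.length, P j = φ N[j]) (i : Fin k) :
    i ∈ (toSet N.length (N.map p)).image P ↔ ∃ x ∈ N, p x = true ∧ φ x = i := by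
  simp only [Finset.mem_image, mem_toSet_map, hφ]
  constructor
  · rintro ⟨j, h, rfl⟩
    exact ⟨_, List.getElem_mem j.2, h, rfl⟩
  · rintro ⟨x, hx, h, rfl⟩
    obtain ⟨j, hj, rfl⟩ := List.getElem_of_mem hx
    exact ⟨⟨j, hj⟩, h, rfl⟩

end

namespace MultiInst

variable {c : ℕ} (I : MultiInst c) (k a R : ℕ)

/-! ### The constructed hypergraph -/

/-- The list of the levels of the nodes. -/
def lvls : List ℕ := levels c I.n I.sets

/-- The list of the block sizes. -/
def blocks : List ℕ := blockSizes c a I.n I.lvls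

/-- The number of isolated nodes. -/
def pad : ℕ := padding k c I.n I.lvls (I.blocks a)

/-- The nodes of the constructed hypergraph, as pairs. -/
def nodes : List (ℕ × ℕ) := blockNodes I.n (I.blocks a) (I.pad k a)

/-- The characteristic vectors of the hyperedges of the constructed hypergraph. -/
def reducedEdges : List (List Bool) :=
  blockEdges R I.n (I.edges.map bits) I.lvls (I.blocks a) (I.nodes k a)

/-- The hypergraph whose `k`-sections are to encode the feasible partitionings of `I`. -/
abbrev reduced : HGraph := HGraph.ofLists (I.nodes k a).length (I.reducedEdges k a R)

/-- The number of nodes of the block that replaces a node. -/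
def bsize (v : Fin I.n) : ℕ := (a * I.n) ^ I.level v

variable {a} in
theorem bsize_pos (ha : 0 < a) (v : Fin I.n) : 0 < I.bsize a v :=
  Nat.pow_pos (Nat.mul_pos ha v.pos)

theorem blocks_getD (v : Fin I.n) : (I.blocks a).getD v 0 = I.bsize a v := by
  have h : I.lvls.getD v 0 = I.level v := rfl
  unfold blocks blockSizes
  rw [List.getD_eq_getElem _ _ (by simp), List.getElem_map, List.getElem_range, h,
    List.getD_eq_getElem _ _ (by simpa [Nat.lt_succ_iff] using I.level_le v), List.getElem_map,
    List.getElem_range]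
  rfl

theorem length_blocks : (I.blocks a).length = I.n := by simp [blocks, blockSizes]

theorem blocks_append_getD (p : ℕ) (v : Fin I.n) :
    (I.blocks a ++ [p]).getD v 0 = I.bsize a v := by
  rw [← blocks_getD, List.getD_append _ _ _ _ (by simp [length_blocks])]

theorem blocks_append_getD_n (p : ℕ) : (I.blocks a ++ [p]).getD I.n 0 = p := by
  rw [List.getD_append_right _ _ _ _ (by simp [length_blocks])]
  simp [length_blocks]

theorem mem_nodes (x : ℕ × ℕ) : x ∈ I.nodes k a ↔
    (∃ v : Fin I.n, x.1 = v ∧ x.2 < I.bsize a v) ∨ (x.1 = I.n ∧ x.2 < I.pad k a) := by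
  obtain ⟨v, t⟩ := x
  simp only [nodes, blockNodes, List.mem_flatMap, List.mem_range, List.mem_map, Prod.mk.injEq]
  constructor
  · rintro ⟨w, hw, s, hs, rfl, rfl⟩
    rcases Nat.lt_succ_iff_lt_or_eq.1 hw with h | rfl
    · exact .inl ⟨⟨w, h⟩, rfl, by rwa [← I.blocks_append_getD a _ ⟨w, h⟩]⟩
    · exact .inr ⟨rfl, by rwa [blocks_append_getD_n] at hs⟩
  · rintro (⟨w, rfl, h⟩ | ⟨rfl, h⟩)
    · exact ⟨w, by omega, t, by rwa [blocks_append_getD], rfl, rfl⟩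
    · exact ⟨I.n, by omega, t, by rwa [blocks_append_getD_n], rfl, rfl⟩

theorem nodup_nodes : (I.nodes k a).Nodup := by
  unfold nodes blockNodes
  rw [List.nodup_flatMap]
  refine ⟨fun v _ => List.nodup_range.map fun t t' h => (Prod.mk.inj h).2, ?_⟩
  refine List.nodup_range.imp fun {v w} h => ?_
  simp only [Function.onFun, List.disjoint_left, List.mem_map, List.mem_range]
  rintro _ ⟨t, _, rfl⟩ ⟨t', _, h'⟩
  exact h (Prod.mk.inj h').1.symm

theorem countP_nodes (p : ℕ × ℕ → Bool) : (I.nodes k a).countP p =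
    ∑ v, (List.range (I.bsize a v)).countP (fun t => p (v, t)) +
      (List.range (I.pad k a)).countP fun t => p (I.n, t) := by
  unfold nodes blockNodes
  rw [List.range_succ, List.flatMap_append, List.countP_append]
  congr 1
  · rw [List.countP_flatMap, ← List.map_coe_finRange_eq_range, List.map_map, ← List.ofFn_eq_map,
      List.sum_ofFn]
    refine Finset.sum_congr rfl fun v _ => ?_
    simp only [Function.comp_apply, blocks_append_getD, List.countP_map]
    rfl
  · simp only [List.flatMap_cons, List.flatMap_nil, List.append_nil, blocks_append_getD_n,
      List.countP_map]
    rfl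

theorem length_nodes : (I.nodes k a).length = ∑ v, I.bsize a v + I.pad k a := by
  have := I.countP_nodes k a fun _ => true
  simpa using this

/-- The hyperedge `e` with every node replaced by its block. -/
def blown (e : Finset (Fin I.n)) : Finset (Fin (I.nodes k a).length) :=
  toSet _ (blowUp (bits e) (I.nodes k a))

/-- A hyperedge inside a block, as a set. -/
def tieSet (v t : ℕ) (e : Finset (Fin I.n)) (r : ℕ) : Finset (Fin (I.nodes k a).length) :=
  toSet _ (tie I.n (I.nodes k a) v t (bits e) r)

theorem mem_reducedEdges (b : List Bool) : b ∈ I.reducedEdges k a R ↔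
    (∃ e ∈ I.edges, b = blowUp (bits e) (I.nodes k a)) ∨
    ∃ v : Fin I.n, I.level v ≠ 0 ∧ ∃ t < I.bsize a v, ∃ e ∈ I.edges, ∃ r < R,
      b = tie I.n (I.nodes k a) v t (bits e) r := by
  unfold reducedEdges blockEdges
  rw [List.mem_dedup, List.mem_append]
  refine or_congr (by simp [eq_comm]) ?_
  simp only [List.mem_flatMap, List.mem_range, Bool.cond_decide]
  constructor
  · rintro ⟨v, hv, h⟩
    split_ifs at h with h0
    · simp at h
    · simp only [List.mem_flatMap, List.mem_range, List.mem_map, exists_exists_and_eq_and] at h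
      obtain ⟨t, ht, e, he, r, hr, rfl⟩ := h
      exact ⟨⟨v, hv⟩, h0, t, by rwa [← I.blocks_getD a ⟨v, hv⟩], e, he, r, hr, rfl⟩
  · rintro ⟨v, h0, t, ht, e, he, r, hr, rfl⟩
    refine ⟨v, v.2, ?_⟩
    rw [if_neg (show ¬ I.lvls.getD v 0 = 0 from h0)]
    simp only [List.mem_flatMap, List.mem_range, List.mem_map, exists_exists_and_eq_and]
    exact ⟨t, by rwa [blocks_getD], e, he, r, hr, rfl⟩

theorem nodup_reducedEdges : (I.reducedEdges k a R).Nodup := List.nodup_dedup _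

theorem length_of_mem_reducedEdges {b : List Bool} (h : b ∈ I.reducedEdges k a R) :
    b.length = (I.nodes k a).length := by
  rcases (I.mem_reducedEdges k a R b).1 h with ⟨e, _, rfl⟩ | ⟨v, _, t, _, e, _, r, _, rfl⟩
  · simp [blowUp]
  · simp [tie]

variable {k a}

theorem mem_nodes_zero (ha : 0 < a) (v : Fin I.n) : ((v : ℕ), 0) ∈ I.nodes k a :=
  (I.mem_nodes k a _).2 (.inl ⟨v, rfl, I.bsize_pos ha v⟩)

theorem true_mem_of_mem_reducedEdges (ha : 0 < a) {b : List Bool}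
    (h : b ∈ I.reducedEdges k a R) : true ∈ b := by
  rcases (I.mem_reducedEdges k a R b).1 h with ⟨e, he, rfl⟩ | ⟨v, _, t, _, e, _, r, _, rfl⟩
  · obtain ⟨v, hv⟩ := I.nonempty e he
    exact List.mem_map.2 ⟨_, I.mem_nodes_zero ha v, by rw [bits_getD]; simpa using hv⟩
  · exact List.mem_map.2 ⟨_, I.mem_nodes_zero ha v, by simp⟩

theorem lists_reduced (ha : 0 < a) :
    (I.reduced k a R).lists = ((I.nodes k a).length, I.reducedEdges k a R) :=
  HGraph.lists_ofLists (I.nodup_reducedEdges k a R)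
    (fun _ => I.length_of_mem_reducedEdges k a R) fun _ => I.true_mem_of_mem_reducedEdges R ha

theorem mem_edges_reduced (ha : 0 < a) (s : Finset (Fin (I.nodes k a).length)) :
    s ∈ (I.reduced k a R).edges ↔ (∃ e ∈ I.edges, s = I.blown k a e) ∨
    ∃ v : Fin I.n, I.level v ≠ 0 ∧ ∃ t < I.bsize a v, ∃ e ∈ I.edges, ∃ r < R,
      s = I.tieSet k a v t e r := by
  have h : (I.reduced k a R).edges = (I.reducedEdges k a R).map (toSet _) :=
    HGraph.edges_ofLists (I.nodup_reducedEdges k a R)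
      (fun _ => I.length_of_mem_reducedEdges k a R) fun _ => I.true_mem_of_mem_reducedEdges R ha
  rw [h]
  refine List.mem_map.trans ?_
  simp only [mem_reducedEdges]
  constructor
  · rintro ⟨b, ⟨e, he, rfl⟩ | ⟨v, h0, t, ht, e, he, r, hr, rfl⟩, rfl⟩
    · exact .inl ⟨e, he, rfl⟩
    · exact .inr ⟨v, h0, t, ht, e, he, r, hr, rfl⟩
  · rintro (⟨e, he, rfl⟩ | ⟨v, h0, t, ht, e, he, r, hr, rfl⟩)
    · exact ⟨_, .inl ⟨e, he, rfl⟩, rfl⟩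
    · exact ⟨_, .inr ⟨v, h0, t, ht, e, he, r, hr, rfl⟩, rfl⟩

theorem blown_injective (ha : 0 < a) : Function.Injective (I.blown k a) := fun e e' h => by
  ext v
  obtain ⟨j, hj, hv⟩ := List.getElem_of_mem (I.mem_nodes_zero (k := k) ha v)
  have h1 : ∀ e, (⟨j, hj⟩ : Fin (I.nodes k a).length) ∈ I.blown k a e ↔ v ∈ e := fun e => by
    unfold blown blowUp
    rw [mem_toSet_map]
    simp only [Fin.getElem_fin, hv, bits_getD, decide_eq_true_eq]
  rw [← h1, h, h1]

/-- The total number of nodes at a level, weighted by block sizes. -/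
theorem sum_bsize_filter {k : ℕ} (P : Fin I.n → Fin k) (i : Fin k) :
    ∑ v, (if P v = i then I.bsize a v else 0) =
      ∑ l ∈ Finset.range (c + 1), (a * I.n) ^ l * I.partCard P l i := by
  rw [← Finset.sum_fiberwise_of_maps_to (s := Finset.univ) (t := Finset.range (c + 1))
    (g := I.level) (fun v _ => Finset.mem_range.2 (Nat.lt_succ_of_le (I.level_le v)))]
  refine Finset.sum_congr rfl fun l _ => ?_
  rw [Finset.sum_ite, Finset.sum_const_zero, add_zero, Finset.filter_filter]
  unfold partCard
  rw [Finset.sum_congr rfl (g := fun _ => (a * I.n) ^ l), Finset.sum_const, smul_eq_mul, mul_comm]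
  intro v hv
  rw [← (Finset.mem_filter.1 hv).2.1]
  rfl

theorem sum_bsize : ∑ v, I.bsize a v =
    ∑ l ∈ Finset.range (c + 1), (a * I.n) ^ l * I.levelCard l := by
  rw [← Finset.sum_fiberwise_of_maps_to (s := Finset.univ) (t := Finset.range (c + 1))
    (g := I.level) (fun v _ => Finset.mem_range.2 (Nat.lt_succ_of_le (I.level_le v)))]
  refine Finset.sum_congr rfl fun l _ => ?_
  unfold levelCard
  rw [Finset.sum_congr rfl (g := fun _ => (a * I.n) ^ l), Finset.sum_const, smul_eq_mul, mul_comm]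
  intro v hv
  rw [← (Finset.mem_filter.1 hv).2]
  rfl

theorem sum_levelCard : ∑ l ∈ Finset.range (c + 1), I.levelCard l = I.n := by
  have h := Finset.card_eq_sum_card_fiberwise (s := Finset.univ) (t := Finset.range (c + 1))
    (f := I.level) (fun v _ => Finset.mem_coe.2 (Finset.mem_range.2 (Nat.lt_succ_of_le (I.level_le v))))
  rw [Finset.card_univ, Fintype.card_fin] at h
  exact h.symm

theorem sum_blocks : (I.blocks a).sum = ∑ v, I.bsize a v := by
  have h : I.blocks a = List.ofFn fun v => I.bsize a v := by
    refine List.ext_getElem (by simp [length_blocks]) fun i h1 h2 => ?_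
    have := I.blocks_getD a ⟨i, by simpa using h2⟩
    rw [List.getD_eq_getElem _ _ h1] at this
    simpa using this
  rw [h, List.sum_ofFn]

open Classical in
theorem pad_eq (hk : 0 < k) : I.pad k a = if I.Feasible 0 (I.cyclicPart hk) then
    (k - 1) * I.levelCard 0 else (k - 1) * ∑ v, I.bsize a v + 1 := by
  have h0 : (List.range I.n).countP (fun v => decide (I.lvls.getD v 0 = 0)) = I.levelCard 0 := by
    rw [countP_range]; simp only [decide_eq_true_eq]; rfl
  have h := I.evenOn_iff hk (I.cyclicPart hk)
  rw [partList_cyclicPart] at h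
  unfold pad padding
  rw [h0, sum_blocks]
  split_ifs with hf
  · have := h.2 hf
    unfold lvls
    rw [this]; rfl
  · have : evenOn k c I.n (levels c I.n I.sets) (cyclic k I.n (levels c I.n I.sets)) = false := by
      rw [← Bool.not_eq_true]; exact fun h' => hf (h.1 h')
    unfold lvls
    rw [this]; rfl

theorem Feasible.cyclicPart {I : MultiInst c} (hk : 0 < k) {P : Fin I.n → Fin k}
    (h : I.Feasible 0 P) : I.Feasible 0 (I.cyclicPart hk) :=
  I.feasible_cyclicPart hk fun _ hj => ⟨_, (h.dvd hk hj ⟨0, hk⟩).symm⟩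

end MultiInst

namespace MultiInst

variable {c : ℕ} (I : MultiInst c) {k a : ℕ} (R : ℕ)

/-! ### From feasible partitionings to sections -/

theorem isSection_iff (hk : 0 < k) (P : Fin (I.nodes k a).length → Fin k) {φ : ℕ × ℕ → Fin k}
    (hφ : ∀ j : Fin (I.nodes k a).length, P j = φ (I.nodes k a)[j]) :
    (I.reduced k a R).IsSection P ↔
      ∀ i, k * (I.nodes k a).countP (fun x => decide (φ x = i)) ≤ (I.nodes k a).length := by
  refine (balancedOn_zero_iff hk (Finset.univ : Finset (Fin (I.nodes k a).length)) P).trans ?_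
  refine forall_congr' fun i => ?_
  rw [← card_filter_getElem, Finset.card_univ, Fintype.card_fin]
  simp only [hφ, decide_eq_true_eq]

theorem mem_image_blown (P : Fin (I.nodes k a).length → Fin k) {φ : ℕ × ℕ → Fin k}
    (hφ : ∀ j : Fin (I.nodes k a).length, P j = φ (I.nodes k a)[j]) (e : Finset (Fin I.n))
    (i : Fin k) :
    i ∈ (I.blown k a e).image P ↔ ∃ v ∈ e, ∃ t < I.bsize a v, φ (v, t) = i := by
  unfold blown blowUp
  rw [mem_image_toSet_map _ _ _ hφ]
  constructor
  · rintro ⟨⟨w, t⟩, hx, he, hi⟩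
    rcases (I.mem_nodes k a _).1 hx with ⟨v, rfl, ht⟩ | ⟨rfl, ht⟩
    · exact ⟨v, by rw [bits_getD] at he; simpa using he, t, ht, hi⟩
    · rw [bits_getD_of_le _ le_rfl] at he
      exact absurd he (by simp)
  · rintro ⟨v, hv, t, ht, hi⟩
    exact ⟨(v, t), (I.mem_nodes k a _).2 (.inl ⟨v, rfl, ht⟩), by rw [bits_getD]; simpa using hv, hi⟩

theorem sum_price_blown_le (ha : 0 < a) (μ : Metric) (P : Fin (I.nodes k a).length → Fin k) :
    ∑ e ∈ I.edges.toFinset, μ.price (lam P (I.blown k a e)) ≤ (I.reduced k a R).cost P μ := by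
  rw [HGraph.cost_eq_sum, ← Finset.sum_image (f := fun s => μ.price (lam P s))
    fun e _ e' _ h => I.blown_injective ha h]
  refine Finset.sum_le_sum_of_subset fun s hs => ?_
  obtain ⟨e, he, rfl⟩ := Finset.mem_image.1 hs
  exact List.mem_toFinset.2 ((I.mem_edges_reduced R ha _).2 (.inl ⟨e, List.mem_toFinset.1 he, rfl⟩))

theorem cost_reduced_of_monochromatic (ha : 0 < a) (μ : Metric) {φ : ℕ × ℕ → Fin k}
    (P' : Fin (I.nodes k a).length → Fin k)
    (hφ : ∀ j : Fin (I.nodes k a).length, P' j = φ (I.nodes k a)[j])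
    (P : Fin I.n → Fin k) (h : ∀ v : Fin I.n, ∀ t, φ (v, t) = P v) :
    (I.reduced k a R).cost P' μ = I.cost P μ := by
  have hl : ∀ e, lam P' (I.blown k a e) = lam P e := fun e => by
    unfold lam
    congr 1
    ext i
    rw [mem_image_blown _ _ hφ, Finset.mem_image]
    refine exists_congr fun v => and_congr_right fun _ => ⟨fun ⟨t, _, ht⟩ => by rw [← ht, h],
      fun hi => ⟨0, I.bsize_pos ha v, by rw [h, hi]⟩⟩
  have e1 : ∑ e ∈ I.edges.toFinset, μ.price (lam P' (I.blown k a e)) =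
      ∑ s ∈ (I.reduced k a R).edges.toFinset, μ.price (lam P' s) := by
    rw [← Finset.sum_image (f := fun s => μ.price (lam P' s))
      fun e _ e' _ h => I.blown_injective ha h]
    refine Finset.sum_subset (fun s hs => ?_) fun s hs hs' => ?_
    · obtain ⟨e, he, rfl⟩ := Finset.mem_image.1 hs
      exact List.mem_toFinset.2
        ((I.mem_edges_reduced R ha _).2 (.inl ⟨e, List.mem_toFinset.1 he, rfl⟩))
    · rcases (I.mem_edges_reduced R ha _).1 (List.mem_toFinset.1 hs) with
        ⟨e, he, rfl⟩ | ⟨v, _, t, _, e, _, r, _, rfl⟩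
      · exact absurd (Finset.mem_image_of_mem _ (List.mem_toFinset.2 he)) hs'
      · refine μ.price_eq_zero ((lam_le_one_iff _ _).2 fun i hi j hj => ?_)
        have key : ∀ i ∈ I.tieSet k a v t e r, P' i = P v := fun i hi => by
          have := (mem_toSet_map _ _ _).1 hi
          simp only [Bool.and_eq_true, decide_eq_true_eq] at this
          rw [hφ, ← h v (I.nodes k a)[i].2, ← this.1]
        rw [key i hi, key j hj]
  rw [HGraph.cost_eq_sum, HGraph.cost_eq_sum]
  exact e1.symm.trans (Finset.sum_congr rfl fun e _ => by rw [hl])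

/-- The padding is distributed over the parts so as to compensate the imbalance of the
unconstrained nodes. -/
theorem exists_section (hk : 0 < k) (ha : 0 < a) (μ : Metric) {P : Fin I.n → Fin k}
    (h : I.Feasible 0 P) : ∃ P' : Fin (I.reduced k a R).n → Fin k,
      (I.reduced k a R).IsSection P' ∧ (I.reduced k a R).cost P' μ = I.cost P μ := by
  have hle : ∀ i, I.partCard P 0 i ≤ I.levelCard 0 := fun i => by
    rw [← I.sum_partCard P 0]
    exact Finset.single_le_sum (f := I.partCard P 0) (fun _ _ => Nat.zero_le _) (Finset.mem_univ i)
  obtain ⟨q, hq⟩ := exists_coloring hk fun i => I.levelCard 0 - I.partCard P 0 i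
  have hpad : I.pad k a = ∑ i, (I.levelCard 0 - I.partCard P 0 i) := by
    rw [I.pad_eq hk, if_pos (h.cyclicPart hk), Finset.sum_tsub_distrib _ fun i _ => hle i,
      sum_partCard, Nat.sub_mul]
    simp
  let φ : ℕ × ℕ → Fin k := fun x => if hx : x.1 < I.n then P ⟨x.1, hx⟩ else q x.2
  have hφ : ∀ v : Fin I.n, ∀ t, φ (v, t) = P v := fun v t => by simp [φ]
  refine ⟨fun j => φ (I.nodes k a)[j], ?_, I.cost_reduced_of_monochromatic R ha μ _
    (fun _ => rfl) P hφ⟩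
  rw [I.isSection_iff R hk _ fun _ => rfl]
  intro i
  have e1 : ∀ v : Fin I.n, (List.range (I.bsize a v)).countP (fun t => decide (φ (v, t) = i)) =
      if P v = i then I.bsize a v else 0 := fun v => by
    simp only [hφ]
    split_ifs with hi <;> simp [hi]
  have e2 : ∀ t, φ (I.n, t) = q t := fun t => by simp [φ]
  have e3 : (I.nodes k a).countP (fun x => decide (φ x = i)) =
      ∑ l ∈ Finset.range (c + 1), (a * I.n) ^ l * I.partCard P l i +
        (I.levelCard 0 - I.partCard P 0 i) := by
    rw [countP_nodes]
    simp only [e1, e2]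
    rw [sum_bsize_filter, hpad, hq]
  rw [e3, length_nodes, I.pad_eq hk, if_pos (h.cyclicPart hk), sum_bsize,
    Finset.sum_range_succ', Finset.sum_range_succ']
  have e4 : k * ∑ l ∈ Finset.range c, (a * I.n) ^ (l + 1) * I.partCard P (l + 1) i =
      ∑ l ∈ Finset.range c, (a * I.n) ^ (l + 1) * I.levelCard (l + 1) := by
    rw [Finset.mul_sum]
    refine Finset.sum_congr rfl fun l hl => ?_
    rw [← h.dvd hk (Finset.mem_range.1 hl) i]
    ring
  rw [mul_add, mul_add, e4, pow_zero, one_mul, one_mul]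
  obtain ⟨k', rfl⟩ := Nat.exists_eq_succ_of_ne_zero hk.ne'
  have e5 : (k' + 1) * I.partCard P 0 i + (k' + 1) * (I.levelCard 0 - I.partCard P 0 i) =
      k' * I.levelCard 0 + I.levelCard 0 := by
    rw [← mul_add, Nat.add_sub_cancel' (hle i)]
    ring
  simp only [Nat.succ_eq_add_one, Nat.add_sub_cancel]
  omega

/-! ### From sections to feasible partitionings -/

/-- The partitioning of the instance obtained from a partitioning `P'` of the constructed
hypergraph: each node goes to the part of the first node of its block if this is feasible, and the
nodes are dealt out cyclically otherwise. -/
def pullback (hk : 0 < k) (P' : Fin (I.nodes k a).length → Fin k) : Fin I.n → Fin k :=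
  toPart I.n hk
    (bif evenOn k c I.n I.lvls (representatives I.n (I.nodes k a) (partList P')) then
      representatives I.n (I.nodes k a) (partList P') else cyclic k I.n I.lvls)

theorem filter_nodes (ha : 0 < a) :
    (I.nodes k a).filter (fun x => decide (x.2 = 0) && Nat.ble (x.1 + 1) I.n) =
      (List.finRange I.n).map fun v : Fin I.n => ((v : ℕ), 0) := by
  unfold nodes blockNodes
  rw [List.range_succ, List.flatMap_append, List.filter_append, List.filter_flatMap,
    ← List.map_coe_finRange_eq_range, List.flatMap_map]
  have h2 : List.filter (fun x : ℕ × ℕ => decide (x.2 = 0) && Nat.ble (x.1 + 1) I.n)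
      ([I.n].flatMap fun v => (List.range ((I.blocks a ++ [I.pad k a]).getD v 0)).map
        fun t => (v, t)) = [] := by
    rw [List.filter_eq_nil_iff]
    simp
  rw [h2, List.append_nil, ← List.flatMap_pure_eq_map]
  refine List.flatMap_congr fun v _ => ?_
  rw [blocks_append_getD]
  obtain ⟨w, hw⟩ := Nat.exists_eq_succ_of_ne_zero (I.bsize_pos ha v).ne'
  rw [hw, List.range_succ_eq_map]
  simp [List.filter_map, Function.comp_def]

theorem representatives_eq (ha : 0 < a) (P' : Fin (I.nodes k a).length → Fin k)
    {φ : ℕ × ℕ → Fin k} (hφ : ∀ j : Fin (I.nodes k a).length, P' j = φ (I.nodes k a)[j]) :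
    representatives I.n (I.nodes k a) (partList P') = partList fun v : Fin I.n => φ (v, 0) := by
  have h1 : partList P' = (I.nodes k a).map fun x => (φ x : ℕ) :=
    List.ext_getElem (by simp [partList]) fun i h1 h2 => by simp [partList, hφ]
  have h2 : ∀ l : List (ℕ × ℕ), l.zip (l.map fun x => (φ x : ℕ)) =
      l.map fun x => (x, (φ x : ℕ)) := fun l => by
    induction l <;> simp_all
  unfold representatives
  rw [h1, h2, List.filter_map, List.map_map]
  have h3 := I.filter_nodes (k := k) ha
  unfold partList
  rw [List.ofFn_eq_map]
  have := congrArg (List.map fun x => (φ x : ℕ)) h3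
  rw [List.map_map] at this
  exact this

theorem toPart_partList {n : ℕ} (hk : 0 < k) (P : Fin n → Fin k) :
    toPart n hk (partList P) = P := by
  funext v
  ext
  change (partList P).getD v 0 % k = P v
  rw [partList_getD, Nat.mod_eq_of_lt (P v).2]

open Classical in
theorem pullback_eq (hk : 0 < k) (ha : 0 < a) (P' : Fin (I.nodes k a).length → Fin k)
    {φ : ℕ × ℕ → Fin k} (hφ : ∀ j : Fin (I.nodes k a).length, P' j = φ (I.nodes k a)[j]) :
    I.pullback hk P' = if I.Feasible 0 (fun v : Fin I.n => φ (v, 0)) then fun v : Fin I.n => φ (v, 0)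
      else I.cyclicPart hk := by
  unfold pullback
  rw [I.representatives_eq ha P' hφ]
  have h := I.evenOn_iff hk fun v : Fin I.n => φ (v, 0)
  split_ifs with hf
  · rw [lvls, h.2 hf, cond_true, toPart_partList]
  · have : evenOn k c I.n (levels c I.n I.sets) (partList fun v : Fin I.n => φ (v, 0)) = false := by
      rw [← Bool.not_eq_true]; exact fun h' => hf (h.1 h')
    rw [lvls, this]; rfl

theorem partList_pullback (hk : 0 < k) (ha : 0 < a) (P' : Fin (I.nodes k a).length → Fin k) :
    partList (I.pullback hk P') =
      bif evenOn k c I.n I.lvls (representatives I.n (I.nodes k a) (partList P')) then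
        representatives I.n (I.nodes k a) (partList P') else cyclic k I.n I.lvls := by
  have : Nonempty (Fin k) := ⟨⟨0, hk⟩⟩
  obtain ⟨φ, hφ⟩ := exists_factor (I.nodup_nodes k a) P'
  unfold pullback
  rw [I.representatives_eq ha P' hφ]
  cases evenOn k c I.n I.lvls (partList fun v : Fin I.n => φ (v, 0))
  · exact I.partList_cyclicPart hk
  · rw [cond_true, toPart_partList]

/-- If the constructed hypergraph has a `k`-section, then the instance is feasible: otherwise the
number of nodes would not be divisible by `k`. -/
theorem feasible_of_section (hk : 2 ≤ k) {P' : Fin (I.nodes k a).length → Fin k}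
    (h : (I.reduced k a R).IsSection P') : I.Feasible 0 (I.cyclicPart (by omega : 0 < k)) := by
  by_contra hf
  have hp := I.pad_eq (a := a) (by omega : 0 < k)
  rw [if_neg hf] at hp
  have hl := I.length_nodes k a
  rw [hp] at hl
  set W := ∑ v, I.bsize a v
  have e : W + ((k - 1) * W + 1) = k * W + 1 := by
    obtain ⟨k', rfl⟩ := Nat.exists_eq_add_of_le' (by omega : 1 ≤ k)
    simp only [Nat.add_sub_cancel]; ring
  rw [e] at hl
  have h1 := (balancedOn_zero_iff (by omega)
    (Finset.univ : Finset (Fin (I.nodes k a).length)) P').1 h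
  rw [Finset.card_univ, Fintype.card_fin] at h1
  have h2 := Finset.card_eq_sum_card_fiberwise (s := (Finset.univ : Finset (Fin (I.nodes k a).length)))
    (t := Finset.univ) (f := P') (by simp)
  have h3 : ∑ i, (Finset.univ.filter fun v => P' v = i).card ≤ ∑ _i : Fin k, W := by
    refine Finset.sum_le_sum fun i _ => ?_
    have h4 := (h1 i).trans_eq hl
    by_contra! h5
    nlinarith
  rw [← h2, Finset.card_univ, Fintype.card_fin, hl] at h3
  simp at h3

/-- If all blocks are monochromatic, then the first nodes of the blocks give a feasible
partitioning. -/
theorem feasible_of_monochromatic (hk : 2 ≤ k) (ha : 0 < a) {φ : ℕ × ℕ → Fin k}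
    {P' : Fin (I.nodes k a).length → Fin k}
    (hφ : ∀ j : Fin (I.nodes k a).length, P' j = φ (I.nodes k a)[j])
    (h : (I.reduced k a R).IsSection P')
    (hm : ∀ v : Fin I.n, I.level v ≠ 0 → ∀ t < I.bsize a v, φ (v, t) = φ (v, 0)) :
    I.Feasible 0 fun v : Fin I.n => φ (v, 0) := by
  have hk0 : 0 < k := by omega
  have hf := I.feasible_of_section R hk h
  rw [feasible_zero_iff _ hk0]
  have hm' : ∀ v : Fin I.n, ∀ t < I.bsize a v, φ (v, t) = φ (v, 0) := fun v t ht => by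
    by_cases h0 : I.level v = 0
    · unfold bsize at ht
      rw [h0, pow_zero, Nat.lt_one_iff] at ht
      rw [ht]
    · exact hm v h0 t ht
  refine balanced_of_radix (a * I.n) _ I.levelCard (fun l => I.sum_partCard _ l) c
    (fun j hj => ⟨_, (hf.dvd hk0 hj ⟨0, hk0⟩).symm⟩) ?_ fun i => ?_
  · rw [sum_levelCard]
    exact Nat.le_mul_of_pos_left _ ha
  · have h1 := (I.isSection_iff R hk0 P' hφ).1 h i
    rw [length_nodes, I.pad_eq hk0, if_pos hf, sum_bsize] at h1
    refine le_trans (Nat.mul_le_mul_left k ?_) h1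
    rw [countP_nodes, ← sum_bsize_filter]
    refine le_trans (Finset.sum_le_sum fun v _ => ?_) (Nat.le_add_right _ _)
    split_ifs with hi
    · refine le_of_eq ?_
      symm
      rw [List.countP_eq_length.2, List.length_range]
      intro t ht
      rw [hm' v t (List.mem_range.1 ht)]
      simpa using hi
    · exact Nat.zero_le _

/-- If a block is split, then many of its hyperedges are cut: a hyperedge `tieSet v t e r`
determines `e` and `r` up to the questions whether `0` and `t` have been in the coding part. -/
theorem card_le_cost_of_split (ha : 0 < a) (μ : Metric) {φ : ℕ × ℕ → Fin k}
    {P' : Fin (I.nodes k a).length → Fin k}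
    (hφ : ∀ j : Fin (I.nodes k a).length, P' j = φ (I.nodes k a)[j])
    {v : Fin I.n} {t : ℕ} (h0 : I.level v ≠ 0) (ht : t < I.bsize a v)
    (hs : φ (v, t) ≠ φ (v, 0)) (hR : I.n + R ≤ I.bsize a v + 1) :
    I.edges.length * R ≤ 4 * (I.reduced k a R).cost P' μ := by
  let F : Finset (Fin I.n) × ℕ → Finset (Fin (I.nodes k a).length) :=
    fun x => I.tieSet k a v t x.1 x.2
  let X : Finset (Fin I.n) × ℕ → ℕ → Bool := fun x s =>
    (bits x.1).getD s false || (Nat.ble I.n s && Nat.ble (s + 1) (I.n + x.2))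
  let D : Finset (Finset (Fin I.n) × ℕ) := I.edges.toFinset ×ˢ Finset.range R
  have hD : D.card = I.edges.length * R := by
    rw [Finset.card_product, Finset.card_range, List.toFinset_card_of_nodup I.nodup]
  have hcost : (D.image F).card ≤ (I.reduced k a R).cost P' μ := by
    rw [HGraph.cost_eq_sum, Finset.card_eq_sum_ones]
    refine (Finset.sum_le_sum fun s hs' => ?_).trans (Finset.sum_le_sum_of_subset fun s hs' => ?_)
    · obtain ⟨x, _, rfl⟩ := Finset.mem_image.1 hs'
      refine μ.one_le_price ?_
      by_contra! hlt
      have h1 := (lam_le_one_iff P' _).1 (Nat.lt_succ_iff.1 hlt)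
      obtain ⟨i, hi, hi'⟩ := List.getElem_of_mem (I.mem_nodes_zero (k := k) ha v)
      obtain ⟨j, hj, hj'⟩ := List.getElem_of_mem
        ((I.mem_nodes k a (v, t)).2 (.inl ⟨v, rfl, ht⟩))
      have := h1 ⟨j, hj⟩ ((mem_toSet_map _ _ _).2 (by simp [hj'])) ⟨i, hi⟩
        ((mem_toSet_map _ _ _).2 (by simp [hi']))
      rw [hφ, hφ] at this
      simp only [Fin.getElem_fin, hi', hj'] at this
      exact hs this
    · obtain ⟨⟨e, r⟩, hx, rfl⟩ := Finset.mem_image.1 hs'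
      simp only [D, Finset.mem_product, List.mem_toFinset, Finset.mem_range] at hx
      exact List.mem_toFinset.2
        ((I.mem_edges_reduced R ha _).2 (.inr ⟨v, h0, t, ht, e, hx.1, r, hx.2, rfl⟩))
  have hinj : D.card ≤ ((D.image F) ×ˢ (Finset.univ : Finset (Bool × Bool))).card := by
    refine Finset.card_le_card_of_injOn (fun x => (F x, X x 0, X x t)) (fun x hx => ?_) ?_
    · simpa using Finset.mem_image_of_mem F hx
    · rintro ⟨e, r⟩ hx ⟨e', r'⟩ hx' heq
      simp only [D, Finset.coe_product, Set.mem_prod, Finset.mem_coe, Finset.mem_range] at hx hx'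
      simp only [Prod.mk.injEq] at heq
      have hX : ∀ s < I.bsize a v, X (e, r) s = X (e', r') s := by
        intro s hsv
        by_cases hs0 : s = 0
        · rw [hs0]; exact heq.2.1
        by_cases hst : s = t
        · rw [hst]; exact heq.2.2
        obtain ⟨j, hj, hj'⟩ := List.getElem_of_mem
          ((I.mem_nodes k a (v, s)).2 (.inl ⟨v, rfl, hsv⟩))
        have h1 : ∀ x, (⟨j, hj⟩ : Fin (I.nodes k a).length) ∈ F x ↔ X x s = true := fun x => by
          refine (mem_toSet_map _ _ _).trans ?_
          simp [hj', hs0, hst, X]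
        rw [Bool.eq_iff_iff, ← h1, ← h1, heq.1]
      have hn : I.n ≤ I.bsize a v := by have := hx.2; omega
      have he : e = e' := by
        ext w
        have := hX w (by omega)
        have hw : Nat.ble I.n w = false := by
          rw [← Bool.not_eq_true, Nat.ble_eq]; omega
        simp only [X, bits_getD, hw, Bool.false_and, Bool.or_false] at this
        simpa using this
      have hX' : ∀ s, I.n ≤ s → ∀ x, X x s = true ↔ s < I.n + x.2 := fun s hs x => by
        simp only [X, bits_getD_of_le _ hs]
        simp [hs]
      have hr : r = r' := by
        rcases lt_trichotomy r r' with hlt | h | hlt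
        · have := hX (I.n + r) (by omega)
          rw [Bool.eq_iff_iff, hX' _ (by omega), hX' _ (by omega)] at this
          simp only at this; omega
        · exact h
        · have := hX (I.n + r') (by omega)
          rw [Bool.eq_iff_iff, hX' _ (by omega), hX' _ (by omega)] at this
          simp only at this; omega
      rw [he, hr]
  rw [hD, Finset.card_product] at hinj
  simp only [Finset.card_univ, Fintype.card_prod, Fintype.card_bool] at hinj
  omega

/-- The pullback is feasible and not much more expensive: a partitioning that splits a block is so
expensive that it can afford the cyclic one. The factor is `1` for `R = 4 * (k - 1)`. -/
theorem pullback_spec (hk : 2 ≤ k) (ha : 0 < a) (μ : Metric) (hR : R ≤ 4 * (k - 1))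
    (hb : ∀ v, I.level v ≠ 0 → I.n + R ≤ I.bsize a v + 1)
    {P' : Fin (I.nodes k a).length → Fin k} (h : (I.reduced k a R).IsSection P') :
    I.Feasible 0 (I.pullback (by omega : 0 < k) P') ∧
      R * I.cost (I.pullback (by omega : 0 < k) P') μ ≤
        4 * (k - 1) * (I.reduced k a R).cost P' μ := by
  have hk0 : 0 < k := by omega
  have : Nonempty (Fin k) := ⟨⟨0, hk0⟩⟩
  obtain ⟨φ, hφ⟩ := exists_factor (I.nodup_nodes k a) P'
  rw [I.pullback_eq hk0 ha P' hφ]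
  split_ifs with hf
  · refine ⟨hf, Nat.mul_le_mul hR (le_trans ?_ (I.sum_price_blown_le R ha μ P'))⟩
    rw [HGraph.cost_eq_sum]
    refine Finset.sum_le_sum fun e _ => μ.price_mono (Finset.card_le_card fun i hi => ?_)
    obtain ⟨v, hv, hi⟩ := Finset.mem_image.1 hi
    exact (I.mem_image_blown P' hφ e i).2 ⟨v, hv, 0, I.bsize_pos ha v, hi⟩
  · refine ⟨I.feasible_of_section R hk h, ?_⟩
    have : ∃ v : Fin I.n, I.level v ≠ 0 ∧ ∃ t < I.bsize a v, φ (v, t) ≠ φ (v, 0) := by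
      by_contra! hc
      exact hf (I.feasible_of_monochromatic R hk ha hφ h hc)
    obtain ⟨v, h0, t, ht, hs⟩ := this
    have h1 := I.card_le_cost_of_split R ha μ hφ h0 ht hs (hb v h0)
    have h2 := I.toHGraph.cost_le (I.cyclicPart hk0) μ
    calc R * I.cost (I.cyclicPart hk0) μ ≤ R * ((k - 1) * I.edges.length) := by gcongr
      _ = (k - 1) * (I.edges.length * R) := by ring
      _ ≤ (k - 1) * (4 * (I.reduced k a R).cost P' μ) := by gcongr
      _ = _ := by ring

end MultiInst

namespace MultiInst

variable {c k a R : ℕ}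

/-! ### The reduction runs in polynomial time -/

@[fun_prop]
theorem polyFun_lvls : PolyFun fun I : MultiInst c => I.lvls := by
  unfold lvls
  fun_prop

@[fun_prop]
theorem polyFun_blocks : PolyFun fun I : MultiInst c => I.blocks a := by
  unfold blocks
  fun_prop

theorem polyFun_nodes (hk : 0 < k) : PolyFun fun I : MultiInst c => I.nodes k a := by
  have h : PolyFun fun I : MultiInst c => I.pad k a := by
    unfold pad
    exact PolyFun.padding hk (by fun_prop) (by fun_prop) (by fun_prop)
  unfold nodes
  fun_prop

theorem polyFun_reducedEdges (hk : 0 < k) :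
    PolyFun fun I : MultiInst c => I.reducedEdges k a R := by
  have := polyFun_nodes (c := c) (a := a) hk
  unfold reducedEdges
  fun_prop

/-- The inputs of the backward transformation. -/
def BackInput (c k a : ℕ) : Type :=
  (I : MultiInst c) × (Fin (I.nodes k a).length → Fin k)

instance : TEnc (BackInput c k a) :=
  ⟨fun x => Tr.cons x.1.enc (encPart x.2), fun x => x.1.size⟩

theorem le_sum_bsize (I : MultiInst c) (ha : 0 < a) : I.n ≤ ∑ v, I.bsize a v := by
  have : ∑ _v : Fin I.n, 1 ≤ ∑ v, I.bsize a v := Finset.sum_le_sum fun v _ => I.bsize_pos ha v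
  simpa using this

theorem levelCard_le (I : MultiInst c) (l : ℕ) : I.levelCard l ≤ I.n :=
  (Finset.card_le_univ _).trans (by simp)

theorem sum_bsize_le (I : MultiInst c) (ha : 0 < a) :
    ∑ v, I.bsize a v ≤ a ^ c * I.n ^ (c + 1) := by
  have h : ∀ v ∈ Finset.univ, I.bsize a v ≤ (a * I.n) ^ c := fun v _ =>
    Nat.pow_le_pow_right (Nat.mul_pos ha v.pos) (I.level_le v)
  refine (Finset.sum_le_sum h).trans ?_
  rw [Finset.sum_const, Finset.card_univ, Fintype.card_fin, smul_eq_mul, mul_pow]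
  exact le_of_eq (by ring)

theorem length_nodes_le (I : MultiInst c) (hk : 0 < k) (ha : 0 < a) :
    (I.nodes k a).length ≤ (k * a ^ c + 1) * I.n ^ (c + 1) := by
  have hW := I.sum_bsize_le ha
  have hn := I.le_sum_bsize ha
  have h0 := I.levelCard_le 0
  rw [length_nodes, I.pad_eq hk]
  set W := ∑ v, I.bsize a v
  have e : W + (k - 1) * W = k * W := by
    obtain ⟨k', rfl⟩ := Nat.exists_eq_add_of_le' hk
    simp only [Nat.add_sub_cancel]; ring
  have h1 : k * W ≤ k * (a ^ c * I.n ^ (c + 1)) := Nat.mul_le_mul_left _ hW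
  have e2 : (k * a ^ c + 1) * I.n ^ (c + 1) = k * (a ^ c * I.n ^ (c + 1)) + I.n ^ (c + 1) := by ring
  rw [e2]
  split_ifs with hf
  · have h2 : (k - 1) * I.levelCard 0 ≤ (k - 1) * W := Nat.mul_le_mul_left _ (h0.trans hn)
    omega
  · have : I.n ≠ 0 := fun h => hf <| I.feasible_cyclicPart hk fun j _ => by
      have := I.levelCard_le (j + 1)
      rw [show I.levelCard (j + 1) = 0 by omega]
      exact dvd_zero k
    have : 0 < I.n ^ (c + 1) := Nat.pow_pos (by omega)
    omega

theorem polyFun_back_fst : PolyFun fun x : BackInput c k a => x.1 :=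
  .of_expr (.hd (.var 0)) PolyBdd.wt_id fun x => by
    simp [Expr.eval, inputStore, code, Tr.hd]

theorem polyFun_back_snd (hk : 0 < k) (ha : 0 < a) :
    PolyFun fun x : BackInput c k a => partList x.2 := by
  refine .of_expr (.tl (.var 0)) (PolyBdd.mono (g := fun x : BackInput c k a =>
    ((k * a ^ c + 1) * (wt x + 1) ^ (c + 1)) * (k + 1)) ?_ fun x => ?_) fun x => ?_
  · exact PolyBdd.mul ⟨k * a ^ c + 1, c + 1, fun x => le_rfl⟩ (.const _)
  · refine (wt_partList x.2).trans ?_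
    gcongr
    refine (x.1.length_nodes_le hk ha).trans ?_
    gcongr
    exact (Nat.le_add_right x.1.n x.1.edges.length).trans (Nat.le_succ _)
  · rw [code_partList]
    simp [Expr.eval, inputStore, code, Tr.tl]

theorem polyFun_pullback (hk : 0 < k) (ha : 0 < a) :
    PolyFun fun x : BackInput c k a => partList (x.1.pullback hk x.2) := by
  have h1 := polyFun_back_fst (c := c) (k := k) (a := a)
  have h2 := polyFun_back_snd (c := c) hk ha
  have h3 := (polyFun_nodes (c := c) (a := a) hk).comp h1
  have h4 := (polyFun_lvls (c := c)).comp h1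
  have h5 := (PolyFun.multiInst_n (c := c)).comp h1
  have h6 := PolyFun.cyclic hk h5 h4
  simp only [partList_pullback _ hk ha]
  fun_prop

end MultiInst

theorem multiSectionReduces (k c : ℕ) (hk : 2 ≤ k) (μ : Metric) : MultiSectionReduces k c μ := by
  have hk0 : 0 < k := by omega
  have ha : 0 < 4 * k := by omega
  -- blocks of size at least `4 k n` leave room for `4 (k - 1)` copies of each hyperedge
  have hb : ∀ (I : MultiInst c) (v : Fin I.n), I.level v ≠ 0 →
      I.n + 4 * (k - 1) ≤ I.bsize (4 * k) v + 1 := fun I v h0 => by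
    have h1 : 4 * k * I.n ≤ I.bsize (4 * k) v := Nat.le_self_pow h0 _
    obtain ⟨m, hm⟩ := Nat.exists_eq_add_of_le' (show 1 ≤ I.n from v.pos)
    rw [hm] at h1 ⊢
    have h2 : m ≤ 4 * k * m := Nat.le_mul_of_pos_left _ ha
    have h3 : 4 * k * (m + 1) = 4 * k * m + 4 * k := by ring
    omega
  refine ⟨fun I => I.reduced k (4 * k) (4 * (k - 1)), fun I P' => I.pullback hk0 P',
    k * (4 * k) ^ c + 1, ?_, ?_, fun I => ⟨I.length_nodes_le hk0 ha, fun P hP =>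
      I.exists_section _ hk0 ha μ hP, fun P' hP' => ?_⟩⟩
  · have h := MultiInst.polyFun_nodes (c := c) (a := 4 * k) hk0
    have h' := MultiInst.polyFun_reducedEdges (c := c) (a := 4 * k) (R := 4 * (k - 1)) hk0
    obtain ⟨p, C, d, hp⟩ := (h.list_length.pair h').runsIn
    refine ⟨p, C, d, fun I => ?_⟩
    have := hp I
    rwa [← I.lists_reduced _ ha, HGraph.code_lists] at this
  · obtain ⟨p, C, d, hp⟩ := (MultiInst.polyFun_pullback (c := c) hk0 ha).runsIn
    refine ⟨p, C, d, fun x => ?_⟩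
    have := hp x
    rwa [code_partList] at this
  · obtain ⟨h1, h2⟩ := I.pullback_spec _ hk ha μ le_rfl (hb I) hP'
    exact ⟨h1, Nat.le_of_mul_le_mul_left h2 (by omega)⟩

namespace MultiInst

variable {c k a R : ℕ}

/-! ### Approximation -/

/-- Whether the instance is feasible and has a constrained node. -/
def proper (k : ℕ) (I : MultiInst c) : Bool :=
  (!(List.range I.n).all fun v => decide (I.lvls.getD v 0 = 0)) &&
    evenOn k c I.n I.lvls (cyclic k I.n I.lvls)

theorem polyFun_proper (hk : 0 < k) : PolyFun fun I : MultiInst c => I.proper k := by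
  have h6 := PolyFun.cyclic hk (PolyFun.multiInst_n (c := c)) (polyFun_lvls (c := c))
  unfold proper
  fun_prop

theorem proper_iff (hk : 0 < k) (I : MultiInst c) :
    I.proper k = true ↔ (∃ v, I.level v ≠ 0) ∧ I.Feasible 0 (I.cyclicPart hk) := by
  have h := I.evenOn_iff hk (I.cyclicPart hk)
  rw [partList_cyclicPart] at h
  unfold proper
  rw [Bool.and_eq_true]
  refine and_congr ?_ h
  rw [Bool.not_eq_true', ← Bool.not_eq_true]
  simp only [List.all_eq_true, List.mem_range, decide_eq_true_eq, not_forall]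
  exact ⟨fun ⟨v, hv, h⟩ => ⟨⟨v, hv⟩, h⟩, fun ⟨v, h⟩ => ⟨v, v.2, h⟩⟩

theorem cyclicPart_of_level_eq_zero (hk : 0 < k) (I : MultiInst c) {v : Fin I.n}
    (h : I.level v = 0) : I.cyclicPart hk v = ⟨0, hk⟩ := by
  have h1 : (I.cyclicPart hk v : ℕ) = (partList (I.cyclicPart hk)).getD v 0 :=
    (partList_getD _ v 0).symm
  rw [partList_cyclicPart] at h1
  ext
  rw [h1]
  unfold cyclic
  rw [List.getD_eq_getElem _ _ (by simp), List.getElem_map, List.getElem_range,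
    show (levels c I.n I.sets).getD v 0 = 0 from h]
  simp

theorem cost_cyclicPart_eq_zero (hk : 0 < k) (I : MultiInst c) (h : ∀ v, I.level v = 0)
    (μ : Metric) : I.cost (I.cyclicPart hk) μ = 0 := by
  rw [HGraph.cost_eq_sum]
  refine Finset.sum_eq_zero fun e _ => μ.price_eq_zero ((lam_le_one_iff _ _).2 fun v _ w _ => ?_)
  rw [I.cyclicPart_of_level_eq_zero hk (h v), I.cyclicPart_of_level_eq_zero hk (h w)]

theorem le_n_of_proper (hk : 0 < k) (I : MultiInst c) (h : I.proper k = true) :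
    k ≤ I.n ∧ 1 ≤ c := by
  obtain ⟨⟨v, hv⟩, hf⟩ := (I.proper_iff hk).1 h
  have hc := I.level_le v
  refine ⟨?_, by omega⟩
  obtain ⟨j, hj⟩ := Nat.exists_eq_succ_of_ne_zero hv
  have h1 : 0 < I.levelCard (j + 1) :=
    Finset.card_pos.2 ⟨v, Finset.mem_filter.2 ⟨Finset.mem_univ _, hj⟩⟩
  have h2 : k ∣ I.levelCard (j + 1) := ⟨_, (hf.dvd hk (by omega) ⟨0, hk⟩).symm⟩
  exact (Nat.le_of_dvd h1 h2).trans (I.levelCard_le _)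

/-- With blocks of size `n ^ ℓ`, the constructed hypergraph has at most `n ^ (c + 1)` nodes. Here
no constant factor may be lost, since `α` is arbitrary. -/
theorem length_nodes_le_of_proper (hk : 0 < k) (I : MultiInst c) (h : I.proper k = true) :
    (I.nodes k 1).length ≤ I.n ^ (c + 1) := by
  obtain ⟨hn, hc⟩ := I.le_n_of_proper hk h
  rw [length_nodes, I.pad_eq hk, if_pos ((I.proper_iff hk).1 h).2]
  have h1 : (k - 1) * I.levelCard 0 = ∑ v, if I.level v = 0 then k - 1 else 0 := by
    rw [← Finset.sum_filter, Finset.sum_const, smul_eq_mul, mul_comm]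
    rfl
  rw [h1, ← Finset.sum_add_distrib]
  refine (Finset.sum_le_sum (g := fun _ => I.n ^ c) fun v _ => ?_).trans ?_
  · unfold bsize
    rw [one_mul]
    split_ifs with h0
    · rw [h0, pow_zero]
      have := Nat.le_self_pow (show c ≠ 0 by omega) I.n
      omega
    · exact Nat.pow_le_pow_right v.pos (I.level_le v)
  · simp [pow_succ, mul_comm]

theorem length_edges_reduced_le (I : MultiInst c) (ha : 0 < a) :
    (I.reduced k a R).edges.length ≤ I.edges.length * (1 + (I.nodes k a).length * R) := by
  have h1 : (I.reduced k a R).edges.length = (I.reducedEdges k a R).length := by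
    have h := congrArg (fun x => x.2.length) (I.lists_reduced (k := k) R ha)
    simpa [HGraph.lists] using h
  have h2 : ((List.range I.n).flatMap fun v =>
      bif decide (I.lvls.getD v 0 = 0) then [] else
        (List.range ((I.blocks a).getD v 0)).flatMap fun t => (I.edges.map bits).flatMap fun e =>
          (List.range R).map fun r => tie I.n (I.nodes k a) v t e r).length ≤
      (∑ v, I.bsize a v) * (I.edges.length * R) := by
    rw [List.length_flatMap, ← List.map_coe_finRange_eq_range (n := I.n), List.map_map, ← List.ofFn_eq_map,
      List.sum_ofFn, Finset.sum_mul]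
    refine Finset.sum_le_sum fun v _ => ?_
    rw [Function.comp_apply, Bool.cond_decide]
    split_ifs
    · simp
    · simp [List.length_flatMap, ← blocks_getD, Function.comp_def]
  rw [h1]
  unfold reducedEdges blockEdges
  refine (List.dedup_sublist _).length_le.trans ?_
  rw [List.length_append, List.length_map, List.length_map]
  have h3 := I.length_nodes k a
  have h4 : (∑ v, I.bsize a v) * (I.edges.length * R) ≤
      (I.nodes k a).length * (I.edges.length * R) := Nat.mul_le_mul_right _ (by omega)
  calc _ ≤ I.edges.length + (I.nodes k a).length * (I.edges.length * R) := by
        have := h2.trans h4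
        omega
    _ = _ := by ring

end MultiInst

/-- The given algorithm is run on the constructed hypergraph, unless the instance is infeasible or
has no constrained nodes, in which case the cyclic partitioning is a correct output. -/
theorem multiSectionApprox_of_sectionApprox {k c : ℕ} (hk : 2 ≤ k) (μ : Metric)
    {S S' : HGraph → Prop}
    (hS : ∀ I : MultiInst c, S I.toHGraph → I.proper k = true → S' (I.reduced k 1 1))
    {α : ℕ → ℝ} (hα : Monotone α) (h1 : ∀ n, 1 ≤ α n) (h : SectionApprox k μ S' α) :
    MultiSectionApprox k c μ S fun n => 4 * ((k : ℝ) - 1) * α (n ^ (c + 1)) := by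
  have hk0 : 0 < k := by omega
  have hk1 : (1 : ℝ) ≤ (k : ℝ) - 1 := by
    have : (2 : ℝ) ≤ k := by exact_mod_cast hk
    linarith
  have hC : ∀ m, 0 ≤ 4 * ((k : ℝ) - 1) * α m := fun m =>
    mul_nonneg (by linarith) (zero_le_one.trans (h1 m))
  obtain ⟨p, C, d, hp⟩ := h
  obtain ⟨q, K, hq⟩ := RunsIn.clean p
  obtain ⟨⟨p₁, T₁, hT₁, hp₁⟩, -⟩ := MultiInst.polyFun_proper (c := c) hk0
  obtain ⟨⟨p₂, T₂, hT₂, hp₂⟩, -⟩ :=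
    PolyFun.cyclic hk0 (PolyFun.multiInst_n (c := c)) (MultiInst.polyFun_lvls (c := c))
  have hN := MultiInst.polyFun_nodes (c := c) (a := 1) hk0
  have hE := MultiInst.polyFun_reducedEdges (c := c) (a := 1) (R := 1) hk0
  obtain ⟨⟨p₃, T₃, hT₃, hp₃⟩, -⟩ := hN.list_length.pair hE
  obtain ⟨⟨p₄, T₄, hT₄, hp₄⟩, -⟩ := MultiInst.polyFun_pullback (c := c) (a := 1) hk0 one_pos
  obtain ⟨C₄, d₄, hT₄⟩ := hT₄
  -- the size of the constructed hypergraph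
  have hsize : PolyBdd fun I : MultiInst c => (I.reduced k 1 1).size := by
    refine (hN.list_length.bdd.add hE.list_length.bdd).mono fun I => ?_
    have h := congrArg (fun x => x.2.length) (I.lists_reduced (k := k) 1 one_pos)
    simp only [HGraph.lists, List.length_map] at h
    exact le_of_eq (congrArg _ h)
  have hTq : PolyBdd fun I : MultiInst c => C * ((I.reduced k 1 1).size + 1) ^ d :=
    PolyBdd.comp_bdd (B := ℕ) (g := fun m => C * (m + 1) ^ d) ⟨C, d, fun m => le_rfl⟩ hsize
  have hTb : PolyBdd fun I : MultiInst c => C₄ * (wt I + 1) ^ d₄ := ⟨C₄, d₄, fun m => le_rfl⟩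
  obtain ⟨C', d', hB⟩ : PolyBdd fun I : MultiInst c => T₁ I + T₂ I + T₃ I +
      C * ((I.reduced k 1 1).size + 1) ^ d + K + C₄ * (wt I + 1) ^ d₄ + 100 := by
    fun_prop
  let idc : Cmd := .assign 0 (.var 0)
  let hdc : Cmd := .assign 0 (.hd (.var 0))
  let tlc : Cmd := .assign 0 (.tl (.var 0))
  refine ⟨.seq (p₁.pair idc) (.ite (.hd (.var 0))
    (.seq tlc (.seq (idc.pair p₃) (.seq (hdc.pair (.seq tlc q)) p₄))) (.seq tlc p₂)),
    C', d', fun I hI => ?_⟩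
  obtain ⟨t₁, ht₁, r₁⟩ := hp₁ I
  dsimp only at r₁
  have r₀ := r₁.pair (Runs.expr (.var 0) (code I))
  have e₀ : (Expr.var 0).eval (inputStore (code I)) = code I := rfl
  rw [e₀] at r₀
  have rt := Runs.expr (.tl (.var 0)) (Tr.cons (code (I.proper k)) (code I))
  have et : (Expr.tl (.var 0)).eval (inputStore (Tr.cons (code (I.proper k)) (code I))) = code I :=
    rfl
  rw [et] at rt
  have hB' := hB I
  dsimp only at hB'
  cases hpr : I.proper k
  · -- the instance is infeasible, or the cyclic partitioning has cost `0`
    obtain ⟨t₂, ht₂, r₂⟩ := hp₂ I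
    refine ⟨_, (r₀.seq (.iteFalse ?_ (rt.seq r₂))).runsIn ?_, ?_⟩
    · rw [hpr]; rfl
    · simp only [Expr.cost]
      refine le_trans ?_ hB'
      omega
    · rintro ⟨Q, hQ⟩
      refine ⟨I.cyclicPart hk0, ?_, hQ.cyclicPart hk0, fun Q' _ => ?_⟩
      · rw [← code_partList, I.partList_cyclicPart]; rfl
      · have hz : ∀ v, I.level v = 0 := by
          by_contra! hc
          have := (I.proper_iff hk0).2 ⟨hc, hQ.cyclicPart hk0⟩
          rw [hpr] at this
          exact absurd this (by simp)
        rw [I.cost_cyclicPart_eq_zero hk0 hz]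
        simpa using mul_nonneg (hC _) (Nat.cast_nonneg _)
  · obtain ⟨hex, hfeas⟩ := (I.proper_iff hk0).1 hpr
    obtain ⟨t₃, ht₃, r₃⟩ := hp₃ I
    dsimp only at r₃
    rw [← I.lists_reduced 1 one_pos, HGraph.code_lists] at r₃
    obtain ⟨out, hout, hsec⟩ := hp _ (hS I hI hpr)
    obtain ⟨P', rfl, hP', hopt⟩ := hsec
      (let ⟨Q, hQ, _⟩ := I.exists_section (a := 1) 1 hk0 one_pos μ hfeas; ⟨Q, hQ⟩)
    obtain ⟨tq, htq, rq⟩ := hq _ _ _ hout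
    let x : MultiInst.BackInput c k 1 := ⟨I, P'⟩
    obtain ⟨t₄, ht₄, r₄⟩ := hp₄ x
    have ht₄' : t₄ ≤ C₄ * (wt I + 1) ^ d₄ := ht₄.trans (hT₄ x)
    have ri := (Runs.expr (.var 0) (code I)).pair r₃
    rw [e₀] at ri
    have rh := Runs.expr (.hd (.var 0)) (Tr.cons (code I) (I.reduced k 1 1).enc)
    have rt' := Runs.expr (.tl (.var 0)) (Tr.cons (code I) (I.reduced k 1 1).enc)
    have et' : (Expr.tl (.var 0)).eval (inputStore (Tr.cons (code I) (I.reduced k 1 1).enc)) =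
      (I.reduced k 1 1).enc := rfl
    have eh' : (Expr.hd (.var 0)).eval (inputStore (Tr.cons (code I) (I.reduced k 1 1).enc)) =
      code I := rfl
    rw [et'] at rt'
    rw [eh'] at rh
    refine ⟨_, (r₀.seq (.iteTrue ?_ (rt.seq (ri.seq ((rh.pair (rt'.seq rq)).seq r₄))))).runsIn ?_,
      fun _ => ?_⟩
    · rw [hpr]
      exact fun h => Tr.noConfusion h
    · simp only [Expr.cost]
      refine le_trans ?_ hB'
      omega
    · have hb : ∀ v, I.level v ≠ 0 → I.n + 1 ≤ I.bsize 1 v + 1 := fun v h0 => by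
        have := Nat.le_self_pow h0 (1 * I.n)
        unfold MultiInst.bsize
        omega
      obtain ⟨hf, hc⟩ := I.pullback_spec 1 hk one_pos μ (by omega) hb hP'
      refine ⟨I.pullback hk0 P', ?_, hf, fun Q hQ => ?_⟩
      · rw [← code_partList]
      · obtain ⟨Q', hQ', hQc⟩ := I.exists_section (a := 1) 1 hk0 one_pos μ hQ
        have h2 := hopt Q' hQ'
        rw [hQc] at h2
        have h3 : α (I.reduced k 1 1).n ≤ α (I.n ^ (c + 1)) :=
          hα (I.length_nodes_le_of_proper hk0 hpr)
        have h4 : (I.cost (I.pullback hk0 P') μ : ℝ) ≤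
            4 * ((k : ℝ) - 1) * ((I.reduced k 1 1).cost P' μ : ℝ) := by
          rw [one_mul] at hc
          have := (Nat.cast_le (α := ℝ)).2 hc
          rw [Nat.cast_mul, Nat.cast_mul, Nat.cast_sub (by omega)] at this
          simpa using this
        calc (I.cost (I.pullback hk0 P') μ : ℝ)
            ≤ 4 * ((k : ℝ) - 1) * ((I.reduced k 1 1).cost P' μ : ℝ) := h4
          _ ≤ 4 * ((k : ℝ) - 1) * (α (I.reduced k 1 1).n * (I.cost Q μ : ℝ)) := by
            gcongr
          _ ≤ 4 * ((k : ℝ) - 1) * (α (I.n ^ (c + 1)) * (I.cost Q μ : ℝ)) := by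
            gcongr
          _ = _ := by ring

theorem exists_multiSectionApprox (k c : ℕ) (hk : 2 ≤ k) (μ : Metric) :
    (∃ C : ℝ, ∀ α : ℕ → ℝ, Monotone α → (∀ n, 1 ≤ α n) →
      SectionApprox k μ (fun _ => True) α →
      MultiSectionApprox k c μ (fun _ => True) fun n => C * α (n ^ (c + 1))) ∧
    (∃ C : ℝ, ∀ h : ℕ, ∃ h' : ℕ, ∀ α : ℕ → ℝ, Monotone α → (∀ n, 1 ≤ α n) →
      SectionApprox k μ (fun H => H.edges.length ≤ H.n ^ h') α →
      MultiSectionApprox k c μ (fun H => H.edges.length ≤ H.n ^ h)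
        fun n => C * α (n ^ (c + 1))) := by
  refine ⟨⟨4 * ((k : ℝ) - 1), fun α hα h1 h =>
    multiSectionApprox_of_sectionApprox hk μ (fun _ _ _ => trivial) hα h1 h⟩,
    ⟨4 * ((k : ℝ) - 1), fun h => ⟨h + 2, fun α hα h1 =>
    multiSectionApprox_of_sectionApprox hk μ (fun I hI hpr => ?_) hα h1⟩⟩⟩
  have h2 := (I.le_n_of_proper (by omega) hpr).1
  have h3 : I.n ≤ (I.nodes k 1).length := by
    rw [I.length_nodes]
    exact (I.le_sum_bsize one_pos).trans (Nat.le_add_right _ _)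
  change (I.reduced k 1 1).edges.length ≤ (I.nodes k 1).length ^ (h + 2)
  refine (I.length_edges_reduced_le one_pos).trans ?_
  set N := (I.nodes k 1).length
  have h4 : I.edges.length ≤ N ^ h := hI.trans (Nat.pow_le_pow_left h3 h)
  rw [pow_add]
  exact Nat.mul_le_mul h4 (by nlinarith)

/-! ### The parameterized algorithm -/

section

variable {A : Type}

/-- All lists of length `m` with entries in `l`. -/
def tuples (l : List A) : ℕ → List (List A)
  | 0 => [[]]
  | m + 1 => (tuples l m).flatMap fun s => l.map fun a => a :: s

theorem mem_tuples {l : List A} {m : ℕ} {s : List A} :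
    s ∈ tuples l m ↔ s.length = m ∧ ∀ a ∈ s, a ∈ l := by
  induction m generalizing s with
  | zero =>
    cases s <;> simp [tuples]
  | succ m ih =>
    simp only [tuples, List.mem_flatMap, List.mem_map, ih]
    constructor
    · rintro ⟨s, ⟨rfl, hs⟩, a, ha, rfl⟩
      simpa using ⟨ha, hs⟩
    · rintro ⟨h, hs⟩
      obtain _ | ⟨a, s⟩ := s
      · simp at h
      · simp only [List.length_cons, Nat.add_right_cancel_iff, List.mem_cons, forall_eq_or_imp] at h hs
        exact ⟨s, ⟨h, hs.2⟩, a, hs.1, rfl⟩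

@[fun_prop]
theorem PolyFun.tuples {Γ : Type} [TEnc Γ] [TEnc A] {l : Γ → List A} (hl : PolyFun l) (m : ℕ) :
    PolyFun fun γ => tuples (l γ) m := by
  induction m with
  | zero => simp only [_root_.tuples]; fun_prop
  | succ m ih => simp only [_root_.tuples]; fun_prop

end

/-- The possibilities for a cut hyperedge: a set of at least two parts that it may intersect, and
the resulting contribution to the cost. -/
def cutOptions (k : ℕ) (μ : Metric) : List (List Bool × ℕ) :=
  ((tuples [false, true] k).filter fun s => Nat.ble 2 (s.count true)).map
    fun s => (s, μ.price (s.count true))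

/-- Whether two sets of nodes intersect. -/
def meets (n : ℕ) (e B : List Bool) : Bool :=
  (List.range n).any fun v => e.getD v false && B.getD v false

/-- A family of components: sets of nodes that have to be monochromatic, each with the set of the
parts in which it may be placed. -/
abbrev Comps : Type := List (List Bool × List Bool)

/-- The family of singletons, without any restriction on the parts. -/
def startComps (k n : ℕ) : Comps :=
  (List.range n).map fun v =>
    ((List.range n).map fun w => decide (w = v), (List.range k).map fun _ => true)

/-- Unites all components that intersect the hyperedge `e`. -/
def mergeComps (k n : ℕ) (e : List Bool) (cs : Comps) : Comps :=
  ((List.range n).map fun v => cs.any fun x => meets n e x.1 && x.1.getD v false,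
    (List.range k).map fun i => cs.all fun x => !(meets n e x.1) || x.2.getD i false) ::
  cs.filter fun x => !(meets n e x.1)

/-- Confines all components that intersect the hyperedge `e` to the parts in `s`. -/
def confineComps (k n : ℕ) (e s : List Bool) (cs : Comps) : Comps :=
  cs.map fun x => (x.1, bif meets n e x.1 then
    (List.range k).map fun i => x.2.getD i false && s.getD i false else x.2)

/-- Guesses whether the hyperedge `e` is cut, and in which way, within the budget `L`. A state
consists of the cost so far and the family of components. -/
def guessStep (k n L : ℕ) (opts : List (List Bool × ℕ)) (st : List (ℕ × Comps)) (e : List Bool) :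
    List (ℕ × Comps) :=
  st.flatMap fun g => (g.1, mergeComps k n e g.2) ::
    (opts.filter fun o => Nat.ble (g.1 + o.2) L).map
      fun o => (g.1 + o.2, confineComps k n e o.1 g.2)

/-- All guesses of cost at most `L`. -/
def guesses (k n L : ℕ) (opts : List (List Bool × ℕ)) (es : List (List Bool)) :
    List (ℕ × Comps) :=
  es.foldl (guessStep k n L opts) [(0, startComps k n)]

/-- The `c × k` matrix with given entries, as a list of rows. -/
def mkTable (c k : ℕ) (g : ℕ → ℕ → ℕ) : List (List ℕ) :=
  (List.range c).map fun j => (List.range k).map fun i => g j i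

/-- Updates the numbers of nodes in each constraint set and part when `B` is put into part `i`. -/
def addTable (c k n : ℕ) (Vs : List (List Bool)) (B : List Bool) (i : ℕ) (s : List (List ℕ)) :
    List (List ℕ) :=
  mkTable c k fun j i' => (s.getD j []).getD i' 0 + bif decide (i' = i) then
    (List.range n).countP (fun v => (Vs.getD j []).getD v false && B.getD v false) else 0

/-- One step of the dynamic program: the tables that can be reached by placing one more
component. -/
def tableStep (c k n : ℕ) (Vs : List (List Bool)) (T : List (List (List ℕ)))
    (x : List Bool × List Bool) : List (List (List ℕ)) :=
  (tuples (tuples (List.range (n + 1)) k) c).filter fun s => T.any fun s' =>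
    (List.range k).any fun i => x.2.getD i false && decide (addTable c k n Vs x.1 i s' = s)

/-- The tables that can be reached by placing all components. -/
def tables (c k n : ℕ) (Vs : List (List Bool)) (cs : Comps) : List (List (List ℕ)) :=
  cs.foldl (tableStep c k n Vs) [mkTable c k fun _ _ => 0]

/-- Whether a table satisfies the balance constraints given by the threshold function `thr`. -/
def withinThresholds (c k n : ℕ) (thr : ℕ → ℕ) (Vs : List (List Bool)) (s : List (List ℕ)) :
    Bool :=
  (List.range c).all fun j => (List.range k).all fun i =>
    Nat.ble ((s.getD j []).getD i 0) (thr ((List.range n).countP fun v => (Vs.getD j []).getD v false))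

/-- Whether some guess of cost at most `L` can be completed to a balanced partitioning. -/
def existsPartitioning (c k n L : ℕ) (thr : ℕ → ℕ) (opts : List (List Bool × ℕ))
    (es Vs : List (List Bool)) : Bool :=
  (guesses k n L opts es).any fun g =>
    (tables c k n Vs g.2).any fun s => withinThresholds c k n thr Vs s

/-! ### Running time of the parameterized algorithm -/

section

variable {Γ : Type} [TEnc Γ]

@[fun_prop]
theorem PolyFun.meets {n : Γ → ℕ} {e B : Γ → List Bool} (hn : PolyFun n) (he : PolyFun e)
    (hB : PolyFun B) : PolyFun fun γ => meets (n γ) (e γ) (B γ) := by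
  unfold _root_.meets
  fun_prop

@[fun_prop]
theorem PolyFun.startComps {k : ℕ} {n : Γ → ℕ} (hn : PolyFun n) :
    PolyFun fun γ => startComps k (n γ) := by
  unfold _root_.startComps
  fun_prop

@[fun_prop]
theorem PolyFun.mergeComps {k : ℕ} {n : Γ → ℕ} {e : Γ → List Bool} {cs : Γ → Comps}
    (hn : PolyFun n) (he : PolyFun e) (hc : PolyFun cs) :
    PolyFun fun γ => mergeComps k (n γ) (e γ) (cs γ) := by
  unfold _root_.mergeComps
  fun_prop

@[fun_prop]
theorem PolyFun.confineComps {k : ℕ} {n : Γ → ℕ} {e s : Γ → List Bool} {cs : Γ → Comps}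
    (hn : PolyFun n) (he : PolyFun e) (hs : PolyFun s) (hc : PolyFun cs) :
    PolyFun fun γ => confineComps k (n γ) (e γ) (s γ) (cs γ) := by
  unfold _root_.confineComps
  fun_prop

@[fun_prop]
theorem PolyFun.guessStep {k : ℕ} {n L : Γ → ℕ} {opts : List (List Bool × ℕ)}
    {st : Γ → List (ℕ × Comps)} {e : Γ → List Bool} (hn : PolyFun n) (hL : PolyFun L)
    (hst : PolyFun st) (he : PolyFun e) :
    PolyFun fun γ => guessStep k (n γ) (L γ) opts (st γ) (e γ) := by
  unfold _root_.guessStep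
  fun_prop

@[fun_prop]
theorem PolyFun.mkTable {c k : ℕ} {g : Γ → ℕ → ℕ → ℕ}
    (hg : PolyFun fun x : (Γ × ℕ) × ℕ => g x.1.1 x.1.2 x.2) :
    PolyFun fun γ => mkTable c k (g γ) :=
  PolyFun.list_map (.const _) (PolyFun.list_map (.const _) hg)

@[fun_prop]
theorem PolyFun.addTable {c k : ℕ} {n i : Γ → ℕ} {Vs : Γ → List (List Bool)} {B : Γ → List Bool}
    {s : Γ → List (List ℕ)} (hn : PolyFun n) (hi : PolyFun i) (hV : PolyFun Vs) (hB : PolyFun B)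
    (hs : PolyFun s) : PolyFun fun γ => addTable c k (n γ) (Vs γ) (B γ) (i γ) (s γ) := by
  unfold _root_.addTable
  fun_prop

@[fun_prop]
theorem PolyFun.tableStep {c k : ℕ} {n : Γ → ℕ} {Vs : Γ → List (List Bool)}
    {T : Γ → List (List (List ℕ))} {x : Γ → List Bool × List Bool} (hn : PolyFun n)
    (hV : PolyFun Vs) (hT : PolyFun T) (hx : PolyFun x) :
    PolyFun fun γ => tableStep c k (n γ) (Vs γ) (T γ) (x γ) := by
  unfold _root_.tableStep
  fun_prop

@[fun_prop]
theorem PolyFun.tables {c k : ℕ} {n : Γ → ℕ} {Vs : Γ → List (List Bool)} {cs : Γ → Comps}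
    (hn : PolyFun n) (hV : PolyFun Vs) (hc : PolyFun cs) :
    PolyFun fun γ => tables c k (n γ) (Vs γ) (cs γ) := by
  have hall : PolyFun fun γ => _root_.tuples (_root_.tuples (List.range (n γ + 1)) k) c := by
    fun_prop
  refine PolyFun.foldl (M := fun γ => wt (_root_.tuples (_root_.tuples (List.range (n γ + 1)) k) c) +
    wt [_root_.mkTable c k fun _ _ => 0]) hc (.const _) (by fun_prop) (hall.bdd.add (.const _))
    fun γ l' _ => ?_
  rcases List.eq_nil_or_concat l' with rfl | ⟨l', x, rfl⟩
  · exact Nat.le_add_left _ _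
  · rw [List.concat_eq_append, List.foldl_append]
    exact (wt_sublist List.filter_sublist).trans (Nat.le_add_right _ _)

theorem PolyFun.withinThresholds {c k : ℕ} {thr : ℕ → ℕ} (ht : PolyFun thr) {n : Γ → ℕ}
    {Vs : Γ → List (List Bool)} {s : Γ → List (List ℕ)} (hn : PolyFun n) (hV : PolyFun Vs)
    (hs : PolyFun s) : PolyFun fun γ => withinThresholds c k (n γ) thr (Vs γ) (s γ) := by
  unfold _root_.withinThresholds
  fun_prop

end

theorem guessStep_le {k n L : ℕ} {opts : List (List Bool × ℕ)} {st : List (ℕ × Comps)}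
    {e : List Bool} (h : ∀ g ∈ st, g.1 ≤ L) : ∀ g ∈ guessStep k n L opts st e, g.1 ≤ L := by
  intro g hg
  obtain ⟨g', hg', hg⟩ := List.mem_flatMap.1 hg
  rcases List.mem_cons.1 hg with rfl | hg
  · exact h g' hg'
  · obtain ⟨o, ho, rfl⟩ := List.mem_map.1 hg
    simpa using (List.mem_filter.1 ho).2

theorem foldl_guessStep_le {k n L : ℕ} {opts : List (List Bool × ℕ)} (es : List (List Bool))
    {st : List (ℕ × Comps)} (h : ∀ g ∈ st, g.1 ≤ L) :
    ∀ g ∈ es.foldl (guessStep k n L opts) st, g.1 ≤ L := by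
  induction es generalizing st with
  | nil => exact h
  | cons e es ih => exact ih (guessStep_le h)

theorem one_le_of_mem_cutOptions {k : ℕ} {μ : Metric} {o : List Bool × ℕ}
    (h : o ∈ cutOptions k μ) : 1 ≤ o.2 := by
  obtain ⟨s, hs, rfl⟩ := List.mem_map.1 h
  exact μ.one_le_price (by simpa using (List.mem_filter.1 hs).2)

/-- Every hyperedge is uncut or takes at least `1` from the budget, whence the bound. -/
theorem length_foldl_guessStep {k n L : ℕ} {opts : List (List Bool × ℕ)}
    (ho : ∀ o ∈ opts, 1 ≤ o.2) (es : List (List Bool)) {st : List (ℕ × Comps)}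
    (h : ∀ g ∈ st, g.1 ≤ L) : (es.foldl (guessStep k n L opts) st).length ≤
      (st.map fun g => (1 + opts.length * es.length) ^ (L - g.1)).sum := by
  induction es generalizing st with
  | nil => simp
  | cons e es ih =>
    refine (ih (guessStep_le h)).trans ?_
    set b := 1 + opts.length * es.length with hb
    have hb' : 1 + opts.length * (e :: es).length = b + opts.length := by
      rw [List.length_cons]; ring
    rw [hb']
    unfold guessStep
    rw [List.map_flatMap, List.flatMap_def, List.sum_flatten, List.map_map]
    refine List.sum_le_sum fun g hg => ?_
    dsimp only [Function.comp_apply]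
    rw [List.map_cons, List.sum_cons, List.map_map]
    dsimp only
    rcases (h g hg).lt_or_eq with hlt | heq
    · have h1 : (((opts.filter fun o => Nat.ble (g.1 + o.2) L).map
          ((fun g => b ^ (L - g.1)) ∘ fun o => (g.1 + o.2, confineComps k n e o.1 g.2))).sum) ≤
          opts.length * b ^ (L - g.1 - 1) := by
        refine (List.sum_le_card_nsmul _ (b ^ (L - g.1 - 1)) fun y hy => ?_).trans ?_
        · obtain ⟨o, ho', rfl⟩ := List.mem_map.1 hy
          have := ho o (List.mem_filter.1 ho').1
          exact Nat.pow_le_pow_right (by omega) (by dsimp only; omega)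
        · rw [smul_eq_mul, List.length_map]
          exact Nat.mul_le_mul_right _ (List.length_filter_le _ _)
      obtain ⟨m, hm⟩ := Nat.exists_eq_add_of_lt hlt
      have e1 : L - g.1 = m + 1 := by omega
      rw [e1, Nat.add_sub_cancel] at h1
      rw [e1]
      calc _ ≤ b ^ (m + 1) + opts.length * b ^ m := Nat.add_le_add_left h1 _
        _ = b ^ m * (b + opts.length) := by ring
        _ ≤ (b + opts.length) ^ m * (b + opts.length) := by gcongr; omega
        _ = _ := by ring
    · have h1 : (opts.filter fun o => Nat.ble (g.1 + o.2) L) = [] := by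
        rw [List.filter_eq_nil_iff]
        intro o ho'
        have := ho o ho'
        rw [Nat.ble_eq]
        omega
      rw [h1, heq]
      simp

theorem wt_foldl_guessStep {k n L : ℕ} {opts : List (List Bool × ℕ)} (es : List (List Bool)) :
    ∀ g ∈ guesses k n L opts es, wt g ≤ L + (n + es.length) * (n + k + 1) := by
  have hmap : ∀ (m : ℕ) (f : ℕ → Bool), wt ((List.range m).map f) ≤ m := fun m f => by
    refine (wt_list_le (M := 0) fun b _ => le_rfl).trans ?_
    simp
  have key : ∀ g ∈ guesses k n L opts es, g.2.length ≤ n + es.length ∧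
      ∀ x ∈ g.2, wt x.1 ≤ n ∧ wt x.2 ≤ k := by
    unfold guesses
    induction es using List.reverseRecOn with
    | nil =>
      simp only [List.foldl_nil, List.mem_singleton, forall_eq]
      refine ⟨by simp [startComps], fun x hx => ?_⟩
      obtain ⟨v, _, rfl⟩ := List.mem_map.1 hx
      exact ⟨hmap _ _, hmap _ _⟩
    | append_singleton es e ih =>
      rw [List.foldl_append]
      intro g hg
      obtain ⟨g', hg', hg⟩ := List.mem_flatMap.1 hg
      obtain ⟨h1, h2⟩ := ih g' hg'
      rcases List.mem_cons.1 hg with rfl | hg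
      · constructor
        · have := List.length_filter_le (fun x : List Bool × List Bool => !(meets n e x.1)) g'.2
          simp only [mergeComps, List.length_cons, List.length_append, List.length_nil]
          omega
        · intro x hx
          rcases List.mem_cons.1 hx with rfl | hx
          · exact ⟨hmap _ _, hmap _ _⟩
          · exact h2 x (List.mem_filter.1 hx).1
      · obtain ⟨o, _, rfl⟩ := List.mem_map.1 hg
        constructor
        · simp only [confineComps, List.length_map, List.length_append]
          omega
        · intro x hx
          obtain ⟨y, hy, rfl⟩ := List.mem_map.1 hx
          refine ⟨(h2 y hy).1, ?_⟩
          dsimp only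
          cases meets n e y.1
          · exact (h2 y hy).2
          · exact hmap _ _
  intro g hg
  have h1 := foldl_guessStep_le (k := k) (n := n) (L := L) (opts := opts) es
    (st := [(0, startComps k n)]) (by simp) g hg
  obtain ⟨h2, h3⟩ := key g hg
  rw [wt_prod]
  refine add_le_add h1 ((wt_list_le (M := n + k) fun x hx => ?_).trans ?_)
  · exact add_le_add (h3 x hx).1 (h3 x hx).2
  · exact Nat.mul_le_mul_right _ h2

/-! ### Correctness of the parameterized algorithm -/

section

variable {n k : ℕ}

theorem getD_map_range {A : Type} (f : ℕ → A) (d : A) {m i : ℕ} (h : i < m) :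
    ((List.range m).map f).getD i d = f i := by
  simp [h]

theorem meets_iff {e : Finset (Fin n)} {B : List Bool} :
    meets n (bits e) B = true ↔ ∃ v ∈ e, B.getD v false = true := by
  simp only [meets, List.any_eq_true, List.mem_range, Bool.and_eq_true]
  constructor
  · rintro ⟨v, hv, h1, h2⟩
    exact ⟨⟨v, hv⟩, of_decide_eq_true ((bits_getD e ⟨v, hv⟩).symm.trans h1), h2⟩
  · rintro ⟨v, hv, h⟩
    exact ⟨v, v.2, by rw [bits_getD]; simpa using hv, h⟩

theorem count_true_eq {s : List Bool} (h : s.length = k) :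
    s.count true = (Finset.univ.filter fun i : Fin k => s.getD i false = true).card := by
  have hs : s = (List.range k).map fun i => s.getD i false := by
    refine List.ext_getElem (by simp [h]) fun i h1 h2 => ?_
    simp [List.getElem?_eq_getElem h1]
  rw [← countP_range k fun i => s.getD i false, List.count]
  conv_lhs => rw [hs]
  rw [List.countP_map]
  congr 1
  funext i
  simp

/-- The partitioning `P` makes every component monochromatic, in an admitted part. -/
def Respects (P : Fin n → Fin k) (cs : Comps) : Prop :=
  ∀ x ∈ cs, ∃ i : Fin k, x.2.getD i false = true ∧ ∀ v : Fin n, x.1.getD v false = true → P v = i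

/-- The components partition the set of nodes. -/
def IsPartition (n : ℕ) (cs : Comps) : Prop :=
  ∀ v : Fin n, cs.countP (fun x => x.1.getD v false) = 1

theorem IsPartition.exists_mem {cs : Comps} (h : IsPartition n cs) (v : Fin n) :
    ∃ x ∈ cs, x.1.getD v false = true :=
  List.countP_pos_iff.1 (by rw [h v]; exact one_pos)

theorem isPartition_startComps : IsPartition n (startComps k n) := by
  intro v
  rw [startComps, List.countP_map]
  have : (List.range n).countP ((fun x : List Bool × List Bool => x.1.getD v false) ∘ fun v =>
      ((List.range n).map fun w => decide (w = v), (List.range k).map fun _ => true)) =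
      (List.range n).countP fun w => decide ((v : ℕ) = w) := by
    refine List.countP_congr fun w _ => ?_
    rw [Function.comp_apply, getD_map_range _ _ v.2]
  rw [this, countP_range]
  simp [Fin.val_inj, Finset.filter_eq]

theorem respects_startComps (P : Fin n → Fin k) : Respects P (startComps k n) := by
  intro x hx
  obtain ⟨w, hw, rfl⟩ := List.mem_map.1 hx
  rw [List.mem_range] at hw
  refine ⟨P ⟨w, hw⟩, getD_map_range _ _ (P _).2, fun v hv => ?_⟩
  rw [getD_map_range _ _ v.2, decide_eq_true_iff] at hv
  congr 1
  exact Fin.ext hv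

theorem IsPartition.mergeComps {cs : Comps} (h : IsPartition n cs) (e : List Bool) :
    IsPartition n (mergeComps k n e cs) := by
  intro v
  have hv := h v
  rw [List.countP_eq_countP_filter_add cs _ fun x => meets n e x.1] at hv
  rw [_root_.mergeComps, List.countP_cons]
  dsimp only
  rw [getD_map_range _ _ v.2]
  by_cases ha : (cs.any fun x => meets n e x.1 && x.1.getD v false) = true
  · have : 0 < (cs.filter fun x => meets n e x.1).countP fun x => x.1.getD v false := by
      obtain ⟨x, hx, hx'⟩ := List.any_eq_true.1 ha
      rw [Bool.and_eq_true] at hx'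
      exact List.countP_pos_iff.2 ⟨x, List.mem_filter.2 ⟨hx, hx'.1⟩, hx'.2⟩
    rw [if_pos ha]
    omega
  · have : (cs.filter fun x => meets n e x.1).countP (fun x => x.1.getD v false) = 0 := by
      refine List.countP_eq_zero.2 fun x hx hx' => ha ?_
      rw [List.mem_filter] at hx
      exact List.any_eq_true.2 ⟨x, hx.1, by rw [Bool.and_eq_true]; exact ⟨hx.2, hx'⟩⟩
    rw [if_neg ha]
    omega

theorem IsPartition.confineComps {cs : Comps} (h : IsPartition n cs) (e s : List Bool) :
    IsPartition n (confineComps k n e s cs) := by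
  intro v
  rw [_root_.confineComps, List.countP_map]
  exact h v

theorem respects_mergeComps {P : Fin n → Fin k} {cs : Comps} (h : IsPartition n cs)
    {e : Finset (Fin n)} (he : e.Nonempty) :
    Respects P (mergeComps k n (bits e) cs) ↔
      Respects P cs ∧ ∀ v ∈ e, ∀ w ∈ e, P v = P w := by
  constructor
  · intro hP
    obtain ⟨i, hi, hPi⟩ := hP _ (List.mem_cons_self ..)
    have hmono : ∀ x ∈ cs, meets n (bits e) x.1 = true →
        ∀ v : Fin n, x.1.getD v false = true → P v = i := by
      intro x hx hm v hv
      refine hPi v ?_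
      dsimp only
      rw [getD_map_range _ _ v.2, List.any_eq_true]
      exact ⟨x, hx, by rw [hm, hv]; rfl⟩
    have hpart : ∀ v ∈ e, P v = i := by
      intro v hv
      obtain ⟨x, hx, hxv⟩ := h.exists_mem v
      exact hmono x hx (meets_iff.2 ⟨v, hv, hxv⟩) v hxv
    refine ⟨fun x hx => ?_, fun v hv w hw => (hpart v hv).trans (hpart w hw).symm⟩
    by_cases hm : meets n (bits e) x.1 = true
    · refine ⟨i, ?_, hmono x hx hm⟩
      dsimp only at hi
      rw [getD_map_range _ _ i.2, List.all_eq_true] at hi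
      simpa [hm] using hi x hx
    · exact hP x (List.mem_cons_of_mem _ (List.mem_filter.2 ⟨hx, by simpa using hm⟩))
  · rintro ⟨hP, hmono⟩ x hx
    rcases List.mem_cons.1 hx with rfl | hx
    · obtain ⟨v₀, hv₀⟩ := he
      have key : ∀ x ∈ cs, meets n (bits e) x.1 = true → x.2.getD (P v₀) false = true ∧
          ∀ v : Fin n, x.1.getD v false = true → P v = P v₀ := by
        intro x hx hm
        obtain ⟨i, hi, hPi⟩ := hP x hx
        obtain ⟨w, hw, hxw⟩ := meets_iff.1 hm
        have : i = P v₀ := (hPi w hxw).symm.trans (hmono w hw v₀ hv₀)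
        subst this
        exact ⟨hi, hPi⟩
      refine ⟨P v₀, ?_, fun v hv => ?_⟩
      · dsimp only
        rw [getD_map_range _ _ (P v₀).2, List.all_eq_true]
        intro x hx
        by_cases hm : meets n (bits e) x.1 = true
        · rw [(key x hx hm).1, Bool.or_true]
        · simp [hm]
      · dsimp only at hv
        rw [getD_map_range _ _ v.2, List.any_eq_true] at hv
        obtain ⟨x, hx, hxv⟩ := hv
        rw [Bool.and_eq_true] at hxv
        exact (key x hx hxv.1).2 v hxv.2
    · exact hP x (List.mem_filter.1 hx).1

theorem respects_confineComps {P : Fin n → Fin k} {cs : Comps} (h : IsPartition n cs)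
    {e : Finset (Fin n)} {s : List Bool} :
    Respects P (confineComps k n (bits e) s cs) ↔
      Respects P cs ∧ ∀ v ∈ e, s.getD (P v) false = true := by
  constructor
  · intro hP
    have key : ∀ x ∈ cs, ∃ i : Fin k, (x.2.getD i false = true ∧
        (meets n (bits e) x.1 = true → s.getD i false = true)) ∧
        ∀ v : Fin n, x.1.getD v false = true → P v = i := by
      intro x hx
      obtain ⟨i, hi, hPi⟩ := hP _ (List.mem_map_of_mem hx)
      refine ⟨i, ?_, hPi⟩
      dsimp only at hi
      cases hm : meets n (bits e) x.1
      · rw [hm] at hi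
        exact ⟨hi, by simp⟩
      · rw [hm, cond_true, getD_map_range _ _ i.2, Bool.and_eq_true] at hi
        exact ⟨hi.1, fun _ => hi.2⟩
    refine ⟨fun x hx => ?_, fun v hv => ?_⟩
    · obtain ⟨i, hi, hPi⟩ := key x hx
      exact ⟨i, hi.1, hPi⟩
    · obtain ⟨x, hx, hxv⟩ := h.exists_mem v
      obtain ⟨i, hi, hPi⟩ := key x hx
      rw [hPi v hxv]
      exact hi.2 (meets_iff.2 ⟨v, hv, hxv⟩)
  · rintro ⟨hP, hs⟩ x hx
    obtain ⟨y, hy, rfl⟩ := List.mem_map.1 hx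
    obtain ⟨i, hi, hPi⟩ := hP y hy
    refine ⟨i, ?_, hPi⟩
    dsimp only
    cases hm : meets n (bits e) y.1
    · exact hi
    · obtain ⟨w, hw, hxw⟩ := meets_iff.1 hm
      rw [cond_true, getD_map_range _ _ i.2, hi, ← hPi w hxw, hs w hw]
      rfl

theorem isPartition_of_mem_guessStep {L : ℕ} {opts : List (List Bool × ℕ)}
    {st : List (ℕ × Comps)} {e : List Bool} (h : ∀ g ∈ st, IsPartition n g.2) :
    ∀ g ∈ guessStep k n L opts st e, IsPartition n g.2 := by
  intro g hg
  obtain ⟨g', hg', hg⟩ := List.mem_flatMap.1 hg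
  rcases List.mem_cons.1 hg with rfl | hg
  · exact (h g' hg').mergeComps e
  · obtain ⟨o, _, rfl⟩ := List.mem_map.1 hg
    exact (h g' hg').confineComps e o.1

theorem isPartition_of_mem_foldl {L : ℕ} {opts : List (List Bool × ℕ)}
    {st : List (ℕ × Comps)} (es : List (List Bool)) (h : ∀ g ∈ st, IsPartition n g.2) :
    ∀ g ∈ es.foldl (guessStep k n L opts) st, IsPartition n g.2 := by
  induction es generalizing st with
  | nil => exact h
  | cons e es ih => exact ih (isPartition_of_mem_guessStep h)

/-- Every partitioning within the budget is found by one of the guesses. -/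
theorem exists_mem_foldl_guessStep {L : ℕ} {μ : Metric} {P : Fin n → Fin k}
    (es : List (Finset (Fin n))) (hes : ∀ e ∈ es, e.Nonempty) {st : List (ℕ × Comps)}
    {p : ℕ} {cs : Comps} (hst : (p, cs) ∈ st) (hcs : IsPartition n cs) (hP : Respects P cs)
    (hL : p + (es.map fun e => μ.price (lam P e)).sum ≤ L) :
    ∃ g ∈ (es.map bits).foldl (guessStep k n L (cutOptions k μ)) st, Respects P g.2 := by
  induction es generalizing st p cs with
  | nil => exact ⟨_, hst, hP⟩
  | cons e es ih =>
    rw [List.map_cons, List.sum_cons] at hL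
    rw [List.map_cons, List.foldl_cons]
    have hes' := fun e' he' => hes e' (List.mem_cons_of_mem _ he')
    by_cases hl : lam P e ≤ 1
    · rw [μ.price_eq_zero hl] at hL
      refine ih hes' (List.mem_flatMap.2 ⟨_, hst, List.mem_cons_self ..⟩) (hcs.mergeComps _)
        ((respects_mergeComps hcs (hes e (List.mem_cons_self ..))).2
          ⟨hP, (lam_le_one_iff P e).1 hl⟩) (by simpa using hL)
    · set s : List Bool := (List.range k).map fun i => decide (∃ v ∈ e, (P v : ℕ) = i) with hs
      have hlen : s.length = k := by simp [hs]
      have hcount : s.count true = lam P e := by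
        rw [count_true_eq hlen, lam]
        congr 1
        ext i
        rw [Finset.mem_filter, hs, getD_map_range _ _ i.2]
        simp [Fin.val_inj]
      have hmem : (s, μ.price (lam P e)) ∈ cutOptions k μ := by
        refine List.mem_map.2 ⟨s, List.mem_filter.2 ⟨mem_tuples.2 ⟨hlen, fun b _ => ?_⟩, ?_⟩, ?_⟩
        · cases b <;> simp
        · rw [hcount, Nat.ble_eq]; omega
        · rw [hcount]
      refine ih hes' (List.mem_flatMap.2 ⟨_, hst, List.mem_cons_of_mem _ (List.mem_map.2
        ⟨_, List.mem_filter.2 ⟨hmem, ?_⟩, rfl⟩)⟩) (hcs.confineComps _ _)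
        ((respects_confineComps hcs).2 ⟨hP, fun v hv => ?_⟩) (by simpa [add_assoc] using hL)
      · rw [Nat.ble_eq]; dsimp only; omega
      · rw [hs, getD_map_range _ _ (P v).2, decide_eq_true_iff]
        exact ⟨v, hv, rfl⟩

/-- A partitioning that respects a guess costs at most as much as the guess says. -/
theorem cost_le_of_mem_foldl_guessStep {L : ℕ} {μ : Metric} {P : Fin n → Fin k}
    (es : List (Finset (Fin n))) (hes : ∀ e ∈ es, e.Nonempty) {st : List (ℕ × Comps)}
    (hst : ∀ g ∈ st, IsPartition n g.2) {g : ℕ × Comps}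
    (hg : g ∈ (es.map bits).foldl (guessStep k n L (cutOptions k μ)) st) (hP : Respects P g.2) :
    ∃ g₀ ∈ st, Respects P g₀.2 ∧ g₀.1 + (es.map fun e => μ.price (lam P e)).sum ≤ g.1 := by
  induction es generalizing st with
  | nil => exact ⟨g, hg, hP, le_rfl⟩
  | cons e es ih =>
    obtain ⟨g₁, hg₁, hP₁, hle⟩ := ih (fun e' he' => hes e' (List.mem_cons_of_mem _ he'))
      (isPartition_of_mem_guessStep hst) hg
    obtain ⟨g₀, hg₀, hg₁⟩ := List.mem_flatMap.1 hg₁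
    rw [List.map_cons, List.sum_cons]
    rcases List.mem_cons.1 hg₁ with rfl | hg₁
    · obtain ⟨hP₀, hmono⟩ :=
        (respects_mergeComps (hst _ hg₀) (hes e (List.mem_cons_self ..))).1 hP₁
      refine ⟨g₀, hg₀, hP₀, ?_⟩
      rw [μ.price_eq_zero ((lam_le_one_iff P e).2 hmono), zero_add]
      exact hle
    · obtain ⟨o, ho, rfl⟩ := List.mem_map.1 hg₁
      obtain ⟨hP₀, hs⟩ := (respects_confineComps (hst _ hg₀)).1 hP₁
      refine ⟨g₀, hg₀, hP₀, ?_⟩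
      obtain ⟨s, hs', rfl⟩ := List.mem_map.1 (List.mem_filter.1 ho).1
      have : μ.price (lam P e) ≤ μ.price (s.count true) := by
        refine μ.price_mono ?_
        rw [count_true_eq (mem_tuples.1 (List.mem_filter.1 hs').1).1, lam]
        refine Finset.card_le_card fun i hi => ?_
        obtain ⟨v, hv, rfl⟩ := Finset.mem_image.1 hi
        exact Finset.mem_filter.2 ⟨Finset.mem_univ _, hs v hv⟩
      dsimp only at hle
      omega

/-- The number of nodes of the `j`-th constraint set in the components `cs` that `P` puts into part
`i`. -/
def placed (Vs : List (List Bool)) (P : Fin n → Fin k) (cs : Comps) (j i : ℕ) : ℕ :=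
  ∑ v : Fin n, if (Vs.getD j []).getD v false = true ∧ (P v : ℕ) = i then
    cs.countP (fun x => x.1.getD v false) else 0

theorem mkTable_congr {c k : ℕ} {g g' : ℕ → ℕ → ℕ} (h : ∀ j < c, ∀ i < k, g j i = g' j i) :
    mkTable c k g = mkTable c k g' :=
  List.map_congr_left fun j hj => List.map_congr_left fun i hi =>
    h j (List.mem_range.1 hj) i (List.mem_range.1 hi)

theorem mkTable_getD {c k : ℕ} (g : ℕ → ℕ → ℕ) {j i : ℕ} (hj : j < c) (hi : i < k) :
    ((mkTable c k g).getD j []).getD i 0 = g j i := by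
  rw [mkTable, getD_map_range _ _ hj, getD_map_range _ _ hi]

theorem addTable_placed {c : ℕ} (Vs : List (List Bool)) (P : Fin n → Fin k) (cs : Comps)
    (x : List Bool × List Bool) (i : Fin k)
    (h : ∀ v : Fin n, x.1.getD v false = true → P v = i) :
    addTable c k n Vs x.1 i (mkTable c k (placed Vs P cs)) =
      mkTable c k (placed Vs P (cs ++ [x])) := by
  refine mkTable_congr fun j hj i' hi' => ?_
  rw [mkTable_getD _ hj hi']
  have h2 : (bif decide (i' = (i : ℕ)) then (List.range n).countP (fun v =>
      (Vs.getD j []).getD v false && x.1.getD v false) else 0) =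
      ∑ v : Fin n, if (Vs.getD j []).getD v false = true ∧ (P v : ℕ) = i' then
        (if x.1.getD v false = true then 1 else 0) else 0 := by
    by_cases hi : i' = (i : ℕ)
    · rw [decide_eq_true hi, cond_true, countP_range, Finset.card_filter]
      refine Finset.sum_congr rfl fun v _ => ?_
      by_cases hx : x.1.getD v false = true
      · have : (P v : ℕ) = i' := by rw [h v hx, hi]
        simp only [hx, this, Bool.and_true, and_true, if_true]
      · rw [Bool.not_eq_true] at hx
        simp only [hx, Bool.and_false, Bool.false_eq_true, if_false, ite_self]
    · rw [decide_eq_false hi, cond_false]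
      refine (Finset.sum_eq_zero fun v _ => ?_).symm
      split_ifs with h1 h3
      · exact absurd (by rw [← h1.2, h v h3]) hi
      · rfl
      · rfl
  rw [h2, placed, placed, ← Finset.sum_add_distrib]
  refine Finset.sum_congr rfl fun v _ => ?_
  rw [List.countP_append, List.countP_singleton]
  split_ifs <;> rfl

/-- Every table of the dynamic program comes from a partitioning that respects the components. -/
theorem exists_of_mem_tables {c : ℕ} (hk : 0 < k) (Vs : List (List Bool)) (cs : Comps)
    (hcs : ∀ v : Fin n, cs.countP (fun x => x.1.getD v false) ≤ 1) {s : List (List ℕ)}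
    (hs : s ∈ tables c k n Vs cs) :
    ∃ P : Fin n → Fin k, Respects P cs ∧ s = mkTable c k (placed Vs P cs) := by
  induction cs using List.reverseRecOn generalizing s with
  | nil =>
    rw [tables, List.foldl_nil, List.mem_singleton] at hs
    refine ⟨fun _ => ⟨0, hk⟩, by simp [Respects], ?_⟩
    rw [hs]
    exact mkTable_congr fun j _ i _ => by simp [placed]
  | append_singleton cs x ih =>
    have hcs' : ∀ v : Fin n, cs.countP (fun x => x.1.getD v false) +
        (if x.1.getD v false = true then 1 else 0) ≤ 1 := fun v => by
      simpa [List.countP_append, List.countP_singleton] using hcs v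
    rw [tables, List.foldl_append] at hs
    obtain ⟨s', hs', hi⟩ := List.any_eq_true.1 (List.mem_filter.1 hs).2
    obtain ⟨P, hP, rfl⟩ := ih (fun v => (Nat.le_add_right _ _).trans (hcs' v)) hs'
    obtain ⟨i, hik, hi⟩ := List.any_eq_true.1 hi
    rw [Bool.and_eq_true, decide_eq_true_iff] at hi
    obtain ⟨hix, rfl⟩ := hi
    rw [List.mem_range] at hik
    have hnot : ∀ v : Fin n, x.1.getD v false = true → ∀ y ∈ cs, y.1.getD v false ≠ true := by
      intro v hv
      have := hcs' v
      rw [if_pos hv] at this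
      exact List.countP_eq_zero.1 (by omega)
    set P' : Fin n → Fin k := fun v => if x.1.getD v false = true then ⟨i, hik⟩ else P v with hP'
    have hx : ∀ v : Fin n, x.1.getD v false = true → P' v = ⟨i, hik⟩ := fun v hv => if_pos hv
    refine ⟨P', fun y hy => ?_, ?_⟩
    · rcases List.mem_append.1 hy with hy | hy
      · obtain ⟨i', hi', hPi⟩ := hP y hy
        refine ⟨i', hi', fun v hv => ?_⟩
        rw [hP']
        dsimp only
        rw [if_neg fun h => hnot v h y hy hv]
        exact hPi v hv
      · rw [List.mem_singleton] at hy
        subst hy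
        exact ⟨⟨i, hik⟩, hix, hx⟩
    · rw [← addTable_placed Vs P' cs x ⟨i, hik⟩ hx]
      congr 1
      refine mkTable_congr fun j _ i' _ => Finset.sum_congr rfl fun v _ => ?_
      by_cases hv : x.1.getD v false = true
      · rw [List.countP_eq_zero.2 fun y hy => hnot v hv y hy]
        simp
      · have : P' v = P v := if_neg hv
        simp only [this]

/-- Every partitioning that respects the components contributes its table. -/
theorem mkTable_placed_mem_tables {c : ℕ} (Vs : List (List Bool)) (cs : Comps)
    (hcs : ∀ v : Fin n, cs.countP (fun x => x.1.getD v false) ≤ 1) {P : Fin n → Fin k}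
    (hP : Respects P cs) : mkTable c k (placed Vs P cs) ∈ tables c k n Vs cs := by
  induction cs using List.reverseRecOn with
  | nil =>
    rw [tables, List.foldl_nil, List.mem_singleton]
    exact mkTable_congr fun j _ i _ => by simp [placed]
  | append_singleton cs x ih =>
    have hpl : ∀ j i, placed Vs P (cs ++ [x]) j i ≤ n := fun j i => by
      refine (Finset.sum_le_card_nsmul _ _ 1 fun v _ => ?_).trans (by simp)
      split_ifs
      · exact hcs v
      · exact Nat.zero_le _
    have ih' := ih (fun v => (List.Sublist.countP_le (List.sublist_append_left _ _)).trans (hcs v))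
      fun y hy => hP y (List.mem_append_left _ hy)
    obtain ⟨i, hi, hPi⟩ := hP x (List.mem_append_right _ (List.mem_singleton_self x))
    rw [tables, List.foldl_append]
    refine List.mem_filter.2 ⟨mem_tuples.2 ⟨by simp [mkTable], fun r hr => ?_⟩,
      List.any_eq_true.2 ⟨_, ih', List.any_eq_true.2 ⟨i, List.mem_range.2 i.2, ?_⟩⟩⟩
    · obtain ⟨j, _, rfl⟩ := List.mem_map.1 hr
      refine mem_tuples.2 ⟨by simp, fun a ha => ?_⟩
      obtain ⟨i, _, rfl⟩ := List.mem_map.1 ha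
      exact List.mem_range.2 (Nat.lt_succ_of_le (hpl j i))
    · rw [Bool.and_eq_true, decide_eq_true_iff]
      exact ⟨hi, addTable_placed Vs P cs x i hPi⟩

end

section

variable {c k : ℕ}

theorem MultiInst.sets_getD (I : MultiInst c) (j : Fin c) : I.sets.getD j [] = bits (I.V j) := by
  simp [MultiInst.sets]

theorem withinThresholds_iff (I : MultiInst c) {cs : Comps} (hcs : IsPartition I.n cs)
    (thr : ℕ → ℕ) (P : Fin I.n → Fin k) :
    withinThresholds c k I.n thr I.sets (mkTable c k (placed I.sets P cs)) = true ↔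
      ∀ (j : Fin c) (i : Fin k), ((I.V j).filter fun v => P v = i).card ≤ thr (I.V j).card := by
  have h1 : ∀ (j : Fin c) (i : Fin k),
      placed I.sets P cs j i = ((I.V j).filter fun v => P v = i).card := fun j i => by
    rw [placed, Finset.card_filter, ← Finset.sum_filter_add_sum_filter_not Finset.univ (· ∈ I.V j),
      Finset.filter_mem_eq_inter, Finset.univ_inter, Finset.sum_eq_zero
        (s := Finset.univ.filter fun v => v ∉ I.V j) fun v hv => ?_, add_zero]
    · refine Finset.sum_congr rfl fun v hv => ?_
      rw [hcs v, I.sets_getD, bits_getD, decide_eq_true hv]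
      simp [Fin.val_inj]
    · rw [I.sets_getD, bits_getD, decide_eq_false (Finset.mem_filter.1 hv).2]
      simp
  have h2 : ∀ j : Fin c, (List.range I.n).countP (fun v => (I.sets.getD j []).getD v false) =
      (I.V j).card := fun j => by
    rw [countP_range, I.sets_getD]
    congr 1
    ext v
    rw [Finset.mem_filter, bits_getD]
    simp
  simp only [withinThresholds, List.all_eq_true, List.mem_range, Nat.ble_eq]
  constructor
  · intro h j i
    have := h j j.2 i i.2
    rwa [mkTable_getD _ j.2 i.2, h1, h2] at this
  · intro h j hj i hi
    have := h ⟨j, hj⟩ ⟨i, hi⟩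
    rw [mkTable_getD _ hj hi, h2 ⟨j, hj⟩, h1 ⟨j, hj⟩ ⟨i, hi⟩]
    exact this

theorem existsPartitioning_iff (hk : 0 < k) (μ : Metric) (I : MultiInst c) (L : ℕ) (thr : ℕ → ℕ) :
    existsPartitioning c k I.n L thr (cutOptions k μ) (I.edges.map bits) I.sets = true ↔
      ∃ P : Fin I.n → Fin k,
        (∀ (j : Fin c) (i : Fin k), ((I.V j).filter fun v => P v = i).card ≤ thr (I.V j).card) ∧
        I.cost P μ ≤ L := by
  have hst : ∀ g ∈ [((0 : ℕ), startComps k I.n)], IsPartition I.n g.2 := by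
    simpa using isPartition_startComps
  have hle : ∀ g ∈ guesses k I.n L (cutOptions k μ) (I.edges.map bits), g.1 ≤ L :=
    foldl_guessStep_le _ (by simp)
  have hpart : ∀ g ∈ guesses k I.n L (cutOptions k μ) (I.edges.map bits), IsPartition I.n g.2 :=
    isPartition_of_mem_foldl _ hst
  simp only [existsPartitioning, List.any_eq_true]
  constructor
  · rintro ⟨g, hg, s, hs, hthr⟩
    obtain ⟨P, hP, rfl⟩ := exists_of_mem_tables hk I.sets g.2 (fun v => (hpart g hg v).le) hs
    obtain ⟨g₀, hg₀, _, h⟩ := cost_le_of_mem_foldl_guessStep I.edges I.nonempty hst hg hP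
    rw [List.mem_singleton] at hg₀
    subst hg₀
    rw [zero_add, ← HGraph.cost_eq_list] at h
    exact ⟨P, (withinThresholds_iff I (hpart g hg) thr P).1 hthr, h.trans (hle g hg)⟩
  · rintro ⟨P, hthr, hcost⟩
    rw [HGraph.cost_eq_list] at hcost
    obtain ⟨g, hg, hP⟩ := exists_mem_foldl_guessStep (L := L) (μ := μ) I.edges I.nonempty
      (List.mem_singleton_self (0, startComps k I.n)) isPartition_startComps
      (respects_startComps P) (by rwa [zero_add])
    exact ⟨g, hg, _, mkTable_placed_mem_tables I.sets g.2 (fun v => (hpart g hg v).le) hP,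
      (withinThresholds_iff I (hpart g hg) thr P).2 hthr⟩

end

/-! ### Membership in XP -/

/-- An instance together with a budget. The parameter `q` stands for the number of ways to cut a
hyperedge; it only enters into the weight, which allows for running times that are polynomial in the
number of guesses. -/
structure Budgeted (c _q : ℕ) : Type where
  inst : MultiInst c
  budget : ℕ

instance (c q : ℕ) : TEnc (Budgeted c q) :=
  ⟨fun x => Tr.cons x.inst.enc (encNat x.budget),
    fun x => x.inst.size + x.budget + (1 + q * x.inst.edges.length) ^ x.budget⟩

section

variable {c q : ℕ} {Γ : Type} [TEnc Γ] {f : Γ → Budgeted c q}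

theorem wt_budgeted (x : Budgeted c q) :
    wt x = x.inst.size + x.budget + (1 + q * x.inst.edges.length) ^ x.budget := rfl

theorem PolyFun.budgeted_inst (hf : PolyFun f) : PolyFun fun γ => (f γ).inst :=
  PolyFun.comp (g := fun x : Budgeted c q => x.inst) (.of_expr (.hd (.var 0))
    (PolyBdd.wt_id.mono fun x => (Nat.le_add_right _ x.budget).trans (Nat.le_add_right _ _))
    fun _ => rfl) hf

@[fun_prop]
theorem PolyFun.budgeted_budget (hf : PolyFun f) : PolyFun fun γ => (f γ).budget :=
  PolyFun.comp (g := fun x : Budgeted c q => x.budget) (.of_expr (.tl (.var 0))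
    (PolyBdd.wt_id.mono fun x => (Nat.le_add_left x.budget x.inst.size).trans
      (Nat.le_add_right _ _))
    fun _ => rfl) hf

@[fun_prop]
theorem PolyFun.budgeted_n (hf : PolyFun f) : PolyFun fun γ => (f γ).inst.n :=
  multiInst_n.comp hf.budgeted_inst

@[fun_prop]
theorem PolyFun.budgeted_edges (hf : PolyFun f) : PolyFun fun γ => (f γ).inst.edges.map bits :=
  multiInst_edges.comp hf.budgeted_inst

@[fun_prop]
theorem PolyFun.budgeted_sets (hf : PolyFun f) : PolyFun fun γ => (f γ).inst.sets :=
  multiInst_sets.comp hf.budgeted_inst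

theorem PolyFun.guesses (k : ℕ) (μ : Metric) {f : Γ → Budgeted c (cutOptions k μ).length}
    (hf : PolyFun f) : PolyFun fun γ =>
      guesses k (f γ).inst.n (f γ).budget (cutOptions k μ) ((f γ).inst.edges.map bits) := by
  refine PolyFun.foldl (M := fun γ => wt (f γ) * ((wt (f γ) + wt (f γ) * (wt (f γ) + k + 1)) + 1))
    (by fun_prop) ?_ ?_ ?_ fun γ l' hl' => ?_
  · exact ((PolyFun.const 0).pair hf.budgeted_n.startComps).list_cons (.const [])
  · fun_prop
  · have := hf.bdd
    fun_prop
  set x := f γ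
  have hlen : l'.length ≤ x.inst.edges.length := by simpa using hl'.length_le
  have h1 := length_foldl_guessStep (k := k) (n := x.inst.n) (L := x.budget)
    (opts := cutOptions k μ) (fun o => one_le_of_mem_cutOptions) l'
    (st := [(0, _root_.startComps k x.inst.n)]) (by simp)
  simp only [List.map_cons, List.map_nil, List.sum_cons, List.sum_nil, add_zero, Nat.sub_zero] at h1
  have hw := wt_budgeted x
  have hpow : (1 + (cutOptions k μ).length * l'.length) ^ x.budget ≤
      (1 + (cutOptions k μ).length * x.inst.edges.length) ^ x.budget := by gcongr
  have hn : x.inst.n + l'.length ≤ wt x := by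
    have : x.inst.size = x.inst.n + x.inst.edges.length := rfl
    omega
  refine (wt_list_le (M := wt x + wt x * (wt x + k + 1)) fun g hg => ?_).trans ?_
  · refine (wt_foldl_guessStep l' g hg).trans ?_
    exact add_le_add (by omega) (Nat.mul_le_mul hn (by omega))
  · exact Nat.mul_le_mul_right _ (by omega)

theorem PolyFun.existsPartitioning (k : ℕ) (μ : Metric) {thr : ℕ → ℕ} (ht : PolyFun thr) :
    PolyFun fun x : Budgeted c (cutOptions k μ).length =>
      existsPartitioning c k x.inst.n x.budget thr (cutOptions k μ) (x.inst.edges.map bits)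
        x.inst.sets := by
  unfold _root_.existsPartitioning
  refine PolyFun.list_any (PolyFun.guesses k μ .id) (PolyFun.list_any (by fun_prop) ?_)
  exact ht.withinThresholds (by fun_prop) (by fun_prop) (by fun_prop)

end

/-- The balance threshold of a set of `m` nodes. -/
noncomputable def threshold (k : ℕ) (ε : ℝ) (m : ℕ) : ℕ := ⌊(1 + ε) * ((m : ℝ) / (k : ℝ))⌋₊

theorem ThresholdPolyTime.polyFun {k : ℕ} (hk : 0 < k) {ε : ℝ} (hε : 0 ≤ ε)
    (h : ThresholdPolyTime k ε) : PolyFun (threshold k ε) := by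
  obtain ⟨p, C, d, hp⟩ := h
  obtain ⟨q, K, hq⟩ := RunsIn.clean p
  refine ⟨⟨q, fun m => C * (m + 1) ^ d + K, PolyBdd.add ⟨C, d, fun m => le_rfl⟩ (.const _),
    fun m => hq _ _ _ (hp m)⟩, ⌈1 + ε⌉₊, 1, fun m => ?_⟩
  change ⌊(1 + ε) * ((m : ℝ) / (k : ℝ))⌋₊ ≤ _
  refine Nat.floor_le_of_le ?_
  have h1 : (m : ℝ) / (k : ℝ) ≤ m := div_le_self (Nat.cast_nonneg m) (Nat.one_le_cast.2 hk)
  have h2 : (m : ℝ) ≤ ((m + 1 : ℕ) : ℝ) := Nat.cast_le.2 (Nat.le_succ m)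
  rw [pow_one, Nat.cast_mul]
  exact mul_le_mul (Nat.le_ceil _) (h1.trans h2) (by positivity) (by positivity)

theorem polyFun_threshold_of_rat {k : ℕ} (hk : 0 < k) {q : ℚ} (hq : 0 ≤ (q : ℝ)) :
    PolyFun (threshold k q) := by
  have hq' : 0 ≤ 1 + q := by
    have : (0 : ℚ) ≤ q := by exact_mod_cast hq
    linarith
  obtain ⟨a, ha⟩ := Int.eq_ofNat_of_zero_le (Rat.num_nonneg.2 hq')
  have hb : 0 < (1 + q).den * k := Nat.mul_pos (1 + q).pos hk
  have h : threshold k q = fun m => a * m / ((1 + q).den * k) := by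
    funext m
    rw [threshold, ← Nat.floor_div_eq_div (K := ℝ)]
    congr 1
    have h1 : (1 + (q : ℝ)) = (a : ℝ) / ((1 + q).den : ℝ) := by
      have h2 : ((1 + q : ℚ) : ℝ) = (((1 + q).num : ℚ) / ((1 + q).den : ℚ) : ℚ) := by
        rw [Rat.num_div_den]
      rw [ha] at h2
      push_cast at h2
      exact h2
    rw [h1, Nat.cast_mul, Nat.cast_mul, div_mul_div_comm]
  rw [h]
  exact PolyFun.nat_div (by fun_prop) _ hb

theorem MultiInst.feasible_iff {c k : ℕ} (I : MultiInst c) {ε : ℝ} (hε : 0 ≤ ε)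
    (P : Fin I.n → Fin k) : I.Feasible ε P ↔
      ∀ (j : Fin c) (i : Fin k),
        ((I.V j).filter fun v => P v = i).card ≤ threshold k ε (I.V j).card :=
  forall_congr' fun _ => forall_congr' fun _ => (Nat.le_floor_iff (by positivity)).symm

theorem computable_affine (a b : ℕ) : Computable fun L : ℕ => a * L + b :=
  (Primrec.nat_add.comp (Primrec.nat_mul.comp (Primrec.const a) Primrec.id)
    (Primrec.const b)).to_comp

/-- The exhaustive search over the at most `(1 + q m) ^ L` ways of choosing and placing the cut
hyperedges, each completed by dynamic programming, is an XP algorithm. -/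
theorem multiPartitionInXP {k : ℕ} (hk : 0 < k) (c : ℕ) {ε : ℝ} (hε : 0 ≤ ε) (μ : Metric)
    (ht : PolyFun (threshold k ε)) : MultiPartitionInXP k c ε μ := by
  obtain ⟨p, C, d, hp⟩ := (PolyFun.existsPartitioning (c := c) k μ ht).runsIn
  set q := (cutOptions k μ).length with hq
  refine ⟨p, fun L => d * (q + 1) * L + (C + d * 3), computable_affine _ _, fun I L => ?_⟩
  refine ⟨existsPartitioning c k I.n L (threshold k ε) (cutOptions k μ) (I.edges.map bits) I.sets,
    ?_, ?_⟩
  · obtain ⟨s, t, h, h', h''⟩ := hp ⟨I, L⟩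
    refine ⟨s, t, h, h'.trans ?_, h''⟩
    rw [wt_budgeted]
    dsimp only
    -- since `2 ≤ N`, all constants can be moved into the exponent
    set N := I.size + 2 with hN
    have hN0 : 0 < N := by omega
    have hC : C ≤ N ^ C := (Nat.lt_pow_self (by omega)).le
    have hbase : 1 + q * I.edges.length ≤ N ^ (q + 1) := by
      have h1 : I.edges.length ≤ N := by
        have : I.size = I.n + I.edges.length := rfl
        omega
      have h2 : q + 1 ≤ N ^ q := Nat.lt_pow_self (by omega)
      calc 1 + q * I.edges.length ≤ N + q * N := by gcongr; omega
        _ = (q + 1) * N := by ring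
        _ ≤ N ^ q * N := by gcongr
        _ = N ^ (q + 1) := (pow_succ _ _).symm
    have hw : I.size + L + (1 + q * I.edges.length) ^ L + 1 ≤ N ^ ((q + 1) * L + 3) := by
      set X := N ^ ((q + 1) * L) with hX
      have hX1 : 1 ≤ X := Nat.one_le_pow _ _ hN0
      have h1 : (1 + q * I.edges.length) ^ L ≤ X := by
        rw [hX, pow_mul]
        gcongr
      have h2 : L ≤ X := (Nat.lt_pow_self (n := L) (by omega : 1 < N)).le.trans
        (Nat.pow_le_pow_right hN0 (Nat.le_mul_of_pos_left L (Nat.succ_pos q)))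
      have h3 : N ≤ X * N := Nat.le_mul_of_pos_left N hX1
      have h4 : X * 2 ≤ X * N := Nat.mul_le_mul_left X (by omega)
      have h5 : X * N * (2 * 2) ≤ X * N * (N * N) :=
        Nat.mul_le_mul_left _ (Nat.mul_le_mul (by omega) (by omega))
      calc _ ≤ X * N * (2 * 2) := by omega
        _ ≤ X * N * (N * N) := h5
        _ = N ^ ((q + 1) * L + 3) := by rw [hX]; ring
    calc _ ≤ N ^ C * (N ^ ((q + 1) * L + 3)) ^ d := by gcongr
      _ = _ := by rw [← pow_mul, ← pow_add]; congr 1; ring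
  · rw [existsPartitioning_iff hk]
    simp only [I.feasible_iff hε]

theorem lemma6p1 (k c : ℕ) (hk : 2 ≤ k) (μ : Metric) :
    -- the reduction
    MultiSectionReduces k c μ ∧
    -- approximation, on all hypergraphs, in time polynomial in the input size
    (∃ C : ℝ, ∀ α : ℕ → ℝ, Monotone α → (∀ n, 1 ≤ α n) →
      SectionApprox k μ (fun _ => True) α →
      MultiSectionApprox k c μ (fun _ => True) fun n => C * α (n ^ (c + 1))) ∧
    -- approximation, on hypergraphs with polynomially many hyperedges
    (∃ C : ℝ, ∀ h : ℕ, ∃ h' : ℕ, ∀ α : ℕ → ℝ, Monotone α → (∀ n, 1 ≤ α n) →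
      SectionApprox k μ (fun H => H.edges.length ≤ H.n ^ h') α →
      MultiSectionApprox k c μ (fun H => H.edges.length ≤ H.n ^ h)
        fun n => C * α (n ^ (c + 1))) ∧
    -- parameterized complexity
    (∀ ε : ℝ, 0 ≤ ε → ((∃ q : ℚ, ε = (q : ℝ)) ∨ ThresholdPolyTime k ε) →
      MultiPartitionInXP k c ε μ) := by
  refine ⟨multiSectionReduces k c hk μ, (exists_multiSectionApprox k c hk μ).1,
    (exists_multiSectionApprox k c hk μ).2, fun ε hε h => ?_⟩
  have hk' : 0 < k := by omega
  refine multiPartitionInXP hk' c hε μ ?_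
  rcases h with ⟨q, rfl⟩ | h
  · exact polyFun_threshold_of_rat hk' hε
  · exact h.polyFun hk' hε
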